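/- Let $C=\{f=0\}\subset\mathbb{C}^2$ be a union of finitely many affine lines in general position at infinity (no two of the lines are parallel; $f$ is a reduced equation of $C$), and let $G=\pi_1(\mathbb{C}^2\setminus C)$, with any base point. Let $G_r^{(0)}=G$ and $G_r^{(n+1)}=\{g\in G_r^{(n)} : g^k\in[G_r^{(n)},G_r^{(n)}]\text{ for some }k\in\mathbb{Z}\setminus\{0\}\}$ be the rational derived series of $G$, and put $\Gamma_n=G/G_r^{(n+1)}$. Let $\bar\Gamma_n\le\Gamma_n$ be the kernel of the homomorphism $\Gamma_n\to\mathbb{Z}$ induced by the total linking number homomorphism $G\to\mathbb{Z}$, $\alpha\mapsto\mathrm{lk}(\alpha,C)$ (the winding number of $f\circ\alpha$ around $0$). The group ring $\mathbb{Z}\bar\Gamma_n$ is an Ore domain; let $\mathbb{K}_n$ be its skew field of fractions. The $n$-th order degree of $C$ is $$\delta_n(C)=\mathrm{rk}_{\mathbb{K}_n}\Bigl(\bigl(G_r^{(n+1)}/[G_r^{(n+1)},G_r^{(n+1)}]\bigr)\otimes_{\mathbb{Z}\bar\Gamma_n}\mathbb{K}_n\Bigr),$$ where $\bar\Gamma_n$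 acts on $G_r^{(n+1)}/[G_r^{(n+1)},G_r^{(n+1)}]=H_1(\mathbb{C}^2\setminus C;\mathbb{Z}\Gamma_n)$ by conjugation. Then: 1. if $C$ consists of three lines through a common point, then $\delta_n(C)=3$ for all $n\ge 0$; 2. if $C$ consists of four lines through a common point, then $\delta_n(C)=8$ for all $n\ge 0$; 3. if $C$ consists of five lines through a common point, then $\delta_n(C)=15$ for all $n\ge 0$; 4. if $C$ contains a line that meets the other lines only in nodes of $C$ (no point of this line lies on two different further lines), then $\delta_n(C)=0$ for all $n\ge 0$. -/

import Mathlib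

noncomputable section

namespace HigherOrderDegree

/-! ### Group rings of poly-torsion-free-abelian groups are Ore domains

The facts of this section are needed to form the skew field of fractions of such a group ring. -/

theorem uniqueProds_of_ker {G Q : Type*} [Group G] [Group Q] (f : G →* Q)
    [UniqueProds Q] [UniqueProds f.ker] : UniqueProds G where
  uniqueMul_of_nonempty {A B} hA hB := by
    classical
    obtain ⟨q₁, h₁, q₂, h₂, hu⟩ :=
      UniqueProds.uniqueMul_of_nonempty (hA.image f) (hB.image f)
    obtain ⟨a, ha, rfl⟩ := Finset.mem_image.1 h₁
    obtain ⟨b, hb, rfl⟩ := Finset.mem_image.1 h₂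
    let A₁ : Finset f.ker := A.preimage (fun n : f.ker => a * (n : G))
      (fun x _ y _ h => Subtype.ext (mul_left_cancel h))
    let B₁ : Finset f.ker := B.preimage (fun n : f.ker => (n : G) * b)
      (fun x _ y _ h => Subtype.ext (mul_right_cancel h))
    have hA₁ : A₁.Nonempty := ⟨1, Finset.mem_preimage.2 (by simpa using ha)⟩
    have hB₁ : B₁.Nonempty := ⟨1, Finset.mem_preimage.2 (by simpa using hb)⟩
    obtain ⟨n, hn, m, hm, hnm⟩ := UniqueProds.uniqueMul_of_nonempty hA₁ hB₁
    have hfn : f (n : G) = 1 := n.2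
    have hfm : f (m : G) = 1 := m.2
    have hn' : a * (n : G) ∈ A := (Finset.mem_preimage (f := fun n : f.ker => a * (n : G))).1 hn
    have hm' : (m : G) * b ∈ B := (Finset.mem_preimage (f := fun n : f.ker => (n : G) * b)).1 hm
    refine ⟨a * n, hn', m * b, hm', ?_⟩
    refine UniqueMul.of_image_filter (f : G →ₙ* Q) (aH := f a) (bH := f b) ?_ ?_ hu ?_
    · simp [hfn]
    · simp [hfm]
    · intro x y hx hy hxy
      rw [Finset.mem_filter] at hx hy
      have hx2 : f x = f a := hx.2
      have hy2 : f y = f b := hy.2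
      let x' : f.ker := ⟨a⁻¹ * x, by rw [MonoidHom.mem_ker, map_mul, map_inv, hx2, inv_mul_cancel]⟩
      let y' : f.ker := ⟨y * b⁻¹, by rw [MonoidHom.mem_ker, map_mul, map_inv, hy2, mul_inv_cancel]⟩
      have hx' : x' ∈ A₁ := Finset.mem_preimage.2 (by simpa [x'] using hx.1)
      have hy' : y' ∈ B₁ := Finset.mem_preimage.2 (by simpa [y'] using hy.1)
      have key := hnm hx' hy' (by
        apply Subtype.ext
        show a⁻¹ * x * (y * b⁻¹) = n * m
        have : a⁻¹ * x * (y * b⁻¹) = a⁻¹ * (x * y) * b⁻¹ := by group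
        rw [this, hxy]; group)
      constructor
      · rw [← key.1]; simp [x']
      · rw [← key.2]; simp [y']

theorem uniqueProds_of_commGroup {A : Type*} [CommGroup A] [IsMulTorsionFree A] :
    UniqueProds A := by
  have h : TwoUniqueSums (Additive A) :=
    TwoUniqueSums.of_injective_addHom ((DivisibleHull.coeAddMonoidHom (M := Additive A)).toAddHom)
      DivisibleHull.coe_injective inferInstance
  have h2 : UniqueProds (Multiplicative (Additive A)) := inferInstance
  exact h2

open scoped Pointwise in
theorem exists_card_mul_lt {Q : Type*} [CommGroup Q] [DecidableEq Q] (F : Finset Q) {m n : ℕ}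
    (h : m < n) : ∃ E : Finset Q, m * (E * F).card < n * E.card := by
  by_contra! H
  have h1 : ∀ k : ℕ, n ^ k ≤ m ^ k * (F ^ k).card := by
    intro k
    induction k with
    | zero => simp
    | succ k ih =>
      calc n ^ (k + 1) = n * n ^ k := by ring
        _ ≤ n * (m ^ k * (F ^ k).card) := Nat.mul_le_mul_left _ ih
        _ = m ^ k * (n * (F ^ k).card) := by ring
        _ ≤ m ^ k * (m * (F ^ k * F).card) := Nat.mul_le_mul_left _ (H _)
        _ = m ^ (k + 1) * (F ^ (k + 1)).card := by rw [← pow_succ F]; ring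
  have h2 : ∀ k : ℕ, (F ^ k).card ≤ (k + 1) ^ F.card := by
    intro k
    have hsub : ∀ k : ℕ, ∀ x ∈ F ^ k, ∃ e : F → Fin (k + 1), ∏ i : F, (i : Q) ^ (e i : ℕ) = x := by
      intro k
      induction k with
      | zero => intro x hx; exact ⟨fun _ => 0, by simpa [eq_comm] using hx⟩
      | succ k ih =>
        intro x hx
        rw [pow_succ] at hx
        obtain ⟨y, hy, z, hz, rfl⟩ := Finset.mem_mul.1 hx
        obtain ⟨e, rfl⟩ := ih y hy
        refine ⟨fun i => ⟨(e i : ℕ) + if i = ⟨z, hz⟩ then 1 else 0, ?_⟩, ?_⟩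
        · have := (e i).2
          split_ifs <;> omega
        · simp only [pow_add, Finset.prod_mul_distrib]
          congr 1
          rw [Finset.prod_eq_single ⟨z, hz⟩] <;> simp +contextual
    calc (F ^ k).card ≤ (Finset.univ.image
          (fun e : F → Fin (k + 1) => ∏ i : F, (i : Q) ^ (e i : ℕ))).card := by
          apply Finset.card_le_card
          intro x hx
          obtain ⟨e, he⟩ := hsub k x hx
          exact Finset.mem_image.2 ⟨e, Finset.mem_univ _, he⟩
      _ ≤ _ := Finset.card_image_le.trans (by simp)
  rcases Nat.eq_zero_or_pos m with rfl | hm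
  · have := h1 1
    simp at this
    omega
  have hr : (1 : ℝ) < (n : ℝ) / m := by
    rw [lt_div_iff₀ (by exact_mod_cast hm)]; simpa using h
  have ht := tendsto_pow_const_div_const_pow_of_one_lt F.card hr
  have ht2 := (Filter.tendsto_add_atTop_iff_nat 1).2 ht
  have hnm : (0 : ℝ) < m / n := by
    have : 0 < n := by omega
    positivity
  obtain ⟨k, hk⟩ := (ht2.eventually (gt_mem_nhds hnm)).exists
  have hmk : (0 : ℝ) < (m : ℝ) ^ k := by positivity
  have h3 : ((n : ℝ) / m) ^ k ≤ ((k : ℝ) + 1) ^ F.card := by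
    rw [div_pow, div_le_iff₀ hmk]
    have h4 : n ^ k ≤ m ^ k * (k + 1) ^ F.card := (h1 k).trans (Nat.mul_le_mul_left _ (h2 k))
    have : (n : ℝ) ^ k ≤ (m : ℝ) ^ k * ((k : ℝ) + 1) ^ F.card := by exact_mod_cast h4
    linarith [mul_comm ((m : ℝ) ^ k) (((k : ℝ) + 1) ^ F.card)]
  push_cast at hk
  rw [div_lt_iff₀ (by positivity), pow_succ] at hk
  have hmn : (m : ℝ) / n * (n / m) = 1 := by
    have : (n : ℝ) ≠ 0 := by norm_cast; omega
    field_simp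
  have h5 : (m : ℝ) / n * (((n : ℝ) / m) ^ k * (n / m)) = ((n : ℝ) / m) ^ k := by
    rw [mul_left_comm, hmn, mul_one]
  rw [h5] at hk
  exact absurd h3 (not_le.2 hk)

open scoped Pointwise in
theorem strongRankCondition_of_exact {N H Q : Type*} [Group N] [Group H] [CommGroup Q]
    (ι : N →* H) (f : H →* Q) (hι : Function.Injective ι) (hf : Function.Surjective f)
    (hex : ι.range = f.ker) (hN : StrongRankCondition (MonoidAlgebra ℤ N)) :
    StrongRankCondition (MonoidAlgebra ℤ H) := by
  classical
  have hfι : ∀ x, f (ι x) = 1 := fun x => by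
    have : ι x ∈ f.ker := hex ▸ ⟨x, rfl⟩
    exact this
  choose s hs using hf
  let j : MonoidAlgebra ℤ N →+* MonoidAlgebra ℤ H := MonoidAlgebra.mapDomainRingHom ℤ ι
  -- the coefficient of an element in the coset of `s q`
  have hinj : ∀ q, Function.Injective (fun x : N => ι x * s q) := fun q x y h =>
    hι (mul_right_cancel h)
  let θ : Q → MonoidAlgebra ℤ H →+ MonoidAlgebra ℤ N := fun q =>
    { toFun := fun b => MonoidAlgebra.ofCoeff
        (Finsupp.comapDomain (fun x : N => ι x * s q) b.coeff (hinj q).injOn)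
      map_zero' := by ext; simp
      map_add' := fun a b => by ext; simp }
  have hθ : ∀ q b x, (θ q b).coeff x = b.coeff (ι x * s q) := fun q b x => rfl
  have hjs : ∀ x r, j (MonoidAlgebra.single x r) = MonoidAlgebra.single (ι x) r := fun x r => by
    simp [j]
  have hθmul : ∀ q a b, θ q (j a * b) = a * θ q b := by
    intro q a b
    induction a using MonoidAlgebra.induction_linear with
    | zero => simp
    | add a₁ a₂ h₁ h₂ => rw [map_add, add_mul, map_add, h₁, h₂, add_mul]
    | single x r =>
      ext y
      rw [hθ, hjs, MonoidAlgebra.coeff_single_mul_apply, MonoidAlgebra.coeff_single_mul_apply, hθ]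
      simp [mul_assoc]
  have hθs : ∀ q q', θ q (MonoidAlgebra.single (s q') 1) = if q = q' then 1 else 0 := by
    intro q q'
    ext y
    rw [hθ]
    split_ifs with h
    · subst h
      rw [MonoidAlgebra.one_def, MonoidAlgebra.coeff_single, MonoidAlgebra.coeff_single,
        Finsupp.single_apply, Finsupp.single_apply]
      congr 1
      rw [eq_comm (a := s q), eq_comm (a := (1 : N)), mul_eq_right, ← map_one ι, hι.eq_iff]
    · rw [MonoidAlgebra.coeff_single, Finsupp.single_apply, if_neg]
      · rfl
      · intro h'
        apply h
        have := congrArg f h'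
        rw [map_mul, hfι, hs, hs, one_mul] at this
        exact this.symm
  -- an element all of whose coset coefficients vanish is zero
  have hθ0 : ∀ b, (∀ q, θ q b = 0) → b = 0 := by
    intro b hb
    ext h
    have : h * (s (f h))⁻¹ ∈ ι.range := by
      rw [hex, MonoidHom.mem_ker, map_mul, map_inv, hs, mul_inv_cancel]
    obtain ⟨x, hx⟩ := this
    have h1 := congrArg (fun a => MonoidAlgebra.coeff a x) (hb (f h))
    simp only [hθ, hx, inv_mul_cancel_right] at h1
    simpa using h1
  have hsupp : ∀ q b, θ q b ≠ 0 → q ∈ b.coeff.support.image f := by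
    intro q b hb
    by_contra hq
    apply hb
    ext x
    rw [hθ]
    by_contra hx
    apply hq
    refine Finset.mem_image.2 ⟨ι x * s q, Finsupp.mem_support_iff.2 (by simpa using hx), ?_⟩
    rw [map_mul, hfι, hs, one_mul]
  constructor
  intro n m φ hφ
  by_contra hlt
  rw [not_le] at hlt
  let F : Finset Q := Finset.univ.biUnion fun i : Fin n => Finset.univ.biUnion fun k : Fin m =>
    ((φ (Pi.single i 1)) k).coeff.support.image f
  obtain ⟨E, hE⟩ := exists_card_mul_lt F hlt
  -- the restriction of the map to the pieces indexed by `E`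
  let u : (E × Fin n → MonoidAlgebra ℤ N) → Fin n → MonoidAlgebra ℤ H := fun a i =>
    ∑ q : E, j (a (q, i)) * MonoidAlgebra.single (s q) 1
  have huadd : ∀ a b, u (a + b) = u a + u b := fun a b => by
    funext i; simp [u, add_mul, Finset.sum_add_distrib]
  have husmul : ∀ (c : MonoidAlgebra ℤ N) a, u (c • a) = j c • u a := fun c a => by
    funext i; simp [u, Finset.mul_sum, mul_assoc]
  let Φ : (E × Fin n → MonoidAlgebra ℤ N) →ₗ[MonoidAlgebra ℤ N]
      ((E * F : Finset Q) × Fin m → MonoidAlgebra ℤ N) :=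
    { toFun := fun a p => θ p.1 (φ (u a) p.2)
      map_add' := fun a b => by funext p; simp [huadd]
      map_smul' := fun c a => by funext p; simp [husmul, hθmul] }
  have hΦ : Function.Injective Φ := by
    rw [← LinearMap.ker_eq_bot, LinearMap.ker_eq_bot']
    intro a ha
    have hzero : φ (u a) = 0 := by
      funext k
      apply hθ0
      intro q
      by_cases hq : q ∈ E * F
      · exact congrFun ha (⟨q, hq⟩, k)
      by_contra hne
      apply hq
      have hexp : φ (u a) k = ∑ i : Fin n, ∑ q' : E,
          j (a (q', i)) * (MonoidAlgebra.single (s q') 1 * φ (Pi.single i 1) k) := by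
        have : u a = ∑ i, u a i • Pi.single i (1 : MonoidAlgebra ℤ H) := by
          rw [← pi_eq_sum_univ']
        rw [this, map_sum, Finset.sum_apply]
        refine Finset.sum_congr rfl fun i _ => ?_
        rw [map_smul, Pi.smul_apply, smul_eq_mul]
        simp only [u, Finset.sum_mul, mul_assoc]
      rw [hexp, map_sum] at hne
      obtain ⟨i, -, hi⟩ := Finset.exists_ne_zero_of_sum_ne_zero hne
      rw [map_sum] at hi
      obtain ⟨q', -, hq'⟩ := Finset.exists_ne_zero_of_sum_ne_zero hi
      rw [hθmul] at hq'
      have h2 := hsupp _ _ (right_ne_zero_of_mul hq')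
      obtain ⟨h, hh, rfl⟩ := Finset.mem_image.1 h2
      have h3 := MonoidAlgebra.support_coeff_mul_subset _ _ hh
      obtain ⟨x, hx, y, hy, rfl⟩ := Finset.mem_mul.1 h3
      rw [map_mul]
      refine Finset.mul_mem_mul ?_ ?_
      · have := Finsupp.support_single_subset hx
        rw [Finset.mem_singleton.1 this, hs]
        exact q'.2
      · exact Finset.mem_biUnion.2 ⟨i, Finset.mem_univ _, Finset.mem_biUnion.2
          ⟨k, Finset.mem_univ _, Finset.mem_image_of_mem _ hy⟩⟩
    have hu0 : u a = 0 := hφ (by rw [hzero, map_zero])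
    funext p
    obtain ⟨q, i⟩ := p
    have h1 := congrArg (θ q) (congrFun hu0 i)
    simp only [u, map_sum, hθmul, hθs, Pi.zero_apply, map_zero] at h1
    rw [Finset.sum_eq_single q] at h1
    · simpa using h1
    · intro q' _ hne
      rw [if_neg, mul_zero]
      exact fun h => hne (Subtype.ext h.symm)
    · simp
  have hcard := card_le_of_injective _ Φ hΦ
  simp only [Fintype.card_prod, Fintype.card_coe, Fintype.card_fin] at hcard
  rw [mul_comm, mul_comm _ m] at hcard
  omega

theorem strongRankCondition_of_isSolvable (Γ : Type*) [Group Γ] [Group.IsSolvable Γ] :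
    StrongRankCondition (MonoidAlgebra ℤ Γ) := by
  obtain ⟨k, hk⟩ := Group.IsSolvable.solvable (G := Γ)
  have key : ∀ i ≤ k, StrongRankCondition (MonoidAlgebra ℤ (derivedSeries Γ (k - i))) := by
    intro i
    induction i with
    | zero =>
      intro _
      rw [Nat.sub_zero, hk]
      let _ : CommGroup (⊥ : Subgroup Γ) :=
        { (inferInstance : Group (⊥ : Subgroup Γ)) with
          mul_comm := fun a b => Subsingleton.elim _ _ }
      exact commRing_strongRankCondition (MonoidAlgebra ℤ (⊥ : Subgroup Γ))
    | succ i ih =>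
      intro hi
      have hN := ih (by omega)
      have hkk : k - i = (k - (i + 1)) + 1 := by omega
      rw [hkk] at hN
      set H := derivedSeries Γ (k - (i + 1)) with hH
      have hle : derivedSeries Γ (k - (i + 1) + 1) ≤ H := derivedSeries_antitone _ (Nat.le_succ _)
      refine strongRankCondition_of_exact (Subgroup.inclusion hle) Abelianization.of
        (Subgroup.inclusion_injective hle) (QuotientGroup.mk_surjective) ?_ hN
      rw [Abelianization.ker_of, Subgroup.inclusion_range]
      apply Subgroup.map_injective H.subtype_injective
      rw [Subgroup.map_subgroupOf_eq_of_le hle, Subgroup.map_subtype_commutator, derivedSeries_succ]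
  have := key k le_rfl
  rw [Nat.sub_self, derivedSeries_zero] at this
  refine strongRankCondition_of_exact (⊤ : Subgroup Γ).subtype (1 : Γ →* Unit)
    Subtype.val_injective (fun _ => ⟨1, rfl⟩) ?_ this
  rw [Subgroup.range_subtype, MonoidHom.ker_one]

/-! ### The rational derived series -/

section Group

variable {G : Type*} [Group G]

theorem mem_commutator_iff (H : Subgroup G) (x : H) :
    (x : G) ∈ ⁅H, H⁆ ↔ Abelianization.of x = 1 := by
  rw [← MonoidHom.mem_ker, Abelianization.ker_of, ← Subgroup.map_subtype_commutator,
    Subgroup.mem_map]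
  constructor
  · rintro ⟨y, hy, hyx⟩
    rwa [← Subtype.ext (a1 := y) (a2 := x) hyx]
  · exact fun h => ⟨x, h, rfl⟩

/-- The subgroup of those `g ∈ H` with a nonzero power in the commutator subgroup `[H, H]`. -/
def rationalCommutator (H : Subgroup G) : Subgroup G where
  carrier := {g | g ∈ H ∧ ∃ k : ℤ, k ≠ 0 ∧ g ^ k ∈ ⁅H, H⁆}
  one_mem' := ⟨H.one_mem, 1, one_ne_zero, by simp⟩
  mul_mem' := by
    rintro a b ⟨ha, k, hk, hak⟩ ⟨hb, l, hl, hbl⟩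
    refine ⟨H.mul_mem ha hb, k * l, mul_ne_zero hk hl, ?_⟩
    have h1 := (mem_commutator_iff H (⟨a, ha⟩ ^ k)).1 hak
    have h2 := (mem_commutator_iff H (⟨b, hb⟩ ^ l)).1 hbl
    refine (mem_commutator_iff H ((⟨a, ha⟩ * ⟨b, hb⟩) ^ (k * l))).2 ?_
    rw [map_zpow] at h1 h2 ⊢
    rw [map_mul, mul_zpow, zpow_mul, h1, one_zpow, one_mul, mul_comm k l, zpow_mul, h2, one_zpow]
  inv_mem' := by
    rintro a ⟨ha, k, hk, hak⟩
    exact ⟨H.inv_mem ha, k, hk, by rw [inv_zpow]; exact Subgroup.inv_mem _ hak⟩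

instance rationalCommutator_normal (H : Subgroup G) [hH : H.Normal] :
    (rationalCommutator H).Normal where
  conj_mem := by
    rintro a ⟨ha, k, hk, hak⟩ g
    exact ⟨hH.conj_mem a ha g, k, hk, by
      rw [conj_zpow]; exact (Subgroup.commutator_normal H H).conj_mem _ hak g⟩

variable (G) in
/-- The rational derived series `G_r^{(n)}` of a group. -/
def rationalDerivedSeries : ℕ → Subgroup G
  | 0 => ⊤
  | n + 1 => rationalCommutator (rationalDerivedSeries n)

instance rationalDerivedSeries_normal (n : ℕ) : (rationalDerivedSeries G n).Normal := by
  induction n with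
  | zero => exact (inferInstance : (⊤ : Subgroup G).Normal)
  | succ n ih => exact rationalCommutator_normal _

theorem derivedSeries_le_rationalDerivedSeries (n : ℕ) :
    derivedSeries G n ≤ rationalDerivedSeries G n := by
  induction n with
  | zero => exact le_top
  | succ n ih =>
    intro g hg
    rw [derivedSeries_succ] at hg
    have h := Subgroup.commutator_mono ih ih hg
    exact ⟨Subgroup.commutator_le_self _ h, 1, one_ne_zero, by simpa using h⟩

instance isSolvable_quotient (n : ℕ) : Group.IsSolvable (G ⧸ rationalDerivedSeries G n) := by
  refine ⟨⟨n, ?_⟩⟩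
  rw [← map_derivedSeries_eq (QuotientGroup.mk'_surjective (rationalDerivedSeries G n)) n,
    Subgroup.map_eq_bot_iff, QuotientGroup.ker_mk']
  exact derivedSeries_le_rationalDerivedSeries n

instance uniqueProds_quotient (n : ℕ) : UniqueProds (G ⧸ rationalDerivedSeries G n) := by
  induction n with
  | zero =>
    have : Subsingleton (G ⧸ rationalDerivedSeries G 0) :=
      QuotientGroup.subsingleton_quotient_top
    exact ⟨fun {A B} ⟨a, ha⟩ ⟨b, hb⟩ => ⟨a, ha, b, hb, UniqueMul.of_subsingleton⟩⟩
  | succ n ih =>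
    let f : G ⧸ rationalDerivedSeries G (n + 1) →* G ⧸ rationalDerivedSeries G n :=
      QuotientGroup.map _ _ (MonoidHom.id G) (fun g hg => hg.1)
    have hker : ∀ x : f.ker, ∃ g ∈ rationalDerivedSeries G n,
        (QuotientGroup.mk g : G ⧸ rationalDerivedSeries G (n + 1)) = x := by
      rintro ⟨x, hx⟩
      obtain ⟨g, rfl⟩ := QuotientGroup.mk_surjective x
      exact ⟨g, (QuotientGroup.eq_one_iff g).1 hx, rfl⟩
    have hcomm : ∀ x y : f.ker, x * y = y * x := by
      intro x y
      obtain ⟨g, hg, hgx⟩ := hker x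
      obtain ⟨h, hh, hhy⟩ := hker y
      have hc : (h * g)⁻¹ * (g * h) ∈ rationalDerivedSeries G (n + 1) := by
        have h1 := Subgroup.commutator_mem_commutator (inv_mem hg) (inv_mem hh)
        rw [commutatorElement_def, inv_inv, inv_inv] at h1
        have h2 : (h * g)⁻¹ * (g * h) = g⁻¹ * h⁻¹ * g * h := by group
        rw [h2]
        exact ⟨Subgroup.commutator_le_self _ h1, 1, one_ne_zero, by simpa using h1⟩
      apply Subtype.ext
      rw [Subgroup.coe_mul, Subgroup.coe_mul, ← hgx, ← hhy]
      exact (QuotientGroup.eq.2 hc).symm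
    let _ : CommGroup f.ker := { (inferInstance : Group f.ker) with mul_comm := hcomm }
    have htf : IsMulTorsionFree f.ker := by
      refine ⟨fun k hk x y hxy => ?_⟩
      have hxy' : (x * y⁻¹) ^ k = 1 := by
        rw [mul_pow, inv_pow]
        exact mul_inv_eq_one.2 hxy
      obtain ⟨g, hg, hgx⟩ := hker (x * y⁻¹)
      have hgk : g ^ k ∈ rationalDerivedSeries G (n + 1) := by
        rw [← QuotientGroup.eq_one_iff, QuotientGroup.mk_pow, hgx, ← Subgroup.coe_pow, hxy']
        rfl
      obtain ⟨-, l, hl, hgl⟩ := hgk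
      have hg1 : g ∈ rationalDerivedSeries G (n + 1) :=
        ⟨hg, k * l, mul_ne_zero (by exact_mod_cast hk) hl, by rwa [zpow_mul, zpow_natCast]⟩
      have : x * y⁻¹ = 1 := Subtype.ext (by rw [← hgx]; exact (QuotientGroup.eq_one_iff g).2 hg1)
      exact mul_inv_eq_one.1 this
    have : UniqueProds f.ker := uniqueProds_of_commGroup
    exact uniqueProds_of_ker f

/-! ### Higher-order degrees of a group -/

variable (G) in
/-- The group `Γ_n = G / G_r^{(n+1)}`. -/
abbrev Gam (n : ℕ) : Type _ := G ⧸ rationalDerivedSeries G (n + 1)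

/-- The kernel of the homomorphism induced on `Γ_n` by a homomorphism `ψ` that vanishes
on `G_r^{(n+1)}`, as the image of the kernel of `ψ`. -/
def gamBar {P : Type*} [Group P] (ψ : G →* P) (n : ℕ) : Subgroup (Gam G n) :=
  ψ.ker.map (QuotientGroup.mk' (rationalDerivedSeries G (n + 1)))

section Ore

variable (n : ℕ) (Λ : Subgroup (Gam G n))

instance uniqueProds_subgroup : UniqueProds Λ :=
  UniqueProds.of_injective_mulHom (Λ.subtype : Λ →ₙ* Gam G n) Λ.subtype_injective inferInstance

/-- The integral group ring of a subgroup of `Γ_n` satisfies the Ore condition. -/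
instance oreSet_groupRing : OreLocalization.OreSet (nonZeroDivisors (MonoidAlgebra ℤ Λ)) :=
  have := strongRankCondition_of_isSolvable Λ
  Classical.choice (nonempty_oreSet_of_strongRankCondition (R := MonoidAlgebra ℤ Λ))

/-- The skew field of fractions of the integral group ring of a subgroup of `Γ_n`. -/
abbrev SkewField : Type _ :=
  OreLocalization (nonZeroDivisors (MonoidAlgebra ℤ Λ)) (MonoidAlgebra ℤ Λ)

end Ore

/-- The action of `G` by conjugation on the abelianization `N / [N, N]` of a normal subgroup. -/
def conjAction (N : Subgroup G) [N.Normal] : Representation ℤ G (Additive (Abelianization N)) where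
  toFun g := (MonoidHom.toAdditive
    (Abelianization.map (MulAut.conjNormal g : N ≃* N).toMonoidHom)).toIntLinearMap
  map_one' := by
    apply LinearMap.ext
    intro x
    induction x using Additive.rec with | ofMul x => ?_
    induction x using QuotientGroup.induction_on with | H x => ?_
    refine congrArg (fun y : N => Additive.ofMul (Abelianization.of y)) (Subtype.ext ?_)
    simp
  map_mul' g h := by
    apply LinearMap.ext
    intro x
    induction x using Additive.rec with | ofMul x => ?_
    induction x using QuotientGroup.induction_on with | H x => ?_
    refine congrArg (fun y : N => Additive.ofMul (Abelianization.of y)) (Subtype.ext ?_)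
    simp

theorem conjAction_of_mem (N : Subgroup G) [N.Normal] (g : G) (hg : g ∈ N) :
    conjAction N g = 1 := by
  apply LinearMap.ext
  intro x
  induction x using Additive.rec with | ofMul x => ?_
  induction x using QuotientGroup.induction_on with | H x => ?_
  have h1 : (MulAut.conjNormal g x : N) = ⟨g, hg⟩ * x * ⟨g, hg⟩⁻¹ := Subtype.ext (by simp)
  have h2 : Abelianization.of (MulAut.conjNormal g x : N) = Abelianization.of x := by
    rw [h1, map_mul, map_mul, map_inv, mul_right_comm, mul_inv_cancel, one_mul]
  exact congrArg Additive.ofMul h2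

variable (G) in
/-- The `n`-th order integral Alexander module `G_r^{(n+1)} / [G_r^{(n+1)}, G_r^{(n+1)}]`, on which
`Γ_n` acts by conjugation. -/
def alexanderModule (n : ℕ) :
    Representation ℤ (Gam G n) (Additive (Abelianization (rationalDerivedSeries G (n + 1)))) :=
  QuotientGroup.lift _ (conjAction (rationalDerivedSeries G (n + 1)))
    (fun g hg => conjAction_of_mem _ g hg)

/-- The `n`-th order integral Alexander module, with the action of a subgroup of `Γ_n`. -/
def restrictedAlexanderModule (n : ℕ) (Λ : Subgroup (Gam G n)) :
    Representation ℤ Λ (Additive (Abelianization (rationalDerivedSeries G (n + 1)))) :=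
  MonoidHom.comp (alexanderModule G n) Λ.subtype

/-- The `n`-th order degree of `G` with respect to `ψ`: the rank of the `n`-th order Alexander
module over the group ring of `ker ψ̄ ≤ Γ_n`, that is, the dimension over the skew field of
fractions `𝕂_n` of this group ring of the vector space obtained by extending scalars
(localizing the module at the nonzero elements of the group ring). It is a cardinal number, so
that the value is meaningful also when it is infinite. -/
def degree {P : Type*} [Group P] (ψ : G →* P) (n : ℕ) : Cardinal :=
  Module.rank (SkewField n (gamBar ψ n))
    (OreLocalization (nonZeroDivisors (MonoidAlgebra ℤ (gamBar ψ n)))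
      (restrictedAlexanderModule n (gamBar ψ n)).asModule)

end Group

/-! ### Plane curves and line arrangements -/

/-- The complement in `ℂ²` of the affine plane curve `f = 0`. -/
def Complement (f : MvPolynomial (Fin 2) ℂ) : Type :=
  {p : Fin 2 → ℂ // MvPolynomial.eval p f ≠ 0}

instance (f : MvPolynomial (Fin 2) ℂ) : TopologicalSpace (Complement f) :=
  instTopologicalSpaceSubtype

/-- The map `f : ℂ² ∖ {f = 0} → ℂ ∖ {0}`. -/
def evalMap (f : MvPolynomial (Fin 2) ℂ) : C(Complement f, {z : ℂ // z ≠ 0}) where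
  toFun p := ⟨MvPolynomial.eval p.1 f, p.2⟩
  continuous_toFun := by
    refine Continuous.subtype_mk ?_ _
    exact (MvPolynomial.continuous_eval f).comp continuous_subtype_val

/-- The total linking number homomorphism `lk : π₁(ℂ² ∖ C) → ℤ` of a reduced curve `C = {f = 0}`.
The linking number of a loop `γ` with `C` is the winding number of `f ∘ γ` around the origin, so
`lk` is the homomorphism induced by `f` on fundamental groups, with `ℤ` in the form of
the fundamental group of `ℂ ∖ {0}`. -/
def linking (f : MvPolynomial (Fin 2) ℂ) (u : Complement f) :
    FundamentalGroup (Complement f) u →* FundamentalGroup {z : ℂ // z ≠ 0} (evalMap f u) :=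
  FundamentalGroup.map (evalMap f) u

/-- The `n`-th order degree `δ_n(C)` of the reduced affine plane curve `C = {f = 0}`, computed with
the fundamental group of the complement at the base point `u`. -/
def curveDegree (f : MvPolynomial (Fin 2) ℂ) (u : Complement f) (n : ℕ) : Cardinal :=
  degree (linking f u) n

/-- An equation `a x + b y + c = 0` of an affine line in `ℂ²`. -/
structure Line where
  a : ℂ
  b : ℂ
  c : ℂ
  ne_zero : a ≠ 0 ∨ b ≠ 0

namespace Line

/-- The linear polynomial `a x + b y + c`. -/
def poly (l : Line) : MvPolynomial (Fin 2) ℂ :=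
  MvPolynomial.C l.a * MvPolynomial.X 0 + MvPolynomial.C l.b * MvPolynomial.X 1 + MvPolynomial.C l.c

/-- The points of the line. -/
def points (l : Line) : Set (Fin 2 → ℂ) := {p | MvPolynomial.eval p l.poly = 0}

/-- Two lines are parallel (possibly equal), that is, they have the same point at infinity. -/
def Parallel (l l' : Line) : Prop := l.a * l'.b = l'.a * l.b

end Line

section Arrangement

variable {m : ℕ} (L : Fin m → Line)

/-- The union of the lines is in general position at infinity: its projective completion is
transverse to the line at infinity, that is, different lines have different points at infinity. In
particular, the lines are pairwise distinct. -/
def GeneralPositionAtInfinity : Prop := ∀ i j, i ≠ j → ¬ (L i).Parallel (L j)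

/-- All lines pass through a common point. -/
def Concurrent : Prop := ∃ p, ∀ i, p ∈ (L i).points

/-- Some line of the arrangement meets the other lines only in nodes of the arrangement: no point
of this line lies on two different further lines. -/
def HasNodalLine : Prop :=
  ∃ i, ∀ j k, j ≠ i → k ≠ i → j ≠ k → ∀ p ∈ (L i).points, ¬ (p ∈ (L j).points ∧ p ∈ (L k).points)

/-- The defining polynomial of the union of the lines. -/
def arrangementPoly : MvPolynomial (Fin 2) ℂ := ∏ i, (L i).poly

end Arrangement

end HigherOrderDegree

end

/-! For `k + 1` concurrent lines, the equation `z` of one line and the slope `t` split the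
complement as `ℂ* × (ℂ ∖ k points)`, with `f` a constant times `z ^ (k + 1) * ∏ (t - c j)`. Its
group is `ℤ × F` with `F` free of rank `k`. A loop in the kernel of the total linking number is
determined by its `F`-component, and the possible components are the words whose winding degree is
divisible by `k + 1`. With `k = l + 1`, the kernel is therefore a subgroup of index `l + 2` in a
free group of rank `l + 1`, hence free of rank `(l + 2) * l + 1`. The module defining `δ_n` is then
the relation module of a presentation of `Γ̄_n` by these generators. Fox calculus identifies it with
the kernel of a nonzero linear form on a free module of rank `(l + 2) * l + 1`, so its rank is `(l +
2) * l`, that is `3`, `8`, `15` for `l = 1, 2, 3` (`degree_of_product`, `degree_eq_of_free`,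
`rank_relationModule`, `exists_freeGroup_hom_dvd`, `stripHom_injective`, `stripHom_surjective`).

For a nodal line, take it as `y = 0`; the other lines are `x = a i * y + b i`, with the `a i`
distinct (no parallels) and the `b i` distinct (nodes only). With `x` very large, rotating `y` once
about `0` gives a central loop: every path in a fibre can be dragged around by an isotopy that is
trivial near infinity (`rotClass_mem_center`). The line at infinity also meets the other lines only
in nodes, so exchanging it with `y = 0` yields a second central loop (`exists_central_swap`). A
combination of the two has total linking number zero but links another line, so it is a nontrivial
central element of `Γ̄_n`. Such an element minus one annihilates the module, and the rank is zero
(`degree_eq_zero_of_central`). If there is no other line, the kernel of the linking number is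
already trivial. -/

noncomputable section
namespace HigherOrderDegree

/-! ### Ranks of modules over the skew field of fractions of an Ore domain -/

section OreRank

open scoped nonZeroDivisors
open OreLocalization

variable {R : Type*} [Ring R] [OreSet R⁰] {M : Type*} [AddCommGroup M] [Module R M]

/-- A common left denominator. The denominator of the next fraction is taken after multiplying by
the previous ones, so multiplying on the left by it does not spoil what has been cleared. -/
theorem exists_smul_mem_range_oreDiv_one {ι : Type*} (s : Finset ι) (g : ι → OreLocalization R⁰ R) :
    ∃ a ∈ R⁰, ∃ r : ι → R, ∀ i ∈ s, (a : R) • g i = r i /ₒ (1 : R⁰) := by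
  classical
  induction s using Finset.induction_on with
  | empty => exact ⟨1, one_mem _, fun _ => 0, by simp⟩
  | insert i s hi ih =>
    obtain ⟨a, ha, r, hr⟩ := ih
    obtain ⟨x, t, hxt⟩ : ∃ x : R, ∃ t : R⁰, a • g i = x /ₒ t := by
      induction a • g i using OreLocalization.ind with | _ x t => exact ⟨x, t, rfl⟩
    refine ⟨t * a, mul_mem t.2 ha, fun j => if j = i then x else t * r j, ?_⟩
    intro j hj
    rw [mul_smul]
    by_cases hji : j = i
    · subst hji
      simp only [if_true]
      rw [hxt, ← oreDiv_one_smul (S := R⁰) (t : R), OreLocalization.smul_cancel]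
    · simp only [if_neg hji]
      rw [hr j (Finset.mem_of_mem_insert_of_ne hj hji), smul_oreDiv_one, smul_eq_mul]

theorem oreDiv_one_eq_zero_iff {m : M} :
    (m /ₒ (1 : R⁰)) = 0 ↔ ∃ a ∈ R⁰, (a : R) • m = 0 := by
  rw [OreLocalization.zero_def, oreDiv_eq_iff]
  constructor
  · rintro ⟨u, v, h1, h2⟩
    refine ⟨v, ?_, ?_⟩
    · simp only [OneMemClass.coe_one, mul_one] at h2
      rw [← h2]; exact u.2
    · rw [← h1, smul_zero]
  · rintro ⟨a, ha, h⟩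
    exact ⟨⟨a, ha⟩, a, by simp [h], by simp⟩

def oreDivOne : M →+ OreLocalization R⁰ M where
  toFun m := m /ₒ 1
  map_zero' := OreLocalization.zero_def.symm
  map_add' _ _ := add_oreDiv.symm

/-- The images of the `v i` form a basis: a common denominator turns a relation over the skew field
into one over `R`, and `ht` puts every element into the span after a division. -/
theorem rank_oreLocalization [NoZeroDivisors R] [Nontrivial R] {d : ℕ} (v : Fin d → M)
    (hv : LinearIndependent R v)
    (ht : ∀ m, ∃ s ∈ R⁰, (s : R) • m ∈ Submodule.span R (Set.range v)) :
    Module.rank (OreLocalization R⁰ R) (OreLocalization R⁰ M) = d := by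
  have hli : LinearIndependent (OreLocalization R⁰ R)
      (fun i => (v i /ₒ (1 : R⁰) : OreLocalization R⁰ M)) := by
    rw [Fintype.linearIndependent_iff]
    intro g hg
    obtain ⟨a, ha, r, hr⟩ := exists_smul_mem_range_oreDiv_one Finset.univ g
    have h1 : (oreDivOne (∑ i, r i • v i) : OreLocalization R⁰ M) = 0 := by
      rw [map_sum]
      have : ∀ i, (oreDivOne (r i • v i) : OreLocalization R⁰ M) =
          a • (g i • (v i /ₒ (1 : R⁰))) := by
        intro i
        rw [← smul_assoc, hr i (Finset.mem_univ _), smul_div_one]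
        rfl
      rw [Finset.sum_congr rfl fun i _ => this i, ← Finset.smul_sum, hg, smul_zero]
    obtain ⟨b, hb, h2⟩ := oreDiv_one_eq_zero_iff.1 h1
    rw [Finset.smul_sum] at h2
    simp only [smul_smul] at h2
    have h3 := Fintype.linearIndependent_iff.1 hv _ h2
    intro i
    have h4 : r i = 0 := (mul_eq_zero.1 (h3 i)).resolve_left (nonZeroDivisors.ne_zero hb)
    have h5 := hr i (Finset.mem_univ _)
    rw [h4, OreLocalization.zero_oreDiv, ← oreDiv_one_smul (S := R⁰) a, smul_eq_mul] at h5
    refine (mul_eq_zero.1 h5).resolve_left fun h => ?_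
    obtain ⟨c, hc, h6⟩ := oreDiv_one_eq_zero_iff.1 h
    exact (mul_ne_zero (nonZeroDivisors.ne_zero hc) (nonZeroDivisors.ne_zero ha)) h6
  have hsp : ⊤ ≤ Submodule.span (OreLocalization R⁰ R)
      (Set.range (fun i => (v i /ₒ (1 : R⁰) : OreLocalization R⁰ M))) := by
    rintro x -
    induction x using OreLocalization.ind with | _ m t => ?_
    obtain ⟨s, hs, hm⟩ := ht m
    have h1 : (m /ₒ t : OreLocalization R⁰ M) =
        ((1 : R) /ₒ (⟨s, hs⟩ * t : R⁰)) • ((s • m) /ₒ (1 : R⁰)) := by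
      rw [OreLocalization.one_div_smul, one_mul, OreLocalization.expand' m t ⟨s, hs⟩]
      rfl
    rw [h1]
    refine Submodule.smul_mem _ _ ?_
    obtain ⟨r, hr⟩ := (Submodule.mem_span_range_iff_exists_fun R).1 hm
    have h2 : (s • m) /ₒ (1 : R⁰) = ∑ i, (r i /ₒ (1 : R⁰)) • (v i /ₒ (1 : R⁰)) := by
      change (oreDivOne (s • m) : OreLocalization R⁰ M) = _
      rw [← hr, map_sum]
      refine Finset.sum_congr rfl fun i _ => ?_
      rw [smul_div_one]; rfl
    rw [h2]
    exact Submodule.sum_mem _ fun i _ => Submodule.smul_mem _ _ (Submodule.subset_span ⟨i, rfl⟩)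
  rw [rank_eq_card_basis (Module.Basis.mk hli hsp), Fintype.card_fin]

/-- The kernel of a nonzero linear form on `R^(d+1)` has rank `d`. -/
theorem rank_oreLocalization_ker [NoZeroDivisors R] [Nontrivial R] {d : ℕ} {κ : Type*} [Fintype κ]
    (hκ : Fintype.card κ = d + 1) (D : M →ₗ[R] (κ → R)) (hD : Function.Injective D)
    (r : κ → R) (hex : ∀ c : κ → R, c ∈ LinearMap.range D ↔ ∑ i, c i * r i = 0)
    {i₀ : κ} (hi₀ : r i₀ ≠ 0) :
    Module.rank (OreLocalization R⁰ R) (OreLocalization R⁰ M) = d := by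
  classical
  let κ' := {i : κ // i ≠ i₀}
  have hκ' : Fintype.card κ' = d := by
    rw [Fintype.card_subtype_compl, hκ, Fintype.card_subtype_eq]; rfl
  let e : Fin d ≃ κ' := (Fintype.equivFinOfCardEq hκ').symm
  let s₀ : R⁰ := ⟨r i₀, mem_nonZeroDivisors_of_ne_zero hi₀⟩
  let q : κ → R := fun i => oreNum (r i) s₀
  let s : κ → R⁰ := fun i => oreDenom (r i) s₀
  have hqs : ∀ i, (s i : R) * r i = q i * r i₀ := fun i => ore_eq (r i) s₀
  -- The Ore condition `s j * r j = q j * r i₀` solves the linear equation with only the coordinates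
  -- `j` and `i₀` nonzero. This gives one vector for each of the `d` indices `j ≠ i₀`.
  have hmem : ∀ j : κ', Pi.single (j : κ) (s j : R) - Pi.single i₀ (q j) ∈ LinearMap.range D := by
    intro j
    rw [hex]
    simp only [Pi.sub_apply, sub_mul, Finset.sum_sub_distrib, Pi.single_apply, ite_mul, zero_mul,
      Finset.sum_ite_eq', Finset.mem_univ, if_true]
    rw [hqs, sub_self]
  choose w hw using hmem
  have hcoord : ∀ (i j : κ'), D (w j) i = if i = j then (s j : R) else 0 := by
    intro i j
    rw [hw, Pi.sub_apply, Pi.single_apply, Pi.single_apply, if_neg i.2, sub_zero]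
    by_cases h : i = j
    · rw [if_pos h, if_pos (congrArg _ h)]
    · rw [if_neg h, if_neg (fun h' => h (Subtype.ext h'))]
  have hlin : ∀ (g : Fin d → R) (j : Fin d), D (∑ i, g i • w (e i)) (e j) = g j * s (e j) := by
    intro g j
    rw [map_sum, Finset.sum_apply, Finset.sum_eq_single j]
    · rw [map_smul, Pi.smul_apply, hcoord, if_pos rfl, smul_eq_mul]
    · intro i _ hij
      rw [map_smul, Pi.smul_apply, hcoord, if_neg (fun h => hij (e.injective h.symm)), smul_zero]
    · simp
  refine rank_oreLocalization (fun j => w (e j)) ?_ ?_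
  · rw [Fintype.linearIndependent_iff]
    intro g hg j
    have := hlin g j
    rw [hg, map_zero, Pi.zero_apply, eq_comm] at this
    exact (mul_eq_zero.1 this).resolve_right (nonZeroDivisors.coe_ne_zero _)
  · intro m
    obtain ⟨a, ha, b, hb⟩ : ∃ a ∈ R⁰, ∃ b : Fin d → R, ∀ j, a * D m (e j) = b j * s (e j) := by
      have key : ∀ S : Finset (Fin d), ∃ a ∈ R⁰, ∃ b : Fin d → R,
          ∀ j ∈ S, a * D m (e j) = b j * s (e j) := by
        intro S
        induction S using Finset.induction_on with
        | empty => exact ⟨1, one_mem _, fun _ => 0, by simp⟩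
        | insert i S hi ih =>
          obtain ⟨a, ha, b, hb⟩ := ih
          have h1 := ore_eq (a * D m (e i)) (s (e i))
          refine ⟨oreDenom (a * D m (e i)) (s (e i)) * a, mul_mem (SetLike.coe_mem _) ha,
            fun j => if j = i then oreNum (a * D m (e i)) (s (e i)) else
              oreDenom (a * D m (e i)) (s (e i)) * b j, ?_⟩
          intro j hj
          by_cases hji : j = i
          · subst hji
            simp only [if_true]
            rw [mul_assoc, h1]
          · simp only [if_neg hji]
            rw [mul_assoc, hb j (Finset.mem_of_mem_insert_of_ne hj hji), mul_assoc]
      obtain ⟨a, ha, b, hb⟩ := key Finset.univ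
      exact ⟨a, ha, b, fun j => hb j (Finset.mem_univ _)⟩
    refine ⟨a, ha, ?_⟩
    -- Both sides agree in the coordinates other than `i₀`. The linear equation then forces
    -- agreement at `i₀`, because `r i₀ ≠ 0` and `R` has no zero divisors.
    have hz : a • m = ∑ i, b i • w (e i) := by
      apply hD
      rw [← sub_eq_zero, ← map_sub]
      have h1 : ∀ i : κ, i ≠ i₀ → D (a • m - ∑ i, b i • w (e i)) i = 0 := by
        intro i hi
        obtain ⟨j, hj⟩ := e.surjective ⟨i, hi⟩
        have h2 := hlin b j
        rw [hj] at h2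
        rw [map_sub, Pi.sub_apply, h2, map_smul, Pi.smul_apply, smul_eq_mul]
        have h3 := hb j
        rw [hj] at h3
        rw [h3, sub_self]
      have h2 := (hex _).1 ⟨a • m - ∑ i, b i • w (e i), rfl⟩
      rw [Finset.sum_eq_single i₀ (fun i _ hi => by rw [h1 i hi, zero_mul]) (by simp)] at h2
      funext i
      by_cases hi : i = i₀
      · rw [hi]; exact (mul_eq_zero.1 h2).resolve_right hi₀
      · exact h1 i hi
    rw [hz]
    exact Submodule.sum_mem _ fun i _ => Submodule.smul_mem _ _ (Submodule.subset_span ⟨i, rfl⟩)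

theorem rank_oreLocalization_eq_zero [NoZeroDivisors R] [Nontrivial R]
    (ht : ∀ m : M, ∃ s ∈ R⁰, (s : R) • m = 0) :
    Module.rank (OreLocalization R⁰ R) (OreLocalization R⁰ M) = 0 := by
  have := rank_oreLocalization (R := R) (M := M) (d := 0) Fin.elim0
    (linearIndependent_empty_type) (fun m => by
      obtain ⟨s, hs, h⟩ := ht m
      exact ⟨s, hs, by rw [h]; exact Submodule.zero_mem _⟩)
  simpa using this

end OreRank
end HigherOrderDegree
end

noncomputable section
namespace HigherOrderDegree

/-! ### Fox calculus and the rank of a relation module -/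

section RelationModule

variable {κ Λ : Type*} [Group Λ] (π : FreeGroup κ →* Λ)

/-- The affine automorphism of `ℤ[Λ]^κ` with linear part `g` and translation part `e`. -/
def affinePerm (g : Λ) (e : κ → MonoidAlgebra ℤ Λ) : Equiv.Perm (κ → MonoidAlgebra ℤ Λ) where
  toFun x := MonoidAlgebra.of ℤ Λ g • x + e
  invFun x := MonoidAlgebra.of ℤ Λ g⁻¹ • (x - e)
  left_inv x := by
    dsimp only
    rw [add_sub_cancel_right, smul_smul, ← map_mul, inv_mul_cancel, map_one, one_smul]
  right_inv x := by
    dsimp only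
    rw [smul_smul, ← map_mul, mul_inv_cancel, map_one, one_smul, sub_add_cancel]

section Fox

variable [DecidableEq κ]

/-- The affine action of a free group that defines the Fox derivatives. -/
def foxAction : FreeGroup κ →* Equiv.Perm (κ → MonoidAlgebra ℤ Λ) :=
  FreeGroup.lift fun i => affinePerm (π (FreeGroup.of i)) (Pi.single i 1)

/-- The vector of Fox derivatives of an element of a free group, with values in `ℤ[Λ]`. -/
def fox (w : FreeGroup κ) : κ → MonoidAlgebra ℤ Λ := foxAction π w 0

/-- Every word acts by an affine map whose translation part is `fox`. The product rule for Fox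
derivatives is thus the composition rule for affine maps. -/
theorem foxAction_apply (w : FreeGroup κ) (x : κ → MonoidAlgebra ℤ Λ) :
    foxAction π w x = MonoidAlgebra.of ℤ Λ (π w) • x + fox π w := by
  induction w using FreeGroup.induction_on generalizing x with
  | C1 => rw [fox, map_one, map_one, map_one, one_smul]; simp
  | of i => simp [fox, foxAction, affinePerm]
  | inv_of i _ =>
    have h : ∀ y, foxAction π (FreeGroup.of i)⁻¹ y =
        MonoidAlgebra.of ℤ Λ (π (FreeGroup.of i)⁻¹) • (y - Pi.single i 1) := by
      intro y
      rw [foxAction, map_inv, FreeGroup.lift_apply_of, map_inv]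
      rfl
    rw [fox, h, h, ← smul_add, zero_sub, sub_eq_add_neg]
  | mul v w hv hw =>
    simp only [fox] at hv hw ⊢
    rw [map_mul, Equiv.Perm.mul_apply, Equiv.Perm.mul_apply, hw x, hv, hv (foxAction π w 0),
      map_mul, map_mul, smul_add, mul_smul, add_assoc]

theorem fox_mul (v w : FreeGroup κ) :
    fox π (v * w) = fox π v + MonoidAlgebra.of ℤ Λ (π v) • fox π w := by
  rw [fox, map_mul, Equiv.Perm.mul_apply, foxAction_apply, add_comm]
  rfl

theorem fox_one : fox π 1 = 0 := by simp [fox]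

theorem fox_of (i : κ) : fox π (FreeGroup.of i) = Pi.single i 1 := by
  simp [fox, foxAction, affinePerm]

theorem fox_inv (w : FreeGroup κ) :
    fox π w⁻¹ = - (MonoidAlgebra.of ℤ Λ (π w)⁻¹ • fox π w) := by
  have := fox_mul π w⁻¹ w
  rw [inv_mul_cancel, fox_one, map_inv] at this
  exact eq_neg_of_add_eq_zero_left this.symm

theorem fox_mul_inv (v w : FreeGroup κ) (h : π v = π w) :
    fox π (v * w⁻¹) = fox π v - fox π w := by
  rw [fox_mul, fox_inv, h, smul_neg, smul_smul, ← map_mul, mul_inv_cancel, map_one, one_smul,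
    sub_eq_add_neg]

/-- The fundamental formula of Fox calculus: both sides obey the same product rule and agree on
generators. For `w` in the kernel of `π` it is the linear equation satisfied by the Fox derivatives.
-/
theorem sum_fox_mul [Fintype κ] (w : FreeGroup κ) :
    ∑ i, fox π w i * (MonoidAlgebra.of ℤ Λ (π (FreeGroup.of i)) - 1) =
      MonoidAlgebra.of ℤ Λ (π w) - 1 := by
  have hmul : ∀ v w : FreeGroup κ,
      ∑ i, fox π (v * w) i * (MonoidAlgebra.of ℤ Λ (π (FreeGroup.of i)) - 1) =
      ∑ i, fox π v i * (MonoidAlgebra.of ℤ Λ (π (FreeGroup.of i)) - 1) + MonoidAlgebra.of ℤ Λ (π v) *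
        ∑ i, fox π w i * (MonoidAlgebra.of ℤ Λ (π (FreeGroup.of i)) - 1) := fun v w => by
    rw [Finset.mul_sum, ← Finset.sum_add_distrib]
    refine Finset.sum_congr rfl fun i _ => ?_
    rw [fox_mul, Pi.add_apply, Pi.smul_apply, smul_eq_mul, add_mul, mul_assoc]
  induction w using FreeGroup.induction_on with
  | C1 => rw [map_one, map_one, sub_self, fox_one]; simp
  | of i =>
    rw [fox_of, Finset.sum_eq_single i]
    · rw [Pi.single_eq_same, one_mul]
    · intro j _ hj
      rw [Pi.single_eq_of_ne hj, zero_mul]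
    · simp
  | inv_of i hi =>
    have h1 := hmul (FreeGroup.of i)⁻¹ (FreeGroup.of i)
    rw [inv_mul_cancel, hi, mul_sub, ← map_mul, ← map_mul, inv_mul_cancel] at h1
    simp only [fox_one, Pi.zero_apply, zero_mul, Finset.sum_const_zero, map_one, mul_one] at h1
    rw [eq_comm, ← sub_eq_zero] at h1
    rw [← sub_eq_zero, ← h1]
    abel
  | mul v w hv hw =>
    rw [hmul, hv, hw, mul_sub, mul_one, map_mul, map_mul]
    abel

end Fox

/-- The additive extension of a function on `Λ` to the group ring. -/
def groupRingLift {Λ A : Type*} [AddCommGroup A] (f : Λ → A) : MonoidAlgebra ℤ Λ →+ A where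
  toFun a := a.coeff.sum fun g z => z • f g
  map_zero' := by simp
  map_add' a b := by
    rw [MonoidAlgebra.coeff_add]
    exact Finsupp.sum_add_index' (by simp) (by simp [add_smul])

theorem groupRingLift_single {Λ A : Type*} [AddCommGroup A] (f : Λ → A) (g : Λ) (z : ℤ) :
    groupRingLift f (MonoidAlgebra.single g z) = z • f g := by
  change (MonoidAlgebra.single g z).coeff.sum (fun g z => z • f g) = _
  simp

open scoped nonZeroDivisors in
/-- The rank of the relation module of a presentation of a group by `d + 1` generators. -/
theorem rank_relationModule [Finite κ] {d : ℕ} (hκ : Nat.card κ = d + 1)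
    [OreLocalization.OreSet (MonoidAlgebra ℤ Λ)⁰] [NoZeroDivisors (MonoidAlgebra ℤ Λ)]
    {A : Type*} [AddCommGroup A] [Module (MonoidAlgebra ℤ Λ) A]
    (hπ : Function.Surjective π) (cls : π.ker →* Multiplicative A)
    (hcls : Function.Surjective cls) (hker : cls.ker = commutator π.ker)
    (hact : ∀ (f : FreeGroup κ) (w w' : π.ker), (w' : FreeGroup κ) = f * w * f⁻¹ →
      (cls w').toAdd = MonoidAlgebra.of ℤ Λ (π f) • (cls w).toAdd)
    {i₀ : κ} (hi₀ : π (FreeGroup.of i₀) ≠ 1) :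
    Module.rank (OreLocalization (MonoidAlgebra ℤ Λ)⁰ (MonoidAlgebra ℤ Λ))
      (OreLocalization (MonoidAlgebra ℤ Λ)⁰ A) = d := by
  classical
  have : Fintype κ := Fintype.ofFinite κ
  -- the Fox derivatives on the classes
  let foxKer : π.ker →* Multiplicative (κ → MonoidAlgebra ℤ Λ) :=
    { toFun := fun w => Multiplicative.ofAdd (fox π w)
      map_one' := by simp [fox_one]
      map_mul' := fun v w => by
        have hv : π (v : FreeGroup κ) = 1 := v.2
        rw [Subgroup.coe_mul, fox_mul, hv, map_one, one_smul]; rfl }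
  have hfoxKer : ∀ w, cls w = 1 → foxKer w = 1 := by
    intro w hw
    have h1 : w ∈ commutator π.ker := hker ▸ hw
    exact Abelianization.commutator_subset_ker foxKer h1
  choose t ht using hcls
  let T₀ : A → κ → MonoidAlgebra ℤ Λ := fun a => fox π (t (Multiplicative.ofAdd a))
  have hT₀ : ∀ w : π.ker, T₀ (cls w).toAdd = fox π w := by
    intro w
    have h1 := hfoxKer (t (cls w) * w⁻¹) (by rw [map_mul, map_inv, ht, mul_inv_cancel])
    rw [map_mul, map_inv, mul_inv_eq_one] at h1
    exact h1
  have hsurj : ∀ a : A, ∃ w, (cls w).toAdd = a := fun a => ⟨t (Multiplicative.ofAdd a), by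
    rw [ht]; rfl⟩
  let T₁ : A →+ κ → MonoidAlgebra ℤ Λ := AddMonoidHom.mk' T₀ (by
    intro a b
    obtain ⟨v, rfl⟩ := hsurj a
    obtain ⟨w, rfl⟩ := hsurj b
    rw [← toAdd_mul, ← map_mul, hT₀, hT₀, hT₀]
    exact congrArg Multiplicative.toAdd (foxKer.map_mul v w))
  have hT₁ : ∀ w : π.ker, T₁ (cls w).toAdd = fox π w := hT₀
  have hTof : ∀ (g : Λ) (a : A), T₁ (MonoidAlgebra.of ℤ Λ g • a) = MonoidAlgebra.of ℤ Λ g • T₁ a := by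
    intro g a
    obtain ⟨f, rfl⟩ := hπ g
    obtain ⟨w, rfl⟩ := hsurj a
    have hw : π (w : FreeGroup κ) = 1 := w.2
    have hmem : f * w * f⁻¹ ∈ π.ker := (inferInstance : π.ker.Normal).conj_mem _ w.2 f
    rw [← hact f w ⟨f * w * f⁻¹, hmem⟩ rfl, hT₁, hT₁]
    change fox π (f * w * f⁻¹) = _
    rw [fox_mul_inv _ _ _ (by rw [map_mul, hw, mul_one]), fox_mul, add_sub_cancel_left]
  -- The Magnus embedding of the relation module. Its image will be the kernel of the form with
  -- coefficients `π x_i - 1`.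
  let T : A →ₗ[MonoidAlgebra ℤ Λ] (κ → MonoidAlgebra ℤ Λ) :=
    { T₁ with
      map_smul' := by
        intro c a
        change T₁ (c • a) = c • T₁ a
        induction c using MonoidAlgebra.induction_linear with
        | zero => simp
        | add c₁ c₂ h₁ h₂ => rw [add_smul, map_add, h₁, h₂, add_smul]
        | single g z =>
          have : (MonoidAlgebra.single g z : MonoidAlgebra ℤ Λ) = z • MonoidAlgebra.of ℤ Λ g := by
            simp
          rw [this, smul_assoc, smul_assoc, map_zsmul, hTof] }
  have hT : ∀ w : π.ker, T (cls w).toAdd = fox π w := hT₀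
  -- the Schreier transversal
  choose s hs using hπ
  let c : Λ → FreeGroup κ → π.ker := fun g h => ⟨s g * h * (s (g * π h))⁻¹, by
    rw [MonoidHom.mem_ker, map_mul, map_mul, map_inv, hs, hs, mul_inv_cancel]⟩
  let C : Λ → FreeGroup κ → A := fun g h => (cls (c g h)).toAdd
  have hCmul : ∀ g v w, C g (v * w) = C g v + C (g * π v) w := by
    intro g v w
    have h1 : c g (v * w) = c g v * c (g * π v) w := by
      apply Subtype.ext
      simp only [c, Subgroup.coe_mul, map_mul]
      group
    simp only [C]
    rw [h1, map_mul, toAdd_mul]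
  have hCone : ∀ g, C g 1 = 0 := fun g => by
    have := hCmul g 1 1
    rw [one_mul, map_one, mul_one] at this
    simpa using this
  -- `ρ` sends `g` times the `i`-th basis vector to the class of the Schreier generator `s g * x_i *
  -- (s (g * π x_i))⁻¹`. It is only additive, which suffices.
  let ρ : (κ → MonoidAlgebra ℤ Λ) →+ A :=
    ∑ i, (groupRingLift fun g => C g (FreeGroup.of i)).comp (Pi.evalAddMonoidHom _ i)
  have hρ : ∀ v, ρ v = ∑ i, groupRingLift (fun g => C g (FreeGroup.of i)) (v i) := fun v => by
    simp [ρ, AddMonoidHom.finsetSum_apply]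
  have hρs : ∀ i g z, ρ (Pi.single i (MonoidAlgebra.single g z)) = z • C g (FreeGroup.of i) := by
    intro i g z
    rw [hρ, Finset.sum_eq_single i]
    · rw [Pi.single_eq_same, groupRingLift_single]
    · intro j _ hj
      rw [Pi.single_eq_of_ne hj, map_zero]
    · simp
  have hρfox : ∀ (h : FreeGroup κ) (g : Λ), ρ (MonoidAlgebra.of ℤ Λ g • fox π h) = C g h := by
    intro h
    induction h using FreeGroup.induction_on with
    | C1 => intro g; rw [fox_one, smul_zero, map_zero, hCone]
    | of i =>
      intro g
      rw [fox_of, ← Pi.single_smul', smul_eq_mul, mul_one, MonoidAlgebra.of_apply, hρs, one_smul]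
    | inv_of i hi =>
      intro g
      have h1 := hi (g * (π (FreeGroup.of i))⁻¹)
      have h2 := hCmul g (FreeGroup.of i)⁻¹ (FreeGroup.of i)
      rw [inv_mul_cancel, hCone, map_inv] at h2
      rw [fox_inv, smul_neg, smul_smul, ← map_mul, map_neg, h1]
      exact (eq_neg_of_add_eq_zero_left h2.symm).symm
    | mul v w hv hw =>
      intro g
      rw [fox_mul, smul_add, map_add, smul_smul, ← map_mul, hv, hw, hCmul]
  -- By `hρfox`, `ρ` recovers from `fox π w` the class of `s 1 * w * (s 1)⁻¹`. This is the class of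
  -- `w`, since `s 1` itself lies in the kernel of `π` and `A` is commutative.
  have hTinj : Function.Injective T := by
    rw [injective_iff_map_eq_zero]
    intro a ha
    obtain ⟨w, rfl⟩ := hsurj a
    have hw : π (w : FreeGroup κ) = 1 := w.2
    rw [hT] at ha
    have h1 := hρfox w 1
    rw [ha, smul_zero, map_zero] at h1
    have h2 : c 1 w = ⟨s 1, MonoidHom.mem_ker.2 (hs 1)⟩ * w *
        ⟨s 1, MonoidHom.mem_ker.2 (hs 1)⟩⁻¹ := by
      apply Subtype.ext
      simp [c, hw]
    have h3 : cls (c 1 w) = cls w := by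
      rw [h2, map_mul, map_mul, map_inv, mul_right_comm, mul_inv_cancel, one_mul]
    rw [← h3]
    exact h1.symm
  -- A contracting homotopy: with `∂` the linear form, `T ∘ ρ = id - σ ∘ ∂`, so every vector killed
  -- by `∂` is in the range of `T`.
  let σ : MonoidAlgebra ℤ Λ →+ (κ → MonoidAlgebra ℤ Λ) := groupRingLift fun g => fox π (s g)
  have hTρ : ∀ v, T (ρ v) = v - σ (∑ i, v i * (MonoidAlgebra.of ℤ Λ (π (FreeGroup.of i)) - 1)) := by
    intro v
    have hadd : ∀ v w : κ → MonoidAlgebra ℤ Λ,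
        T (ρ v) = v - σ (∑ i, v i * (MonoidAlgebra.of ℤ Λ (π (FreeGroup.of i)) - 1)) →
        T (ρ w) = w - σ (∑ i, w i * (MonoidAlgebra.of ℤ Λ (π (FreeGroup.of i)) - 1)) →
        T (ρ (v + w)) =
          (v + w) - σ (∑ i, (v + w) i * (MonoidAlgebra.of ℤ Λ (π (FreeGroup.of i)) - 1)) := by
      intro v w hv hw
      simp only [Pi.add_apply, add_mul, Finset.sum_add_distrib, map_add, hv, hw]
      abel
    have hsingle : ∀ i x, T (ρ (Pi.single i x)) = Pi.single i x - σ (∑ j,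
        (Pi.single i x : κ → MonoidAlgebra ℤ Λ) j *
          (MonoidAlgebra.of ℤ Λ (π (FreeGroup.of j)) - 1)) := by
      intro i x
      induction x using MonoidAlgebra.induction_linear with
      | zero => simp
      | add x y hx hy =>
        rw [Pi.single_add]
        exact hadd _ _ hx hy
      | single g z =>
        rw [Finset.sum_eq_single i (fun j _ hj => by rw [Pi.single_eq_of_ne hj, zero_mul])
          (by simp), Pi.single_eq_same, mul_sub, mul_one, MonoidAlgebra.of_apply,
          MonoidAlgebra.single_mul_single, mul_one, map_sub]
        simp only [σ, groupRingLift_single]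
        rw [hρs, map_zsmul, hT]
        simp only [c]
        rw [fox_mul_inv _ _ _ (by rw [map_mul, hs, hs]), fox_mul, hs, fox_of, ← Pi.single_smul',
          smul_eq_mul, mul_one, MonoidAlgebra.of_apply]
        have : (MonoidAlgebra.single g z : MonoidAlgebra ℤ Λ) = z • MonoidAlgebra.single g 1 := by
          simp
        rw [this, Pi.single_smul']
        simp only [smul_sub, smul_add]
        abel
    rw [← Finset.univ_sum_single v]
    refine Finset.sum_induction _ (fun v => T (ρ v) = v - σ (∑ i, v i *
      (MonoidAlgebra.of ℤ Λ (π (FreeGroup.of i)) - 1))) hadd (by simp) fun i _ => hsingle i _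
  refine rank_oreLocalization_ker (κ := κ) (by rwa [← Nat.card_eq_fintype_card]) T hTinj
    (fun i => MonoidAlgebra.of ℤ Λ (π (FreeGroup.of i)) - 1) ?_ (i₀ := i₀) ?_
  · intro v
    constructor
    · rintro ⟨a, rfl⟩
      obtain ⟨w, rfl⟩ := hsurj a
      have hw : π (w : FreeGroup κ) = 1 := w.2
      rw [hT, sum_fox_mul, hw, map_one, sub_self]
    · intro hv
      exact ⟨ρ v, by rw [hTρ, hv, map_zero, sub_zero]⟩
  · rw [sub_ne_zero, ← map_one (MonoidAlgebra.of ℤ Λ)]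
    exact fun h => hi₀ (MonoidAlgebra.of_injective h)

end RelationModule
end HigherOrderDegree
end

noncomputable section
namespace HigherOrderDegree

/-! ### Higher-order degrees: central elements and free kernels -/

section DegreeOfGroup

variable {G P : Type*} [Group G] [Group P] (ψ : G →* P) (n : ℕ)

theorem single_smul_restrictedAlexanderModule (Λ : Subgroup (Gam G n)) (g : G)
    (hg : QuotientGroup.mk g ∈ Λ) (x y : rationalDerivedSeries G (n + 1))
    (hy : (y : G) = g * x * g⁻¹) :
    MonoidAlgebra.of ℤ Λ ⟨QuotientGroup.mk g, hg⟩ •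
      ((restrictedAlexanderModule n Λ).asModuleEquiv.symm
        (Additive.ofMul (Abelianization.of x))) =
      (restrictedAlexanderModule n Λ).asModuleEquiv.symm (Additive.ofMul (Abelianization.of y)) := by
  rw [← Representation.asModuleEquiv_symm_map_rho]
  have h : MulAut.conjNormal g x = y := Subtype.ext (by simp [hy])
  rw [← h]
  rfl

/-- A torsion-free abelian target kills commutators and hence their roots. Consequently winding
numbers detect elements outside the rational derived subgroups. -/
theorem rationalDerivedSeries_succ_le_ker {B : Type*} [CommGroup B] [IsMulTorsionFree B]
    (φ : G →* B) (n : ℕ) : rationalDerivedSeries G (n + 1) ≤ φ.ker := by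
  rintro g ⟨-, k, hk, hgk⟩
  have h : g ^ k ∈ φ.ker :=
    Abelianization.commutator_subset_ker φ (Subgroup.commutator_mono le_top le_top hgk)
  rw [MonoidHom.mem_ker, map_zpow] at h
  refine zpow_left_injective hk ?_
  simpa using h

theorem degree_eq_zero_of_subsingleton (h : rationalDerivedSeries G (n + 1) = ⊥) :
    degree ψ n = 0 := by
  refine rank_oreLocalization_eq_zero fun m => ⟨1, one_mem _, ?_⟩
  have : Subsingleton (rationalDerivedSeries G (n + 1)) := by rw [h]; infer_instance
  obtain ⟨x, hx⟩ := QuotientGroup.mk_surjective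
    ((restrictedAlexanderModule n (gamBar ψ n)).asModuleEquiv m).toMul
  rw [Subsingleton.elim x 1] at hx
  rw [one_smul]
  apply (restrictedAlexanderModule n (gamBar ψ n)).asModuleEquiv.injective
  rw [map_zero]
  exact congrArg Additive.ofMul hx.symm

/-- The degree vanishes if the kernel of `ψ` contains a central element of infinite order in the
abelianization. -/
theorem degree_eq_zero_of_central {z : G} (hz : z ∈ Subgroup.center G) (hψ : ψ z = 1)
    (hn : z ∉ rationalDerivedSeries G (n + 1)) : degree ψ n = 0 := by
  have hzΛ : QuotientGroup.mk z ∈ gamBar ψ n := ⟨z, hψ, rfl⟩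
  -- Conjugation by a central `z` is trivial, so `z - 1` annihilates the module. It is nonzero in
  -- the group ring because `z` survives in `Γ_n`.
  refine rank_oreLocalization_eq_zero fun m =>
    ⟨MonoidAlgebra.of ℤ (gamBar ψ n) ⟨QuotientGroup.mk z, hzΛ⟩ - 1, ?_, ?_⟩
  · apply mem_nonZeroDivisors_of_ne_zero
    rw [sub_ne_zero, ← map_one (MonoidAlgebra.of ℤ (gamBar ψ n))]
    intro h
    exact hn ((QuotientGroup.eq_one_iff z).1
      (congrArg Subtype.val (MonoidAlgebra.of_injective h)))
  · obtain ⟨x, hx⟩ := QuotientGroup.mk_surjective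
      ((restrictedAlexanderModule n (gamBar ψ n)).asModuleEquiv m).toMul
    have hm : m = (restrictedAlexanderModule n (gamBar ψ n)).asModuleEquiv.symm
        (Additive.ofMul (Abelianization.of x)) := by
      rw [LinearEquiv.eq_symm_apply]
      exact congrArg Additive.ofMul hx.symm
    rw [hm, sub_smul, one_smul, single_smul_restrictedAlexanderModule n _ z hzΛ x x, sub_self]
    rw [← Subgroup.mem_center_iff.1 hz, mul_inv_cancel_right]

/-- The degree is one less than the rank of the kernel of `ψ` if this kernel is a free group. -/
theorem degree_eq_of_free {κ : Type*} [Finite κ] {d : ℕ} (hκ : Nat.card κ = d + 1)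
    (b : FreeGroup κ →* G) (hb : Function.Injective b) (hrange : b.range = ψ.ker)
    (hle : rationalDerivedSeries G (n + 1) ≤ ψ.ker) (hn : ¬ ψ.ker ≤ rationalDerivedSeries G (n + 1)) :
    degree ψ n = d := by
  set N := rationalDerivedSeries G (n + 1) with hN
  have hbker : ∀ w, b w ∈ ψ.ker := fun w => hrange ▸ ⟨w, rfl⟩
  let π : FreeGroup κ →* gamBar ψ n :=
    ((QuotientGroup.mk' N).comp b).codRestrict (gamBar ψ n) fun w => ⟨b w, hbker w, rfl⟩
  have hπ : ∀ w, π w = 1 ↔ b w ∈ N := fun w => by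
    rw [← QuotientGroup.eq_one_iff, Subtype.ext_iff]
    rfl
  have hπs : Function.Surjective π := by
    rintro ⟨-, g, hg, rfl⟩
    rw [← hrange] at hg
    obtain ⟨w, rfl⟩ := hg
    exact ⟨w, rfl⟩
  -- Because `N` lies in the free group `ψ.ker`, it is the full group of relations of the
  -- presentation `π` of `Γ̄_n`, and its abelianization is the relation module.
  let β₀ : π.ker →* N := (b.comp π.ker.subtype).codRestrict N fun w => (hπ w).1 w.2
  have hβ₀ : Function.Bijective β₀ := by
    constructor
    · intro v w h
      exact Subtype.ext (hb (congrArg Subtype.val h))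
    · rintro ⟨g, hg⟩
      have := hle hg
      rw [← hrange] at this
      obtain ⟨w, rfl⟩ := this
      exact ⟨⟨w, (hπ w).2 hg⟩, rfl⟩
  let β : π.ker ≃* N := MulEquiv.ofBijective β₀ hβ₀
  let ρ := restrictedAlexanderModule n (gamBar ψ n)
  let cls : π.ker →* Multiplicative ρ.asModule :=
    { toFun := fun w => Multiplicative.ofAdd
        (ρ.asModuleEquiv.symm (Additive.ofMul (Abelianization.of (β w))))
      map_one' := by
        rw [map_one, map_one, ofMul_one, map_zero, ofAdd_zero]
      map_mul' := fun v w => by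
        rw [map_mul, map_mul, ofMul_mul, map_add, ofAdd_add] }
  have hcls : ∀ w, (cls w).toAdd = ρ.asModuleEquiv.symm
    (Additive.ofMul (Abelianization.of (β w))) := fun w => rfl
  obtain ⟨i₀, hi₀⟩ : ∃ i, π (FreeGroup.of i) ≠ 1 := by
    by_contra! h
    apply hn
    have h1 : π = 1 := FreeGroup.ext_hom _ _ (by simpa using h)
    rw [← hrange]
    rintro - ⟨w, rfl⟩
    rw [← hπ, h1]
    rfl
  refine rank_relationModule π hκ hπs cls ?_ ?_ ?_ hi₀
  · intro a
    obtain ⟨x, hx⟩ := QuotientGroup.mk_surjective (ρ.asModuleEquiv a.toAdd).toMul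
    obtain ⟨w, rfl⟩ := β.surjective x
    refine ⟨w, ?_⟩
    apply Multiplicative.toAdd.injective
    rw [hcls, LinearEquiv.symm_apply_eq]
    exact congrArg Additive.ofMul hx
  · have h1 : cls.ker = (Abelianization.of.comp β.toMonoidHom).ker := by
      ext w
      rw [MonoidHom.mem_ker, MonoidHom.mem_ker, ← toAdd_eq_zero, hcls,
        LinearEquiv.map_eq_zero_iff]
      rfl
    rw [h1, ← MonoidHom.comap_ker, Abelianization.ker_of]
    apply Subgroup.map_injective (f := β.toMonoidHom) β.injective
    have hβs : Function.Surjective β.toMonoidHom := β.surjective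
    rw [Subgroup.map_comap_eq_self_of_surjective hβs, commutator_def, commutator_def,
      Subgroup.map_commutator, Subgroup.map_top_of_surjective _ hβs]
  · intro f w w' h
    rw [hcls, hcls]
    refine (single_smul_restrictedAlexanderModule n _ (b f) (π f).2 (β w) (β w') ?_).symm
    change b w' = b f * b w * (b f)⁻¹
    rw [h, map_mul, map_mul, map_inv]

end DegreeOfGroup
end HigherOrderDegree
end

noncomputable section
namespace HigherOrderDegree

/-! ### Finite-index subgroups of free groups given by a degree -/

section FreeSubgroup

open Multiplicative

/-- The free group on `J × ℤ`, extended by the shift of the second coordinate. -/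
def shiftAut (J : Type*) : Multiplicative ℤ →* MulAut (FreeGroup (J × ℤ)) where
  toFun k := FreeGroup.freeGroupCongr ((Equiv.refl J).prodCongr (Equiv.addLeft k.toAdd))
  map_one' := by
    ext w
    induction w using FreeGroup.induction_on with
    | C1 => simp
    | of i => simp
    | inv_of i h => rw [map_inv, h, map_inv]
    | mul v w hv hw => rw [map_mul, hv, hw, map_mul]
  map_mul' k l := by
    ext w
    induction w using FreeGroup.induction_on with
    | C1 => simp
    | of i =>
      obtain ⟨j, i⟩ := i
      simp [add_assoc]
    | inv_of i h => rw [map_inv, h, map_inv]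
    | mul v w hv hw => rw [map_mul, hv, hw, map_mul]

theorem shiftAut_of {J : Type*} (k : Multiplicative ℤ) (j : J) (l : ℤ) :
    shiftAut J k (FreeGroup.of (j, l)) = FreeGroup.of (j, k.toAdd + l) := by
  simp [shiftAut]

variable (J : Type*)

abbrev ShiftProduct : Type _ := FreeGroup (J × ℤ) ⋊[shiftAut J] Multiplicative ℤ

/-- With `t` for `none` and `x_j` for `some j`, the letter `(j, l)` stands for `t ^ l * x_j * t ^
(-l)`. These conjugates freely generate the kernel of the degree with `t ↦ 1`, `x_j ↦ 0`. -/
def toShiftProduct : FreeGroup (Option J) →* ShiftProduct J :=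
  FreeGroup.lift fun o => o.elim (SemidirectProduct.inr (ofAdd 1))
    fun j => SemidirectProduct.inl (FreeGroup.of (j, 0))

def ofShiftProduct : ShiftProduct J →* FreeGroup (Option J) :=
  SemidirectProduct.lift
    (FreeGroup.lift fun p => FreeGroup.of none ^ p.2 * FreeGroup.of (some p.1) *
      (FreeGroup.of none ^ p.2)⁻¹)
    (zpowersHom _ (FreeGroup.of none)) (by
      intro k
      apply FreeGroup.ext_hom
      rintro ⟨j, l⟩
      simp [shiftAut_of, zpow_add, mul_assoc, -map_zpow])

variable {J}

theorem ofShiftProduct_toShiftProduct (w : FreeGroup (Option J)) :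
    ofShiftProduct J (toShiftProduct J w) = w := by
  have : (ofShiftProduct J).comp (toShiftProduct J) = MonoidHom.id _ := by
    apply FreeGroup.ext_hom
    rintro (_ | j) <;> simp [ofShiftProduct, toShiftProduct]
  exact DFunLike.congr_fun this w

theorem toShiftProduct_ofShiftProduct (x : ShiftProduct J) :
    toShiftProduct J (ofShiftProduct J x) = x := by
  have hz : ∀ k : ℤ, (SemidirectProduct.inr (ofAdd 1) : ShiftProduct J) ^ k =
      SemidirectProduct.inr (ofAdd k) := fun k => by
    rw [← map_zpow, ← ofAdd_zsmul, smul_eq_mul, mul_one]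
  have : (toShiftProduct J).comp (ofShiftProduct J) = MonoidHom.id _ := by
    apply SemidirectProduct.hom_ext
    · apply FreeGroup.ext_hom
      rintro ⟨j, l⟩
      simp only [MonoidHom.comp_apply, ofShiftProduct, SemidirectProduct.lift_inl,
        FreeGroup.lift_apply_of, map_mul, map_zpow, map_inv, toShiftProduct, Option.elim,
        MonoidHom.id_apply]
      rw [hz, ← map_inv, ← SemidirectProduct.inl_aut, shiftAut_of, toAdd_ofAdd, add_zero]
    · ext
      · simp [ofShiftProduct, toShiftProduct]
      · simp [ofShiftProduct, toShiftProduct]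
  exact DFunLike.congr_fun this x

theorem toShiftProduct_bijective : Function.Bijective (toShiftProduct J) :=
  ⟨Function.LeftInverse.injective ofShiftProduct_toShiftProduct,
    Function.RightInverse.surjective toShiftProduct_ofShiftProduct⟩

/-- The index change that makes the shift by `m` on `J × ℤ` a shift by one on
`(J × Fin m) × ℤ`. -/
def shiftIndexEquiv (J : Type*) (m : ℕ) [NeZero m] : (J × Fin m) × ℤ ≃ J × ℤ :=
  (Equiv.prodAssoc J (Fin m) ℤ).trans ((Equiv.refl J).prodCongr
    ((Equiv.prodComm _ _).trans (Int.divModEquiv m).symm))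

theorem shiftIndexEquiv_add {m : ℕ} [NeZero m] (j : J) (i : Fin m) (k l : ℤ) :
    shiftIndexEquiv J m ((j, i), k + l) =
      ((shiftIndexEquiv J m ((j, i), l)).1, m * k + (shiftIndexEquiv J m ((j, i), l)).2) := by
  simp [shiftIndexEquiv]
  ring

/-- Restricting the shift to `mℤ` breaks each orbit of letters into `m` orbits, one for each
remainder modulo `m`. The preimage of `mℤ` is therefore again a shift product, with `J × Fin m` in
place of `J`. -/
def shiftProductMap (J : Type*) (m : ℕ) [NeZero m] :
    ShiftProduct (J × Fin m) →* ShiftProduct J :=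
  SemidirectProduct.map (FreeGroup.freeGroupCongr (shiftIndexEquiv J m)).toMonoidHom
    (powMonoidHom m) (by
      intro k
      apply FreeGroup.ext_hom
      rintro ⟨⟨j, i⟩, l⟩
      simp only [MonoidHom.comp_apply, MulEquiv.coe_toMonoidHom, shiftAut_of,
        FreeGroup.freeGroupCongr_apply, FreeGroup.map.of, shiftIndexEquiv_add]
      generalize shiftIndexEquiv J m ((j, i), l) = p
      obtain ⟨a, c⟩ := p
      simp [shiftAut_of, -map_pow])

theorem shiftProductMap_injective (m : ℕ) [NeZero m] :
    Function.Injective (shiftProductMap J m) := by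
  intro x y h
  have h1 := congrArg SemidirectProduct.left h
  have h2 := congrArg SemidirectProduct.right h
  simp only [shiftProductMap, SemidirectProduct.map_left, SemidirectProduct.map_right] at h1 h2
  ext1
  · exact (FreeGroup.freeGroupCongr (shiftIndexEquiv J m)).injective h1
  · exact pow_left_injective (NeZero.ne m) h2

theorem mem_range_shiftProductMap (m : ℕ) [NeZero m] (x : ShiftProduct J) :
    x ∈ (shiftProductMap J m).range ↔ (m : ℤ) ∣ x.right.toAdd := by
  constructor
  · rintro ⟨y, rfl⟩
    simp [shiftProductMap]
  · rintro ⟨k, hk⟩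
    refine ⟨⟨(FreeGroup.freeGroupCongr (shiftIndexEquiv J m)).symm x.left, ofAdd k⟩, ?_⟩
    ext1
    · exact (FreeGroup.freeGroupCongr (shiftIndexEquiv J m)).apply_symm_apply _
    · apply Multiplicative.toAdd.injective
      change (ofAdd k ^ m).toAdd = _
      rw [hk, toAdd_pow, toAdd_ofAdd, nsmul_eq_mul]

/-- The subgroup of a free group of rank `|J| + 1` defined by the divisibility of a primitive
degree by `m` is free of rank `|J| m + 1`. -/
theorem exists_freeGroup_hom_dvd (m : ℕ) [NeZero m] (deg : FreeGroup (Option J) →* Multiplicative ℤ)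
    (hdeg : deg (FreeGroup.of none) = ofAdd 1) :
    ∃ b : FreeGroup (Option (J × Fin m)) →* FreeGroup (Option J), Function.Injective b ∧
      ∀ w, w ∈ b.range ↔ (m : ℤ) ∣ (deg w).toAdd := by
  let t : FreeGroup (Option J) := FreeGroup.of none
  let e : ℤ → J → ℤ := fun s j => s * (deg (FreeGroup.of (some j))).toAdd
  -- `α s` fixes `t` and multiplies `x_j` by `t` to the power `s * deg x_j`, so `α (-s)` inverts it.
  -- For `s = -1` it reduces the degree of every `x_j` to zero.
  let α : ℤ → FreeGroup (Option J) →* FreeGroup (Option J) := fun s =>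
    FreeGroup.lift fun o => o.elim t fun j => FreeGroup.of (some j) * t ^ e s j
  have hα : ∀ s w, α (-s) (α s w) = w := by
    intro s w
    have : (α (-s)).comp (α s) = MonoidHom.id _ := by
      apply FreeGroup.ext_hom
      rintro (_ | j)
      · simp [α, t]
      · simp [α, t, e]
    exact DFunLike.congr_fun this w
  -- the composite of `deg` with the automorphism is the standard degree
  have hstd : ∀ w, deg (α (-1) w) = (toShiftProduct J w).right := by
    intro w
    have : deg.comp (α (-1)) = SemidirectProduct.rightHom.comp (toShiftProduct J) := by
      apply FreeGroup.ext_hom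
      rintro (_ | j)
      · simp [α, t, hdeg, toShiftProduct]
      · simp only [MonoidHom.comp_apply, α, FreeGroup.lift_apply_of, Option.elim, map_mul, map_zpow,
          t, hdeg, e, toShiftProduct, SemidirectProduct.rightHom_inl]
        apply Multiplicative.toAdd.injective
        simp
    exact DFunLike.congr_fun this w
  let θ := (ofShiftProduct J).comp ((shiftProductMap J m).comp (toShiftProduct (J × Fin m)))
  refine ⟨(α (-1)).comp θ, ?_, ?_⟩
  · have h1 : Function.Injective (α (-1)) := Function.LeftInverse.injective (hα (-1))
    exact h1.comp ((Function.LeftInverse.injective toShiftProduct_ofShiftProduct).comp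
      ((shiftProductMap_injective m).comp toShiftProduct_bijective.1))
  · intro w
    have hw : w = α (-1) (α 1 w) := (hα 1 w).symm
    rw [hw, hstd, ← mem_range_shiftProductMap]
    constructor
    · rintro ⟨v, hv⟩
      rw [hα] at hv
      refine ⟨toShiftProduct _ v, ?_⟩
      rw [← hv]
      have := hα (-1) (θ v)
      rw [neg_neg] at this
      change _ = toShiftProduct J (α 1 (α (-1) (θ v)))
      rw [this]
      exact (toShiftProduct_ofShiftProduct _).symm
    · rintro ⟨x, hx⟩
      obtain ⟨v, rfl⟩ := toShiftProduct_bijective.2 x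
      refine ⟨v, ?_⟩
      change α (-1) (ofShiftProduct J (shiftProductMap J m (toShiftProduct _ v))) = _
      rw [hx, ofShiftProduct_toShiftProduct]

end FreeSubgroup
end HigherOrderDegree
end

noncomputable section
namespace HigherOrderDegree

open scoped unitInterval

/-! ### Local-to-global arguments for paths -/

section PathInduction

variable {X : Type*} [TopologicalSpace X]

/-- A property of homotopy classes of paths that is compatible with concatenation holds if it holds
locally. -/
theorem path_induction {ι : Type*} (W : ι → Set X) (hW : ∀ i, IsOpen (W i)) (hc : ∀ x, ∃ i, x ∈ W i)
    (P : ∀ {x y : X}, Path.Homotopic.Quotient x y → Prop)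
    (htrans : ∀ {x y z : X} (γ : Path.Homotopic.Quotient x y) (γ' : Path.Homotopic.Quotient y z),
      P γ → P γ' → P (γ.trans γ'))
    (hloc : ∀ i {x y : X} (γ : Path x y), (∀ t, γ t ∈ W i) → P (.mk γ))
    {x y : X} (γ : Path.Homotopic.Quotient x y) : P γ := by
  induction γ using Path.Homotopic.Quotient.ind with | mk γ => ?_
  obtain ⟨t, ht0, htm, ⟨n, hn⟩, ht⟩ := exists_monotone_Icc_subset_open_cover_unitInterval
    (c := fun i => γ ⁻¹' W i) (fun i => (hW i).preimage γ.continuous)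
    (fun s _ => Set.mem_iUnion.2 (hc (γ s)))
  have key : ∀ k, P (.mk (γ.subpath 0 (t k))) := by
    intro k
    induction k with
    | zero =>
      obtain ⟨i, hi⟩ := hc (γ 0)
      rw [ht0, Path.subpath_self]
      exact hloc i _ fun _ => hi
    | succ k ih =>
      obtain ⟨i, hi⟩ := ht k
      have h1 : P (.mk (γ.subpath (t k) (t (k + 1)))) := by
        refine hloc i _ fun s => ?_
        have h2 : γ.subpath (t k) (t (k + 1)) s ∈ Set.range (γ.subpath (t k) (t (k + 1))) := ⟨s, rfl⟩
        rw [Path.range_subpath_of_le _ _ _ (htm (Nat.le_succ k))] at h2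
        obtain ⟨r, hr, hrs⟩ := h2
        rw [← hrs]
        exact hi hr
      have h2 := htrans _ _ ih h1
      rw [← Path.Homotopic.Quotient.mk_trans] at h2
      rwa [← Path.Homotopic.Quotient.eq.2 ⟨Path.Homotopy.subpathTransSubpath γ 0 (t k) (t (k + 1))⟩]
  have h1 := key n
  rw [hn n le_rfl, Path.subpath_zero_one] at h1
  have hcast : ∀ {x' y' : X} (hx : x' = x) (hy : y' = y), P (.mk (γ.cast hx hy)) → P (.mk γ) := by
    rintro _ _ rfl rfl h
    exact h
  exact hcast _ _ h1

/-- Two ways around a square are homotopic. -/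
theorem square_homotopic {F : I → I → X} (hF : Continuous (Function.uncurry F)) {a b c d : X}
    {p : Path a b} {q : Path c d} {l : Path a c} {r : Path b d}
    (hp : ∀ t, p t = F t 0) (hq : ∀ t, q t = F t 1) (hl : ∀ s, l s = F 0 s) (hr : ∀ s, r s = F 1 s) :
    (Path.Homotopic.Quotient.mk p).trans (.mk r) = (Path.Homotopic.Quotient.mk l).trans (.mk q) := by
  obtain rfl : F 0 0 = a := (hp 0).symm.trans p.source
  obtain rfl : F 1 0 = b := (hp 1).symm.trans p.target
  obtain rfl : F 0 1 = c := (hq 0).symm.trans q.source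
  obtain rfl : F 1 1 = d := (hq 1).symm.trans q.target
  -- `F` is extended to the whole plane by projecting to the square. The two ways around the square
  -- are homotopic in the plane, which is simply connected.
  let f : C(ℝ × ℝ, X) := ⟨fun x => Function.uncurry F (Set.projIcc 0 1 zero_le_one x.1,
    Set.projIcc 0 1 zero_le_one x.2), by fun_prop⟩
  have hf : ∀ s t : I, f (s, t) = F s t := fun s t => by
    simp only [f, ContinuousMap.coe_mk, Set.projIcc_val, Function.uncurry_apply_pair]
  let p' : Path ((0, 0) : ℝ × ℝ) (1, 0) := ⟨⟨fun t => (t, 0), by fun_prop⟩, by simp, by simp⟩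
  let q' : Path ((0, 1) : ℝ × ℝ) (1, 1) := ⟨⟨fun t => (t, 1), by fun_prop⟩, by simp, by simp⟩
  let l' : Path ((0, 0) : ℝ × ℝ) (0, 1) := ⟨⟨fun t => (0, t), by fun_prop⟩, by simp, by simp⟩
  let r' : Path ((1, 0) : ℝ × ℝ) (1, 1) := ⟨⟨fun t => (1, t), by fun_prop⟩, by simp, by simp⟩
  have h := SimplyConnectedSpace.paths_homotopic (p'.trans r') (l'.trans q')
  have h2 := h.map f
  rw [Path.map_trans, Path.map_trans] at h2
  have e00 := (hf 0 0).symm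
  have e01 := (hf 0 1).symm
  have e10 := (hf 1 0).symm
  have e11 := (hf 1 1).symm
  have hp' : p = (p'.map f.continuous).cast e00 e10 := by ext t; exact (hp t).trans (hf t 0).symm
  have hq' : q = (q'.map f.continuous).cast e01 e11 := by ext t; exact (hq t).trans (hf t 1).symm
  have hl' : l = (l'.map f.continuous).cast e00 e01 := by ext t; exact (hl t).trans (hf 0 t).symm
  have hr' : r = (r'.map f.continuous).cast e10 e11 := by ext t; exact (hr t).trans (hf 1 t).symm
  rw [← Path.Homotopic.Quotient.mk_trans, ← Path.Homotopic.Quotient.mk_trans,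
    Path.Homotopic.Quotient.eq, hp', hq', hl', hr']
  exact h2.pathCast e00 e11

end PathInduction

/-! ### Winding numbers as increments of logarithms -/

section LogIncrement

abbrev PuncturedPlane : Type := {z : ℂ // z ≠ 0}

/-- The exponential map as a covering of the punctured plane. -/
def expCover (z : ℂ) : PuncturedPlane := ⟨_, z.exp_ne_zero⟩

theorem isCoveringMap_expCover : IsCoveringMap expCover := Complex.isCoveringMap_exp

/-- The increment of the logarithm along a path in the punctured plane. -/
def logIncr {x y : PuncturedPlane} (γ : Path.Homotopic.Quotient x y) : ℂ :=
  isCoveringMap_expCover.monodromy γ ⟨Complex.log x, Subtype.ext (Complex.exp_log x.2)⟩ -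
    Complex.log x

theorem monodromy_expCover_mk {x y : PuncturedPlane} (γ : Path x y) (L : I → ℂ) (hL : Continuous L)
    (h : ∀ t, Complex.exp (L t) = γ t) (e : expCover ⁻¹' {x}) (c : ℂ) (hc : e = L 0 + c) :
    (isCoveringMap_expCover.monodromy (.mk γ) e : ℂ) = L 1 + c := by
  have h1 : (e : ℂ) = L 0 + c := hc
  have hexp : Complex.exp c = 1 := by
    have h2 : Complex.exp e = x := congrArg Subtype.val e.2
    rw [h1, Complex.exp_add, h, γ.source] at h2
    exact mul_left_cancel₀ x.2 (h2.trans (mul_one _).symm)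
  have h3 := (isCoveringMap_expCover.eq_liftPath_iff' (γ := γ) (e := e)
    (γ_0 := γ.source.trans e.2.symm) (Γ := ⟨fun t => L t + c, by fun_prop⟩)).2
    ⟨by
      funext t
      apply Subtype.ext
      change Complex.exp (L t + c) = γ t
      rw [Complex.exp_add, hexp, mul_one, h], h1.symm⟩
  exact (DFunLike.congr_fun h3 1).symm

theorem logIncr_mk {x y : PuncturedPlane} (γ : Path x y) (L : I → ℂ) (hL : Continuous L)
    (h : ∀ t, Complex.exp (L t) = γ t) : logIncr (.mk γ) = L 1 - L 0 := by
  rw [logIncr, monodromy_expCover_mk γ L hL h _ (Complex.log x - L 0) (by simp)]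
  ring

theorem exists_log_path {x y : PuncturedPlane} (γ : Path x y) :
    ∃ L : I → ℂ, Continuous L ∧ ∀ t, Complex.exp (L t) = γ t := by
  obtain ⟨Γ, h, -⟩ := isCoveringMap_expCover.exists_path_lifts (γ : C(I, PuncturedPlane))
    (Complex.log x) (by
      change γ 0 = _
      rw [γ.source]
      exact Subtype.ext (Complex.exp_log x.2).symm)
  exact ⟨Γ, Γ.continuous, fun t => congrArg Subtype.val (congrFun h t)⟩

theorem monodromy_expCover {x y : PuncturedPlane} (γ : Path.Homotopic.Quotient x y)
    (e : expCover ⁻¹' {x}) : (isCoveringMap_expCover.monodromy γ e : ℂ) = e + logIncr γ := by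
  induction γ using Path.Homotopic.Quotient.ind with | mk γ => ?_
  obtain ⟨L, hL, h⟩ := exists_log_path γ
  rw [logIncr_mk γ L hL h, monodromy_expCover_mk γ L hL h e (e - L 0) (by ring)]
  ring

theorem logIncr_trans {x y z : PuncturedPlane} (γ : Path.Homotopic.Quotient x y)
    (γ' : Path.Homotopic.Quotient y z) : logIncr (γ.trans γ') = logIncr γ + logIncr γ' := by
  rw [logIncr, isCoveringMap_expCover.monodromy_trans_apply, monodromy_expCover,
    monodromy_expCover]
  ring

/-- Two logarithms of the starting value differ by a period, so both lifts may start at the same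
point. Equal increments make them end at the same point, and a homotopy in `ℂ` is pushed down by
`exp`. -/
theorem logIncr_injective {x y : PuncturedPlane} {γ γ' : Path.Homotopic.Quotient x y}
    (h : logIncr γ = logIncr γ') : γ = γ' := by
  induction γ using Path.Homotopic.Quotient.ind with | mk γ => ?_
  induction γ' using Path.Homotopic.Quotient.ind with | mk γ' => ?_
  obtain ⟨L, hL, h1⟩ := exists_log_path γ
  obtain ⟨L', hL', h2⟩ := exists_log_path γ'
  rw [logIncr_mk γ L hL h1, logIncr_mk γ' L' hL' h2] at h
  have hexp : Complex.exp (L 0 - L' 0) = 1 := by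
    rw [Complex.exp_sub, h1, h2, γ.source, γ'.source, div_self x.2]
  let a : Path (L 0) (L 1) := ⟨⟨L, hL⟩, rfl, rfl⟩
  let b : Path (L 0) (L 1) := ⟨⟨fun t => L' t + (L 0 - L' 0), by fun_prop⟩, by simp, by
    simp only
    linear_combination -h⟩
  have h3 := (SimplyConnectedSpace.paths_homotopic a b).map ⟨expCover, by
    exact isCoveringMap_expCover.continuous⟩
  have hx : x = expCover (L 0) := Subtype.ext (by
    change (x : ℂ) = Complex.exp _
    rw [h1, γ.source])
  have hy : y = expCover (L 1) := Subtype.ext (by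
    change (y : ℂ) = Complex.exp _
    rw [h1, γ.target])
  refine Path.Homotopic.Quotient.eq.2 ?_
  convert h3.pathCast hx hy using 1
  · ext t
    exact (h1 t).symm
  · ext t
    change _ = Complex.exp (L' t + (L 0 - L' 0))
    rw [Complex.exp_add, hexp, mul_one, h2]

variable {X : Type*} [TopologicalSpace X]

/-- The increment of the logarithm of a nonvanishing function along a path. -/
def incr (g : C(X, PuncturedPlane)) {x y : X} (γ : Path.Homotopic.Quotient x y) : ℂ :=
  logIncr (γ.map g)

theorem incr_mk (g : C(X, PuncturedPlane)) {x y : X} (γ : Path x y) (L : I → ℂ) (hL : Continuous L)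
    (h : ∀ t, Complex.exp (L t) = g (γ t)) : incr g (.mk γ) = L 1 - L 0 :=
  logIncr_mk (γ.map g.continuous) L hL h

theorem exists_log_comp_path (g : C(X, PuncturedPlane)) {x y : X} (γ : Path x y) :
    ∃ L : I → ℂ, Continuous L ∧ ∀ t, Complex.exp (L t) = g (γ t) :=
  exists_log_path (γ.map g.continuous)

theorem incr_trans (g : C(X, PuncturedPlane)) {x y z : X} (γ : Path.Homotopic.Quotient x y)
    (γ' : Path.Homotopic.Quotient y z) : incr g (γ.trans γ') = incr g γ + incr g γ' := by
  rw [incr, incr, incr, ← logIncr_trans]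
  congr 1
  induction γ using Path.Homotopic.Quotient.ind with | mk γ => ?_
  induction γ' using Path.Homotopic.Quotient.ind with | mk γ' => ?_
  rw [← Path.Homotopic.Quotient.mk_trans, ← Path.Homotopic.Quotient.mk_map, Path.map_trans]
  rfl

theorem incr_refl (g : C(X, PuncturedPlane)) (x : X) :
    incr g (Path.Homotopic.Quotient.refl x) = 0 := by
  have := incr_trans g (.refl x) (.refl x)
  simpa using this

theorem incr_symm (g : C(X, PuncturedPlane)) {x y : X} (γ : Path.Homotopic.Quotient x y) :
    incr g γ.symm = - incr g γ := by
  have := incr_trans g γ γ.symm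
  rw [Path.Homotopic.Quotient.trans_symm, incr_refl] at this
  exact (neg_eq_of_add_eq_zero_right this.symm).symm

theorem incr_mul {f g h : C(X, PuncturedPlane)} (hf : ∀ x, (f x : ℂ) = g x * h x) {x y : X}
    (γ : Path.Homotopic.Quotient x y) : incr f γ = incr g γ + incr h γ := by
  induction γ using Path.Homotopic.Quotient.ind with | mk γ => ?_
  obtain ⟨L, hL, h1⟩ := exists_log_comp_path g γ
  obtain ⟨L', hL', h2⟩ := exists_log_comp_path h γ
  rw [incr_mk g γ L hL h1, incr_mk h γ L' hL' h2, incr_mk f γ (fun t => L t + L' t) (by fun_prop)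
    (fun t => by rw [Complex.exp_add, h1, h2, hf])]
  ring

theorem incr_const {f : C(X, PuncturedPlane)} (c : ℂ) (hf : ∀ x, (f x : ℂ) = c) {x y : X}
    (γ : Path.Homotopic.Quotient x y) : incr f γ = 0 := by
  induction γ using Path.Homotopic.Quotient.ind with | mk γ => ?_
  rw [incr_mk f γ (fun _ => Complex.log c) (by fun_prop)
    (fun t => by rw [hf, Complex.exp_log]; exact hf x ▸ (f x).2), sub_self]

theorem incr_prod {ι : Type*} (s : Finset ι) {f : C(X, PuncturedPlane)} {g : ι → C(X, PuncturedPlane)}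
    (c : ℂ) (hf : ∀ x, (f x : ℂ) = c * ∏ i ∈ s, (g i x : ℂ)) {x y : X}
    (γ : Path.Homotopic.Quotient x y) : incr f γ = ∑ i ∈ s, incr (g i) γ := by
  induction γ using Path.Homotopic.Quotient.ind with | mk γ => ?_
  choose L hL hg using fun i => exists_log_comp_path (g i) γ
  have hc : c ≠ 0 := left_ne_zero_of_mul (hf x ▸ (f x).2)
  rw [incr_mk f γ (fun t => Complex.log c + ∑ i ∈ s, L i t) (by fun_prop) (fun t => by
    rw [Complex.exp_add, Complex.exp_log hc, Complex.exp_sum, hf]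
    simp only [hg])]
  rw [add_sub_add_left_eq_sub, ← Finset.sum_sub_distrib]
  exact Finset.sum_congr rfl fun i _ => (incr_mk (g i) γ (L i) (hL i) (hg i)).symm

theorem incr_map {Y : Type*} [TopologicalSpace Y] (g : C(Y, PuncturedPlane)) (h : C(X, Y)) {x y : X}
    (γ : Path.Homotopic.Quotient x y) : incr g (γ.map h) = incr (g.comp h) γ := by
  rw [incr, incr, Path.Homotopic.Quotient.map_comp]

/-- The increment of the logarithm as a homomorphism on the fundamental group. -/
def incrHom (g : C(X, PuncturedPlane)) (u : X) : FundamentalGroup X u →* Multiplicative ℂ where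
  toFun γ := Multiplicative.ofAdd (incr g γ)
  map_one' := by
    rw [FundamentalGroup.one_def, incr_refl]; rfl
  map_mul' a b := by
    rw [FundamentalGroup.mul_def, incr_trans, add_comm]; rfl

theorem incrHom_apply (g : C(X, PuncturedPlane)) (u : X) (γ : FundamentalGroup X u) :
    (incrHom g u γ).toAdd = incr g γ := rfl

theorem mem_ker_incrHom {g : C(X, PuncturedPlane)} {u : X} {γ : FundamentalGroup X u} :
    γ ∈ (incrHom g u).ker ↔ incr g γ = 0 := Iff.rfl

/-- A loop in the punctured plane is trivial exactly if its logarithm has increment zero. The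
linking homomorphism may thus be replaced by a homomorphism to complex numbers, which is additive
over the factors of `f`. -/
theorem ker_linking (f : MvPolynomial (Fin 2) ℂ) (u : Complement f) :
    (linking f u).ker = (incrHom (evalMap f) u).ker := by
  ext γ
  rw [mem_ker_incrHom, MonoidHom.mem_ker]
  have h0 : logIncr (Path.Homotopic.Quotient.refl (evalMap f u)) = 0 := by
    have := logIncr_trans (Path.Homotopic.Quotient.refl (evalMap f u)) (.refl _)
    simpa using this
  constructor
  · intro h
    have h1 : Path.Homotopic.Quotient.map γ (evalMap f) = .refl _ := h
    rw [incr, h1, h0]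
  · intro h
    exact logIncr_injective (h.trans h0.symm)

end LogIncrement
end HigherOrderDegree
end

noncomputable section
namespace HigherOrderDegree

open scoped unitInterval

/-! ### Holonomy of a local system glued over two open sets -/

section Holonomy

variable {X T : Type*} [Group T]

/-- The transition functions of a local system that is trivial over two open sets. -/
def transition (h : X → T) : Bool → Bool → X → T
  | true, false, x => h x
  | false, true, x => (h x)⁻¹
  | true, true, _ => 1
  | false, false, _ => 1

theorem transition_self (h : X → T) (i : Bool) (x : X) : transition h i i x = 1 := by
  cases i <;> rfl

theorem transition_mul (h : X → T) (i j k : Bool) (x : X) :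
    transition h j k x * transition h i j x = transition h i k x := by
  cases i <;> cases j <;> cases k <;> simp [transition]

variable [TopologicalSpace X] (W : Bool → Set X) (h : X → T)

open Topology in
/-- The bundle with discrete fibre `T` that is glued from trivial bundles over two open sets. -/
def holonomyBundle [TopologicalSpace T] [DiscreteTopology T] (hW : ∀ i, IsOpen (W i))
    (hc : ∀ x, ∃ i, x ∈ W i) (hh : ∀ x ∈ W true ∩ W false, ∀ᶠ y in 𝓝 x, h y = h x) :
    FiberBundleCore Bool X T where
  baseSet := W
  isOpen_baseSet := hW
  indexAt x := (hc x).choose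
  mem_baseSet_at x := (hc x).choose_spec
  coordChange i j x v := transition h i j x * v
  coordChange_self i x _ v := by rw [transition_self, one_mul]
  continuousOn_coordChange i j := by
    rintro ⟨x, v⟩ ⟨⟨hi, hj⟩, -⟩
    have h1 : ∀ᶠ y in 𝓝 x, transition h i j y = transition h i j x := by
      cases i <;> cases j
      · simp [transition]
      · filter_upwards [hh x ⟨hj, hi⟩] with y hy
        simp [transition, hy]
      · filter_upwards [hh x ⟨hi, hj⟩] with y hy
        simp [transition, hy]
      · simp [transition]
    have h2 : ∀ᶠ p : X × T in 𝓝 (x, v), transition h i j p.1 * p.2 = transition h i j x * v := by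
      have h3 : ∀ᶠ u : T in 𝓝 v, u = v := by rw [nhds_discrete]; simp
      filter_upwards [h1.prod_nhds h3] with p hp
      rw [hp.1, hp.2]
    exact (continuousAt_const.congr (h2.mono fun _ h => h.symm)).continuousWithinAt
  coordChange_comp i j k x _ v := by rw [← mul_assoc, transition_mul]

open Topology in
/-- The holonomy of paths in a local system that is trivial over two open sets, expressed as
a relation between the class of a path, trivializations at the end points, and elements of `T`. -/
theorem exists_holonomy (hW : ∀ i, IsOpen (W i)) (hc : ∀ x, ∃ i, x ∈ W i)
    (hh : ∀ x ∈ W true ∩ W false, ∀ᶠ y in 𝓝 x, h y = h x) :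
    ∃ R : ∀ {x y : X}, Path.Homotopic.Quotient x y → Bool → Bool → T → Prop,
      (∀ {x y : X} (γ : Path x y) (i : Bool), (∀ t, γ t ∈ W i) → R (.mk γ) i i 1) ∧
      (∀ {x y z : X} (γ : Path.Homotopic.Quotient x y) (γ' : Path.Homotopic.Quotient y z)
        (i j k : Bool) (a b : T), R γ i j a → R γ' j k b → R (γ.trans γ') i k (b * a)) ∧
      (∀ {x y : X} (γ : Path.Homotopic.Quotient x y) (i j : Bool) (a : T), R γ i j a →
        R γ.symm j i a⁻¹) ∧
      (∀ x : X, x ∈ W true → x ∈ W false → R (.refl x) true false (h x)) ∧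
      (∀ {x y : X} (γ : Path.Homotopic.Quotient x y) (i j : Bool) (a b : T), x ∈ W i → R γ i j a →
        R γ i j b → a = b) := by
  let _ : TopologicalSpace T := ⊥
  have _ : DiscreteTopology T := ⟨rfl⟩
  let Z := holonomyBundle W h hW hc hh
  have cov : IsCoveringMap Z.proj := FiberBundle.isCoveringMap (F := T) (E := Z.Fiber)
  let coord : Bool → Z.TotalSpace → T := fun i e => (Z.localTriv i e).2
  have hcoord : ∀ i e, coord i e = transition h (Z.indexAt e.proj) i e.proj * (show T from e.2) :=
    fun i e => rfl
  have hchange : ∀ i j e, transition h i j e.proj * coord i e = coord j e := fun i j e => by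
    rw [hcoord, hcoord, ← mul_assoc, transition_mul]
  -- The relation says that the monodromy along `γ`, read in the trivialization `i` at the start and
  -- `j` at the end, is left multiplication by `a`. Evaluating on a single fibre point shows that
  -- `a` is unique.
  refine ⟨fun {x y} γ i j a => ∀ e : Z.proj ⁻¹' {x}, coord j (cov.monodromy γ e) = a * coord i e,
    ?_, ?_, ?_, ?_, ?_⟩
  · intro x y γ i hγ e
    rw [one_mul]
    let Γ := cov.liftPath γ e (γ.source.trans e.2.symm)
    have hΓ : ∀ t, Z.proj (Γ t) = γ t := fun t => congrFun (cov.liftPath_lifts _ _ _) t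
    have hcont : Continuous fun t => coord i (Γ t) := by
      have h1 : Continuous fun t => Z.localTriv i (Γ t) := by
        refine (Z.localTriv i).continuousOn.comp_continuous Γ.continuous fun t => ?_
        rw [(Z.localTriv i).mem_source, hΓ]
        exact hγ t
      exact h1.snd
    have h1 : coord i (Γ 1) = coord i (Γ 0) := PreconnectedSpace.constant inferInstance hcont
    have h0 : Γ 0 = e := cov.liftPath_zero _ _ _
    rw [h0] at h1
    exact h1
  · intro x y z γ γ' i j k a b ha hb e
    rw [cov.monodromy_trans_apply, hb, ha, mul_assoc]
  · intro x y γ i j a ha e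
    have h1 := ha (cov.monodromy γ.symm e)
    rw [← cov.monodromy_trans_apply, Path.Homotopic.Quotient.symm_trans, cov.monodromy_refl] at h1
    rw [eq_inv_mul_iff_mul_eq, ← h1]
    rfl
  · intro x _ _ e
    rw [cov.monodromy_refl]
    have h1 : (e : Z.TotalSpace).proj = x := e.2
    rw [id, ← hchange true false, h1]
    rfl
  · intro x y γ i j a b hx ha hb
    let e : Z.TotalSpace := ⟨x, (1 : T)⟩
    have := (ha ⟨e, rfl⟩).symm.trans (hb ⟨e, rfl⟩)
    exact mul_right_cancel this

end Holonomy
end HigherOrderDegree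
end

noncomputable section
namespace HigherOrderDegree

open scoped unitInterval

/-! ### Slit planes and their contraction to an apex -/

section PuncturedPlane

variable {ι : Type*} (c : ι → ℂ)

/-- The plane without the points `c i`. -/
def Punctured : Type := {t : ℂ // ∀ i, t ≠ c i}

instance : TopologicalSpace (Punctured c) := instTopologicalSpaceSubtype

/-- The function `t ↦ t - c i`. -/
def subPoint (i : ι) : C(Punctured c, PuncturedPlane) where
  toFun t := ⟨t.1 - c i, sub_ne_zero.2 (t.2 i)⟩
  continuous_toFun := Continuous.subtype_mk (continuous_subtype_val.sub continuous_const) _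

def boolSign (b : Bool) : ℝ := if b then 1 else -1

theorem boolSign_mul_self (b : Bool) : boolSign b * boolSign b = 1 := by
  cases b <;> simp [boolSign]

/-- The plane without the vertical downward rays (for `true`) or the vertical upward rays
(for `false`) from the points `c i`. -/
def slitSet (b : Bool) : Set ℂ := {t | ∀ i, t.re = (c i).re → 0 < boolSign b * (t.im - (c i).im)}

theorem ne_of_mem_slitSet {b : Bool} {t : ℂ} (ht : t ∈ slitSet c b) (i : ι) : t ≠ c i := by
  rintro rfl
  simpa using ht i rfl

theorem isOpen_slitSet [Finite ι] (b : Bool) : IsOpen (slitSet c b) := by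
  have : slitSet c b = ⋂ i, {t : ℂ | t.re = (c i).re ∧ boolSign b * (t.im - (c i).im) ≤ 0}ᶜ := by
    ext t
    simp [slitSet]
  rw [this]
  refine isOpen_iInter_of_finite fun i => IsClosed.isOpen_compl (self := IsClosed.inter ?_ ?_)
  · exact isClosed_eq Complex.continuous_re continuous_const
  · exact isClosed_le (continuous_const.mul (Complex.continuous_im.sub continuous_const))
      continuous_const

def slit (b : Bool) : Set (Punctured c) := Subtype.val ⁻¹' slitSet c b

/-- Distinct real parts place `t` on the vertical line of at most one puncture. Its position above
or below that puncture selects the slit plane. -/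
theorem exists_mem_slit (hc : Function.Injective fun i => (c i).re) (t : Punctured c) :
    ∃ b, t ∈ slit c b := by
  by_cases h : ∃ i, t.1.re = (c i).re
  · obtain ⟨i, hi⟩ := h
    have hne : t.1.im - (c i).im ≠ 0 := fun h => t.2 i (Complex.ext hi (sub_eq_zero.1 h))
    have huniq : ∀ j, t.1.re = (c j).re → j = i := fun j hj => hc (hj.symm.trans hi)
    rcases lt_or_gt_of_ne hne with h | h
    · refine ⟨false, fun j hj => ?_⟩
      rw [huniq j hj]
      simpa [boolSign] using h
    · refine ⟨true, fun j hj => ?_⟩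
      rw [huniq j hj]
      simpa [boolSign] using h
  · push Not at h
    exact ⟨true, fun i hi => absurd hi (h i)⟩

section Cone

variable [Fintype ι]

/-- Beyond this height, upwards or downwards according to the sign, the half-plane is convex and
clear of the slits. -/
def coneHeight : ℝ := 1 + ∑ i, |(c i).im|

theorem lt_coneHeight (b : Bool) (i : ι) : boolSign b * (c i).im < coneHeight c := by
  have h1 : |(c i).im| ≤ ∑ i, |(c i).im| :=
    Finset.single_le_sum (f := fun i => |(c i).im|) (fun _ _ => abs_nonneg _) (Finset.mem_univ i)
  have h2 : boolSign b * (c i).im ≤ |(c i).im| := by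
    cases b
    · simpa [boolSign] using neg_le_abs _
    · simpa [boolSign] using le_abs_self _
  unfold coneHeight
  linarith

theorem coneHeight_pos : 0 < coneHeight c :=
  add_pos_of_pos_of_nonneg one_pos (Finset.sum_nonneg fun _ _ => abs_nonneg _)

/-- The apex of the cone contraction. -/
def apexPoint (b : Bool) : ℂ := ⟨0, boolSign b * coneHeight c⟩

/-- The contraction of a slit plane: move vertically away from the slits, and then straight to the
apex. -/
def coneFun (b : Bool) (s : ℝ) (t : ℂ) : ℂ :=
  ⟨(1 - max (2 * s - 1) 0) * t.re, (1 - max (2 * s - 1) 0) *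
    (t.im + boolSign b * min (2 * s) 1 * (|t.im| + coneHeight c)) +
      max (2 * s - 1) 0 * (boolSign b * coneHeight c)⟩

theorem continuous_coneFun (b : Bool) : Continuous (Function.uncurry (coneFun c b)) := by
  have : Function.uncurry (coneFun c b) = fun p : ℝ × ℂ => Complex.equivRealProdCLM.symm
    ((1 - max (2 * p.1 - 1) 0) * p.2.re, (1 - max (2 * p.1 - 1) 0) *
    (p.2.im + boolSign b * min (2 * p.1) 1 * (|p.2.im| + coneHeight c)) +
      max (2 * p.1 - 1) 0 * (boolSign b * coneHeight c)) := by
    funext p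
    obtain ⟨s, t⟩ := p
    apply Complex.ext <;> simp [coneFun, Function.uncurry, Complex.equivRealProdCLM_symm_apply]
  rw [this]
  fun_prop

theorem coneFun_zero (b : Bool) (t : ℂ) : coneFun c b 0 t = t := by
  apply Complex.ext <;> simp [coneFun]

theorem coneFun_one (b : Bool) (t : ℂ) : coneFun c b 1 t = apexPoint c b := by
  have h1 : (2 : ℝ) * 1 - 1 = 1 := by norm_num
  have h2 : min ((2 : ℝ) * 1) 1 = 1 := by norm_num
  apply Complex.ext <;> simp only [coneFun, apexPoint, h1, h2] <;> simp

/-- Up to time `1 / 2` the point keeps its real part and moves away from the slits. The shift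
`|t.im| + coneHeight c` brings its signed height to at least `coneHeight c`, and the second half is
a segment in a convex half-plane. -/
theorem coneFun_mem {b : Bool} {s : ℝ} {t : ℂ} (h0 : 0 ≤ s) (h1 : s ≤ 1) (ht : t ∈ slitSet c b) :
    coneFun c b s t ∈ slitSet c b := by
  intro i hi
  have hb := boolSign_mul_self b
  have hH := lt_coneHeight c b i
  have hHp := coneHeight_pos c
  rcases le_total s (1 / 2) with hs | hs
  · have e1 : max (2 * s - 1) 0 = 0 := max_eq_right (by linarith)
    have e2 : min (2 * s) 1 = 2 * s := min_eq_left (by linarith)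
    simp only [coneFun, e1, e2] at hi ⊢
    have h2 := ht i (by linarith)
    have h3 : 0 ≤ 2 * s * (|t.im| + coneHeight c) := by positivity
    have h4 : boolSign b * ((1 - 0) * (t.im + boolSign b * (2 * s) * (|t.im| + coneHeight c)) +
        0 * (boolSign b * coneHeight c) - (c i).im) = boolSign b * (t.im - (c i).im) +
        (boolSign b * boolSign b) * (2 * s * (|t.im| + coneHeight c)) := by ring
    rw [h4, hb]
    linarith
  · have e1 : max (2 * s - 1) 0 = 2 * s - 1 := max_eq_left (by linarith)
    have e2 : min (2 * s) 1 = 1 := min_eq_right (by linarith)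
    simp only [coneFun, e1, e2]
    have h3 : 0 ≤ boolSign b * t.im + |t.im| := by
      cases b
      · simpa [boolSign, add_comm] using le_abs_self t.im
      · have := neg_le_abs t.im
        simp only [boolSign, if_true, one_mul]
        linarith
    have h4 : boolSign b * ((1 - (2 * s - 1)) * (t.im + boolSign b * 1 * (|t.im| + coneHeight c)) +
        (2 * s - 1) * (boolSign b * coneHeight c) - (c i).im) =
        (1 - (2 * s - 1)) * (boolSign b * t.im + (boolSign b * boolSign b) * |t.im|) +
        (boolSign b * boolSign b) * coneHeight c - boolSign b * (c i).im := by ring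
    rw [h4, hb, one_mul, one_mul]
    have h5 : 0 ≤ (1 - (2 * s - 1)) * (boolSign b * t.im + |t.im|) :=
      mul_nonneg (by linarith) h3
    linarith

theorem apexPoint_mem (b : Bool) : apexPoint c b ∈ slitSet c b := by
  intro i _
  have := lt_coneHeight c b i
  simp only [apexPoint, mul_sub, ← mul_assoc, boolSign_mul_self]
  linarith

def apex (b : Bool) : Punctured c := ⟨apexPoint c b, ne_of_mem_slitSet c (apexPoint_mem c b)⟩

/-- The path from the apex to a point of a slit plane. -/
def conePath {b : Bool} {t : Punctured c} (ht : t ∈ slit c b) : Path (apex c b) t where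
  toFun s := ⟨coneFun c b (1 - s) t.1, ne_of_mem_slitSet c
    (coneFun_mem c (by linarith [s.2.2]) (by linarith [s.2.1]) ht)⟩
  continuous_toFun := Continuous.subtype_mk
    ((continuous_coneFun c b).comp (by fun_prop : Continuous fun s : I => ((1 - s : ℝ), t.1))) _
  source' := Subtype.ext (by simp [coneFun_one, apex])
  target' := Subtype.ext (by simp [coneFun_zero])

theorem conePath_mem {b : Bool} {t : Punctured c} (ht : t ∈ slit c b) (s : I) :
    conePath c ht s ∈ slit c b :=
  coneFun_mem c (by linarith [s.2.2]) (by linarith [s.2.1]) ht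

/-- Contracting all points of `γ` at once gives a square with one side constant at the apex. -/
theorem conePath_trans {b : Bool} {x y : Punctured c} (γ : Path x y) (hγ : ∀ s, γ s ∈ slit c b)
    (hx : x ∈ slit c b) (hy : y ∈ slit c b) :
    (Path.Homotopic.Quotient.mk (conePath c hx)).trans (.mk γ) = .mk (conePath c hy) := by
  let F : I → I → Punctured c := fun s r => ⟨coneFun c b (1 - r) (γ s).1, ne_of_mem_slitSet c
    (coneFun_mem c (by linarith [r.2.2]) (by linarith [r.2.1]) (hγ s))⟩
  have hF : Continuous (Function.uncurry F) := by
    refine Continuous.subtype_mk ?_ _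
    have h1 : Continuous fun p : I × I => ((1 - p.2 : ℝ), (γ p.1).1) := by
      refine Continuous.prodMk (by fun_prop) ?_
      exact continuous_subtype_val.comp (γ.continuous.comp continuous_fst)
    exact (continuous_coneFun c b).comp h1
  have h := square_homotopic hF (p := Path.refl (apex c b)) (q := γ) (l := conePath c hx)
    (r := conePath c hy) (fun t => Subtype.ext (by
      change apexPoint c b = coneFun c b (1 - (0 : I)) (γ t).1
      rw [Set.Icc.coe_zero, sub_zero, coneFun_one]))
    (fun t => Subtype.ext (by simp [F, coneFun_zero]))
    (fun s => Subtype.ext (by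
      change coneFun c b (1 - s) x.1 = coneFun c b (1 - s) (γ 0).1
      rw [γ.source]))
    (fun s => Subtype.ext (by
      change coneFun c b (1 - s) y.1 = coneFun c b (1 - s) (γ 1).1
      rw [γ.target]))
  rw [Path.Homotopic.Quotient.mk_refl, Path.Homotopic.Quotient.refl_trans] at h
  exact h.symm

/-- The contraction moves the apex away and back, so this path is not constant. By `conePath_trans`
its class is idempotent, hence trivial. -/
theorem conePath_apex (b : Bool) :
    Path.Homotopic.Quotient.mk (conePath c (t := apex c b) (apexPoint_mem c b)) = .refl _ := by
  have h := conePath_trans c (conePath c (t := apex c b) (apexPoint_mem c b))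
    (conePath_mem c _) (apexPoint_mem c b) (apexPoint_mem c b)
  have h2 := congrArg (fun γ => Path.Homotopic.Quotient.trans (Path.Homotopic.Quotient.symm
    (.mk (conePath c (t := apex c b) (apexPoint_mem c b)))) γ) h
  simpa [← Path.Homotopic.Quotient.trans_assoc] using h2

end Cone

end PuncturedPlane
end HigherOrderDegree
end

noncomputable section
namespace HigherOrderDegree

open scoped unitInterval

/-! ### Vertical strips, crossings and branches of the logarithm -/

section Strips

variable {ι : Type*} (c : ι → ℂ)

theorem mem_slit_of_re_ne {t : Punctured c} (h : ∀ j, t.1.re ≠ (c j).re) (b : Bool) :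
    t ∈ slit c b := fun j hj => absurd hj (h j)

theorem re_ne_of_mem_slit {t : Punctured c} (h1 : t ∈ slit c true) (h2 : t ∈ slit c false) (j : ι) :
    t.1.re ≠ (c j).re := by
  intro h
  have a := h1 j h
  have b := h2 j h
  simp only [boolSign, if_true, Bool.false_eq_true, if_false] at a b
  linarith

variable [Fintype ι]

open Classical in
/-- The indices of the punctures to the left of a point. -/
def leftSet (t : ℂ) : Finset ι := Finset.univ.filter fun j => (c j).re < t.re

theorem mem_leftSet {t : ℂ} {j : ι} : j ∈ leftSet c t ↔ (c j).re < t.re := by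
  simp [leftSet]

open Classical in
/-- The indices of the punctures that are not to the right of a given one. -/
def leftSetAt (i : ι) : Finset ι := Finset.univ.filter fun j => (c j).re ≤ (c i).re

theorem mem_leftSetAt {i j : ι} : j ∈ leftSetAt c i ↔ (c j).re ≤ (c i).re := by
  simp [leftSetAt]

theorem leftSetAt_injective (hc : Function.Injective fun i => (c i).re) :
    Function.Injective (leftSetAt c) := by
  intro i j h
  have h1 : i ∈ leftSetAt c j := h ▸ (mem_leftSetAt c).2 le_rfl
  have h2 : j ∈ leftSetAt c i := h ▸ (mem_leftSetAt c).2 le_rfl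
  exact hc (le_antisymm ((mem_leftSetAt c).1 h1) ((mem_leftSetAt c).1 h2))

theorem exists_re_right (i : ι) : ∃ t : Punctured c, leftSet c t.1 = leftSetAt c i ∧
    ∀ j, t.1.re ≠ (c j).re := by
  obtain ⟨r, hr, hr2⟩ : ∃ r, (c i).re < r ∧ ∀ j, (c i).re < (c j).re → r < (c j).re := by
    have h : ∀ᶠ r in nhdsWithin (c i).re (Set.Ioi (c i).re), (c i).re < r ∧
        ∀ j, (c i).re < (c j).re → r < (c j).re := by
      refine Filter.Eventually.and self_mem_nhdsWithin (Filter.eventually_all.2 fun j => ?_)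
      by_cases hj : (c i).re < (c j).re
      · filter_upwards [nhdsWithin_le_nhds (gt_mem_nhds hj)] with r h _ using h
      · exact Filter.Eventually.of_forall fun r h => absurd h hj
    exact h.exists
  have hne : ∀ j, (⟨r, 0⟩ : ℂ).re ≠ (c j).re := by
    intro j h
    change r = _ at h
    have := hr2 j (h ▸ hr)
    exact this.ne h
  refine ⟨⟨⟨r, 0⟩, fun j h => hne j (congrArg Complex.re h)⟩, ?_, hne⟩
  ext j
  rw [mem_leftSet, mem_leftSetAt]
  change _ < r ↔ _
  constructor
  · intro h
    by_contra! h'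
    exact (hr2 j h').not_gt h
  · intro h
    exact h.trans_lt hr

theorem exists_re_left : ∃ t : Punctured c, leftSet c t.1 = ∅ ∧ ∀ j, t.1.re ≠ (c j).re := by
  obtain ⟨r, hr⟩ : ∃ r : ℝ, ∀ j, r < (c j).re :=
    (Filter.eventually_all.2 fun j => Filter.eventually_lt_atBot (c j).re).exists
  have hne : ∀ j, (⟨r, 0⟩ : ℂ).re ≠ (c j).re := fun j => (hr j).ne
  refine ⟨⟨⟨r, 0⟩, fun j h => hne j (congrArg Complex.re h)⟩, ?_, hne⟩
  ext j
  simp only [mem_leftSet, Finset.notMem_empty, iff_false, not_lt]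
  exact (hr j).le

theorem leftSet_eq (t : ℂ) : leftSet c t = ∅ ∨ ∃ i, leftSet c t = leftSetAt c i := by
  rcases (leftSet c t).eq_empty_or_nonempty with h | h
  · exact Or.inl h
  · obtain ⟨i, hi, hmax⟩ := Finset.exists_max_image (leftSet c t) (fun j => (c j).re) h
    refine Or.inr ⟨i, ?_⟩
    ext j
    rw [mem_leftSetAt]
    refine ⟨fun hj => hmax j hj, fun hj => ?_⟩
    rw [mem_leftSet] at hi ⊢
    exact hj.trans_lt hi

/-- The class of the path between the two apices that passes through `t`. -/
def crossing {t : Punctured c} (ht : ∀ j, t.1.re ≠ (c j).re) :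
    Path.Homotopic.Quotient (apex c true) (apex c false) :=
  (Path.Homotopic.Quotient.mk (conePath c (mem_slit_of_re_ne c ht true))).trans
    (Path.Homotopic.Quotient.mk (conePath c (mem_slit_of_re_ne c ht false))).symm

/-- The points lie in the same vertical strip, and the segment between them stays in both slit
planes; both cone paths can be slid along it. -/
theorem crossing_congr {x y : Punctured c} (hx : ∀ j, x.1.re ≠ (c j).re)
    (hy : ∀ j, y.1.re ≠ (c j).re) (h : leftSet c x.1 = leftSet c y.1) :
    crossing c hx = crossing c hy := by
  have hlt : ∀ j, (c j).re < x.1.re ↔ (c j).re < y.1.re := fun j => by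
    rw [← mem_leftSet, h, mem_leftSet]
  have hseg : ∀ (s : I) (j : ι), (1 - (s : ℝ)) * x.1.re + s * y.1.re ≠ (c j).re := by
    intro s j
    have h0 := s.2.1
    have h1 := s.2.2
    rcases lt_or_gt_of_ne (hx j) with hj | hj
    · have hj2 : y.1.re < (c j).re := lt_of_le_of_ne (not_lt.1 fun h => hj.not_gt ((hlt j).2 h)) (hy j)
      refine ne_of_lt ?_
      rcases h0.eq_or_lt with h0 | h0
      · rw [← h0]; simpa using hj
      · nlinarith
    · have hj2 := (hlt j).1 hj
      refine ne_of_gt ?_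
      rcases h0.eq_or_lt with h0 | h0
      · rw [← h0]; simpa using hj
      · nlinarith
  have hre : ∀ s : I, ((1 - (s : ℂ)) * x.1 + s * y.1).re = (1 - (s : ℝ)) * x.1.re + s * y.1.re := by
    intro s
    simp
  let γ : Path x y :=
    { toFun := fun s => ⟨(1 - (s : ℂ)) * x.1 + s * y.1, fun j h => hseg s j (by rw [← hre, h])⟩
      continuous_toFun := Continuous.subtype_mk (by fun_prop) _
      source' := Subtype.ext (by simp)
      target' := Subtype.ext (by simp) }
  have hγ : ∀ b s, γ s ∈ slit c b := fun b s => mem_slit_of_re_ne c (fun j => by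
    change ((1 - (s : ℂ)) * x.1 + s * y.1).re ≠ _
    rw [hre]; exact hseg s j) b
  have e1 := conePath_trans c γ (hγ true) (mem_slit_of_re_ne c hx true) (mem_slit_of_re_ne c hy true)
  have e2 := conePath_trans c γ (hγ false) (mem_slit_of_re_ne c hx false)
    (mem_slit_of_re_ne c hy false)
  have e3 : Path.Homotopic.Quotient.mk (conePath c (mem_slit_of_re_ne c hx false)) =
      (Path.Homotopic.Quotient.mk (conePath c (mem_slit_of_re_ne c hy false))).trans
        (Path.Homotopic.Quotient.mk γ).symm := by
    rw [← e2, Path.Homotopic.Quotient.trans_assoc, Path.Homotopic.Quotient.trans_symm,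
      Path.Homotopic.Quotient.trans_refl]
  have e4 : ∀ {a b c : Punctured c} (p : Path.Homotopic.Quotient a b)
      (q : Path.Homotopic.Quotient b c), (p.trans q).symm = q.symm.trans p.symm := by
    intro a b c p q
    have h1 : (p.trans q).symm.trans ((p.trans q).trans (q.symm.trans p.symm)) =
        q.symm.trans p.symm := by
      rw [← Path.Homotopic.Quotient.trans_assoc, Path.Homotopic.Quotient.symm_trans,
        Path.Homotopic.Quotient.refl_trans]
    rw [← h1, Path.Homotopic.Quotient.trans_assoc, ← Path.Homotopic.Quotient.trans_assoc q,
      Path.Homotopic.Quotient.trans_symm, Path.Homotopic.Quotient.refl_trans,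
      Path.Homotopic.Quotient.trans_symm, Path.Homotopic.Quotient.trans_refl]
  have e5 : (Path.Homotopic.Quotient.mk γ).symm.symm = .mk γ := by
    rw [← Path.Homotopic.Quotient.mk_symm, ← Path.Homotopic.Quotient.mk_symm, Path.symm_symm]
  rw [crossing, crossing, ← e1, e3, e4, e5, Path.Homotopic.Quotient.trans_assoc]

end Strips

section BranchIncrement

variable {ι : Type*} (c : ι → ℂ)

/-- A branch of the logarithm of `z` off a vertical ray. -/
def branch (b : Bool) (z : ℂ) : ℂ :=
  Complex.log (-(boolSign b * Complex.I * z)) + boolSign b * (Real.pi / 2 * Complex.I)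

theorem branch_mem_slitPlane {b : Bool} {z : ℂ} (hz : z.re = 0 → 0 < boolSign b * z.im) :
    -(boolSign b * Complex.I * z) ∈ Complex.slitPlane := by
  rw [Complex.mem_slitPlane_iff]
  by_cases h : z.re = 0
  · left
    simpa using hz h
  · right
    have : boolSign b ≠ 0 := by cases b <;> simp [boolSign]
    simpa using ⟨this, h⟩

theorem exp_branch {b : Bool} {z : ℂ} (hz : z ≠ 0) : Complex.exp (branch b z) = z := by
  have hb : (boolSign b : ℂ) ≠ 0 := by cases b <;> simp [boolSign]
  rw [branch, Complex.exp_add, Complex.exp_log (by simp [hb, hz])]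
  have : Complex.exp (boolSign b * (Real.pi / 2 * Complex.I)) = boolSign b * Complex.I := by
    cases b
    · simp [boolSign, Complex.exp_neg, Complex.exp_pi_div_two_mul_I]
    · simp [boolSign, Complex.exp_pi_div_two_mul_I]
  rw [this]
  have h2 : (boolSign b : ℂ) * boolSign b = 1 := by exact_mod_cast boolSign_mul_self b
  linear_combination (-(z * Complex.I * Complex.I)) * h2 - z * Complex.I_mul_I

theorem incr_of_mem_slit {b : Bool} {x y : Punctured c} (γ : Path x y) (hγ : ∀ s, γ s ∈ slit c b)
    (j : ι) : incr (subPoint c j) (.mk γ) = branch b (y.1 - c j) - branch b (x.1 - c j) := by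
  rw [incr_mk (subPoint c j) γ (fun s => branch b ((γ s).1 - c j)) ?_ ?_]
  · rw [γ.source, γ.target]
  · have hc : Continuous fun s => ((γ s).1 - c j) :=
      (continuous_subtype_val.comp γ.continuous).sub continuous_const
    refine Continuous.add (Continuous.clog ?_ fun s => branch_mem_slitPlane fun h => ?_)
      continuous_const
    · fun_prop
    · have := hγ s j (by simpa [sub_eq_zero] using h)
      simpa using this
  · exact fun s => exp_branch (sub_ne_zero.2 ((γ s).2 j))

/-- The branches are normalized to agree to the right of the puncture. To the left they differ by a
full period, and this jump produces the winding number of a pair of crossings. -/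
theorem branch_sub_of_pos {z : ℂ} (hz : 0 < z.re) : branch true z - branch false z = 0 := by
  have h1 : -((boolSign true : ℂ) * Complex.I * z) = -(Complex.I * z) := by simp [boolSign]
  have h2 : -((boolSign false : ℂ) * Complex.I * z) = Complex.I * z := by simp [boolSign]
  rw [branch, branch, h1, h2, Complex.log, Complex.log, norm_neg,
    Complex.arg_neg_eq_arg_sub_pi_of_im_pos (by simpa using hz)]
  simp [boolSign]
  ring

theorem branch_sub_of_neg {z : ℂ} (hz : z.re < 0) :
    branch true z - branch false z = 2 * Real.pi * Complex.I := by
  have h1 : -((boolSign true : ℂ) * Complex.I * z) = -(Complex.I * z) := by simp [boolSign]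
  have h2 : -((boolSign false : ℂ) * Complex.I * z) = Complex.I * z := by simp [boolSign]
  rw [branch, branch, h1, h2, Complex.log, Complex.log, norm_neg,
    Complex.arg_neg_eq_arg_add_pi_of_im_neg (by simpa using hz)]
  simp [boolSign]
  ring

theorem incr_crossing [Fintype ι] {t : Punctured c} (ht : ∀ j, t.1.re ≠ (c j).re) (j : ι) :
    incr (subPoint c j) (crossing c ht) =
      (branch true (t.1 - c j) - branch false (t.1 - c j)) -
      (branch true ((apex c true).1 - c j) - branch false ((apex c false).1 - c j)) := by
  rw [crossing, incr_trans, incr_symm, incr_of_mem_slit c _ (conePath_mem c _),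
    incr_of_mem_slit c _ (conePath_mem c _)]
  ring

end BranchIncrement
end HigherOrderDegree
end

noncomputable section
namespace HigherOrderDegree

open scoped unitInterval

/-! ### The fundamental group of the punctured plane is free -/

section Generators

variable {ι : Type*} [Fintype ι] (c : ι → ℂ)

theorem isOpen_slit (b : Bool) : IsOpen (slit c b) :=
  (isOpen_slitSet c b).preimage continuous_subtype_val

theorem eventually_leftSet_eq {x : Punctured c} (hx : ∀ j, x.1.re ≠ (c j).re) :
    ∀ᶠ y : Punctured c in nhds x, leftSet c y.1 = leftSet c x.1 := by
  have hcont : Continuous fun y : Punctured c => y.1.re :=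
    Complex.continuous_re.comp continuous_subtype_val
  have h : ∀ j, ∀ᶠ y : Punctured c in nhds x, (c j).re < y.1.re ↔ (c j).re < x.1.re := by
    intro j
    rcases lt_or_gt_of_ne (hx j) with hj | hj
    · filter_upwards [hcont.continuousAt.eventually_lt_const hj] with y hy
      exact iff_of_false hy.not_gt hj.not_gt
    · filter_upwards [hcont.continuousAt.eventually_const_lt hj] with y hy
      exact iff_of_true hy hj
  filter_upwards [Filter.eventually_all.2 h] with y hy
  ext j
  rw [mem_leftSet, mem_leftSet, hy]

open Classical in
/-- The generator attached to a strip. -/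
def stripGenerator (A : Finset ι) : FreeGroup ι :=
  if h : ∃ i, A = leftSetAt c i then FreeGroup.of h.choose else 1

theorem stripGenerator_leftSetAt (hc : Function.Injective fun i => (c i).re) (i : ι) :
    stripGenerator c (leftSetAt c i) = FreeGroup.of i := by
  have h : ∃ k, leftSetAt c i = leftSetAt c k := ⟨i, rfl⟩
  rw [stripGenerator, dif_pos h]
  exact congrArg _ (leftSetAt_injective c hc h.choose_spec).symm

theorem stripGenerator_empty : stripGenerator c ∅ = 1 := by
  rw [stripGenerator, dif_neg]
  rintro ⟨i, h⟩
  have : i ∈ leftSetAt c i := (mem_leftSetAt c).2 le_rfl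
  rw [← h] at this
  simp at this

/-- A point of the leftmost strip. -/
def leftPoint : Punctured c := (exists_re_left c).choose

theorem leftPoint_re : ∀ j, (leftPoint c).1.re ≠ (c j).re := (exists_re_left c).choose_spec.2

theorem leftSet_leftPoint : leftSet c (leftPoint c).1 = ∅ := (exists_re_left c).choose_spec.1

/-- A point of the strip to the right of `c i`. -/
def rightPoint (i : ι) : Punctured c := (exists_re_right c i).choose

theorem rightPoint_re (i : ι) : ∀ j, (rightPoint c i).1.re ≠ (c j).re :=
  (exists_re_right c i).choose_spec.2

theorem leftSet_rightPoint (i : ι) : leftSet c (rightPoint c i).1 = leftSetAt c i :=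
  (exists_re_right c i).choose_spec.1

/-- The loop that crosses the strip to the right of `c i` downwards and returns through the leftmost
strip. -/
def stripLoop (i : ι) : FundamentalGroup (Punctured c) (apex c true) :=
  Path.Homotopic.Quotient.trans (crossing c (rightPoint_re c i)) (crossing c (leftPoint_re c)).symm

/-- The homomorphism to the fundamental group given by the loops `stripLoop`. -/
def stripHom : FreeGroup ι →* FundamentalGroup (Punctured c) (apex c true) :=
  FreeGroup.lift (stripLoop c)

theorem branch_sub_eq {z : ℂ} (hz : z.re ≠ 0) :
    branch true z - branch false z = if 0 < z.re then 0 else 2 * Real.pi * Complex.I := by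
  split_ifs with h
  · exact branch_sub_of_pos h
  · exact branch_sub_of_neg (lt_of_le_of_ne (not_lt.1 h) hz)

/-- The loop descends just to the right of `c i` and ascends at the far left. It encloses,
clockwise, the punctures whose real part does not exceed that of `c i`; hence the minus sign. -/
theorem incr_stripHom_of (i j : ι) : incr (subPoint c j) (stripHom c (.of i)) =
    if (c j).re ≤ (c i).re then -(2 * Real.pi * Complex.I) else 0 := by
  have h1 : 0 < ((rightPoint c i).1 - c j).re ↔ (c j).re ≤ (c i).re := by
    rw [Complex.sub_re, sub_pos, ← mem_leftSet, leftSet_rightPoint, mem_leftSetAt]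
  have h2 : ¬ 0 < ((leftPoint c).1 - c j).re := by
    rw [Complex.sub_re, sub_pos, ← mem_leftSet, leftSet_leftPoint]
    simp
  rw [stripHom, FreeGroup.lift_apply_of, stripLoop, incr_trans, incr_symm, incr_crossing,
    incr_crossing, branch_sub_eq (z := (rightPoint c i).1 - c j) (by
      rw [Complex.sub_re, sub_ne_zero]; exact rightPoint_re c i j),
    branch_sub_eq (z := (leftPoint c).1 - c j) (by
      rw [Complex.sub_re, sub_ne_zero]; exact leftPoint_re c j), if_neg h2]
  simp only [h1]
  split_ifs <;> ring

/-- Glue a local system with fibre the free group, taking the generator of each strip as transition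
function between the slit planes. Its holonomy along the loop of a word is the word itself. -/
theorem stripHom_injective (hc : Function.Injective fun i => (c i).re) :
    Function.Injective (stripHom c) := by
  obtain ⟨R, h1, h2, h3, h4, h5⟩ := exists_holonomy (fun b => slit c b)
    (fun t : Punctured c => stripGenerator c (leftSet c t.1))
    (isOpen_slit c) (exists_mem_slit c hc)
    (fun x hx => by
      filter_upwards [eventually_leftSet_eq c (re_ne_of_mem_slit c hx.1 hx.2)] with y hy
      rw [hy])
  have hcross : ∀ {t : Punctured c} (ht : ∀ j, t.1.re ≠ (c j).re),
      R (crossing c ht) true false (stripGenerator c (leftSet c t.1)) := by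
    intro t ht
    have a := h1 (conePath c (mem_slit_of_re_ne c ht true)) true (conePath_mem c _)
    have b := h4 t (mem_slit_of_re_ne c ht true) (mem_slit_of_re_ne c ht false)
    have d := h3 _ _ _ _ (h1 (conePath c (mem_slit_of_re_ne c ht false)) false (conePath_mem c _))
    have e := h2 _ _ _ _ _ _ _ (h2 _ _ _ _ _ _ _ a b) d
    rw [Path.Homotopic.Quotient.trans_refl, inv_one, one_mul, mul_one] at e
    exact e
  have hR : ∀ w, R (stripHom c w) true true w := by
    intro w
    induction w using FreeGroup.induction_on with
    | C1 =>
      rw [map_one]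
      exact h1 (Path.refl _) true fun _ => apexPoint_mem c true
    | of i =>
      have := h2 _ _ _ _ _ _ _ (hcross (rightPoint_re c i)) (h3 _ _ _ _ (hcross (leftPoint_re c)))
      rw [leftSet_leftPoint, stripGenerator_empty, leftSet_rightPoint,
        stripGenerator_leftSetAt c hc, inv_one, one_mul] at this
      rw [stripHom, FreeGroup.lift_apply_of]
      exact this
    | inv_of i h =>
      rw [map_inv]
      exact h3 _ _ _ _ h
    | mul x y hx hy =>
      rw [map_mul, FundamentalGroup.mul_def]
      -- A product in the fundamental group runs its right factor first, which matches the order `b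
      -- * a` in which holonomies compose.
      exact h2 _ _ _ _ _ _ _ hy hx
  intro w w' hw
  have := hR w'
  rw [← hw] at this
  exact h5 _ _ _ _ _ (apexPoint_mem c true) (hR w) this

/-- The classes of paths from the base point that are standard up to the image of `stripHom`. -/
def IsStripStandard (b : Bool) {x : Punctured c}
    (a : Path.Homotopic.Quotient (apex c true) x) : Prop :=
  ∃ κ ∈ (stripHom c).range, ∃ hx : x ∈ slit c b,
    a = Path.Homotopic.Quotient.trans κ (match b, hx with
      | true, hx => .mk (conePath c hx)
      | false, hx => (crossing c (leftPoint_re c)).trans (.mk (conePath c hx)))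

theorem exists_crossing_eq {x : Punctured c} (hx : ∀ j, x.1.re ≠ (c j).re) :
    ∃ κ ∈ (stripHom c).range, crossing c hx =
      Path.Homotopic.Quotient.trans κ (crossing c (leftPoint_re c)) := by
  rcases leftSet_eq c x.1 with h | ⟨i, h⟩
  · refine ⟨1, Subgroup.one_mem _, ?_⟩
    rw [FundamentalGroup.one_def, Path.Homotopic.Quotient.refl_trans]
    exact crossing_congr c _ _ (h.trans (leftSet_leftPoint c).symm)
  · refine ⟨stripHom c (.of i), ⟨_, rfl⟩, ?_⟩
    rw [stripHom, FreeGroup.lift_apply_of, stripLoop, Path.Homotopic.Quotient.trans_assoc,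
      Path.Homotopic.Quotient.symm_trans, Path.Homotopic.Quotient.trans_refl]
    exact crossing_congr c _ _ (h.trans (leftSet_rightPoint c i).symm)

/-- Passing to the other slit plane inserts a crossing. Each crossing is the leftmost one up to an
element of the range of `stripHom`. -/
theorem IsStripStandard.change {b b' : Bool} {x : Punctured c}
    {a : Path.Homotopic.Quotient (apex c true) x} (ha : IsStripStandard c b a)
    (hx : x ∈ slit c b') : IsStripStandard c b' a := by
  obtain ⟨κ, hκ, hb, rfl⟩ := ha
  have hne : b ≠ b' → ∀ j, x.1.re ≠ (c j).re := fun h => by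
    cases b <;> cases b' <;> first | exact absurd rfl h | skip
    · exact re_ne_of_mem_slit c hx hb
    · exact re_ne_of_mem_slit c hb hx
  have hcross : ∀ h : ∀ j, x.1.re ≠ (c j).re, (crossing c h).trans
      (.mk (conePath c (mem_slit_of_re_ne c h false))) =
        .mk (conePath c (mem_slit_of_re_ne c h true)) := fun h => by
    rw [crossing, Path.Homotopic.Quotient.trans_assoc, Path.Homotopic.Quotient.symm_trans,
      Path.Homotopic.Quotient.trans_refl]
  cases b <;> cases b'
  · exact ⟨κ, hκ, hb, rfl⟩
  · obtain ⟨κ', hκ', h⟩ := exists_crossing_eq c (hne (by simp))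
    refine ⟨κ'⁻¹ * κ, Subgroup.mul_mem _ (Subgroup.inv_mem _ hκ') hκ, hx, ?_⟩
    have h1 := hcross (hne (by simp))
    rw [h] at h1
    rw [FundamentalGroup.mul_def, FundamentalGroup.inv_def]
    simp only
    rw [← h1, Path.Homotopic.Quotient.trans_assoc, Path.Homotopic.Quotient.trans_assoc κ',
      ← Path.Homotopic.Quotient.trans_assoc (Path.Homotopic.Quotient.symm κ'),
      Path.Homotopic.Quotient.symm_trans, Path.Homotopic.Quotient.refl_trans]
  · obtain ⟨κ', hκ', h⟩ := exists_crossing_eq c (hne (by simp))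
    refine ⟨κ' * κ, Subgroup.mul_mem _ hκ' hκ, hx, ?_⟩
    have h1 := hcross (hne (by simp))
    rw [h] at h1
    rw [FundamentalGroup.mul_def]
    simp only
    rw [← h1, Path.Homotopic.Quotient.trans_assoc, Path.Homotopic.Quotient.trans_assoc]
  · exact ⟨κ, hκ, hb, rfl⟩

/-- Being standard survives each short piece of a path inside one slit plane. A standard loop, read
in the slit plane of the base apex, belongs to the range since the cone path there is trivial. -/
theorem stripHom_surjective (hc : Function.Injective fun i => (c i).re) :
    Function.Surjective (stripHom c) := by
  have key : ∀ {x y : Punctured c} (γ : Path.Homotopic.Quotient x y),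
      ∀ b (a : Path.Homotopic.Quotient (apex c true) x), IsStripStandard c b a →
        ∃ b', IsStripStandard c b' (a.trans γ) := by
    intro x y γ
    refine path_induction (fun b => slit c b)
      (isOpen_slit c) (exists_mem_slit c hc)
      (fun {x y} γ => ∀ b (a : Path.Homotopic.Quotient (apex c true) x), IsStripStandard c b a →
        ∃ b', IsStripStandard c b' (a.trans γ)) ?_ ?_ γ
    · intro x y z γ γ' h h' b a ha
      obtain ⟨b', hb'⟩ := h b a ha
      rw [← Path.Homotopic.Quotient.trans_assoc]
      exact h' b' _ hb'
    · intro i x y γ hγ b a ha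
      have hx : x ∈ slit c i := γ.source ▸ hγ 0
      have hy : y ∈ slit c i := γ.target ▸ hγ 1
      obtain ⟨κ, hκ, _, rfl⟩ := ha.change c hx
      refine ⟨i, κ, hκ, hy, ?_⟩
      have h := conePath_trans c γ hγ hx hy
      cases i
      · simp only
        rw [← h]
        simp only [Path.Homotopic.Quotient.trans_assoc]
      · simp only
        rw [← h]
        simp only [Path.Homotopic.Quotient.trans_assoc]
  intro γ
  obtain ⟨b, hb⟩ := key γ true (.refl _) ⟨1, Subgroup.one_mem _, apexPoint_mem c true, by
    simp only
    rw [conePath_apex, FundamentalGroup.one_def, Path.Homotopic.Quotient.trans_refl]⟩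
  obtain ⟨κ, hκ, _, h⟩ := hb.change c (b' := true) (apexPoint_mem c true)
  simp only at h
  rw [conePath_apex, Path.Homotopic.Quotient.refl_trans, Path.Homotopic.Quotient.trans_refl] at h
  exact h ▸ hκ

end Generators
end HigherOrderDegree
end

noncomputable section
namespace HigherOrderDegree

open scoped unitInterval

/-! ### Fundamental groups of products with the punctured plane -/

section Product

variable {X Y : Type*} [TopologicalSpace X] [TopologicalSpace Y]

/-- The first component of a homeomorphism to a product. -/
def fstMap (e : X ≃ₜ PuncturedPlane × Y) : C(X, PuncturedPlane) :=
  ⟨fun x => (e x).1, by fun_prop⟩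

/-- The second component of a homeomorphism to a product. -/
def sndMap (e : X ≃ₜ PuncturedPlane × Y) : C(X, Y) := ⟨fun x => (e x).2, by fun_prop⟩

theorem logIncr_refl (x : PuncturedPlane) : logIncr (Path.Homotopic.Quotient.refl x) = 0 := by
  have := logIncr_trans (Path.Homotopic.Quotient.refl x) (.refl _)
  simpa using this

theorem exists_int_incr (g : C(X, PuncturedPlane)) {u : X} (γ : Path.Homotopic.Quotient u u) :
    ∃ n : ℤ, incr g γ = n * (2 * Real.pi * Complex.I) := by
  induction γ using Path.Homotopic.Quotient.ind with | mk γ => ?_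
  obtain ⟨L, hL, h⟩ := exists_log_comp_path g γ
  rw [incr_mk g γ L hL h]
  apply Complex.exp_eq_one_iff.1
  rw [Complex.exp_sub, h, h, γ.source, γ.target, div_self (g u).2]

theorem eq_refl_of_fst_of_snd (e : X ≃ₜ PuncturedPlane × Y) {u : X}
    (γ : Path.Homotopic.Quotient u u) (h1 : incr (fstMap e) γ = 0)
    (h2 : γ.map (sndMap e) = .refl _) : γ = .refl u := by
  have h1' : γ.map (fstMap e) = .refl _ := logIncr_injective (h1.trans (logIncr_refl _).symm)
  induction γ using Path.Homotopic.Quotient.ind with | mk γ => ?_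
  rw [← Path.Homotopic.Quotient.mk_map, ← Path.Homotopic.Quotient.mk_refl,
    Path.Homotopic.Quotient.eq] at h1' h2
  obtain ⟨H1⟩ := h1'
  obtain ⟨H2⟩ := h2
  have H := (Path.Homotopic.prodHomotopy H1 H2).map ⟨e.symm, e.symm.continuous⟩
  rw [← Path.Homotopic.Quotient.mk_refl, Path.Homotopic.Quotient.eq]
  have hu : u = e.symm ((e u).1, (e u).2) := (e.symm_apply_apply u).symm
  convert Path.Homotopic.pathCast ⟨H⟩ hu hu using 1
  · ext t
    exact (e.symm_apply_apply (γ t)).symm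
  · ext t
    exact hu

theorem exists_loop_of_fst_of_snd (e : X ≃ₜ PuncturedPlane × Y) (u : X) (n : ℤ)
    (τ : Path.Homotopic.Quotient (sndMap e u) (sndMap e u)) :
    ∃ γ : Path.Homotopic.Quotient u u, incr (fstMap e) γ = n * (2 * Real.pi * Complex.I) ∧
      γ.map (sndMap e) = τ := by
  induction τ using Path.Homotopic.Quotient.ind with | mk τ => ?_
  have hne := (fstMap e u).2
  let γ : Path u u :=
    { toFun := fun s => e.symm (expCover (Complex.log (fstMap e u) +
        s * (n * (2 * Real.pi * Complex.I))), τ s)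
      continuous_toFun := by
        have : Continuous expCover := isCoveringMap_expCover.continuous
        fun_prop
      source' := by
        rw [e.symm_apply_eq]
        refine Prod.ext (Subtype.ext ?_) τ.source
        simp only [expCover, Set.Icc.coe_zero, Complex.ofReal_zero, zero_mul, add_zero]
        exact Complex.exp_log hne
      target' := by
        rw [e.symm_apply_eq]
        refine Prod.ext (Subtype.ext ?_) τ.target
        simp only [expCover, Set.Icc.coe_one, Complex.ofReal_one, one_mul]
        rw [Complex.exp_add, Complex.exp_int_mul_two_pi_mul_I, mul_one]
        exact Complex.exp_log hne }
  refine ⟨.mk γ, ?_, ?_⟩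
  · rw [incr_mk (fstMap e) γ (fun s => Complex.log (fstMap e u) +
        s * (n * (2 * Real.pi * Complex.I))) (by fun_prop)]
    · simp
    · intro t
      simp [γ, fstMap, expCover]
  · rw [← Path.Homotopic.Quotient.mk_map]
    congr 1
    ext t
    change (e (e.symm _)).2 = τ t
    rw [e.apply_symm_apply]

end Product

section Conjugation

variable {X : Type*} [TopologicalSpace X]

/-- The change of the base point along a path. -/
def conjHom {a b : X} (p : Path.Homotopic.Quotient a b) :
    FundamentalGroup X b →* FundamentalGroup X a where
  toFun γ := p.trans (Path.Homotopic.Quotient.trans γ p.symm)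
  map_one' := by
    rw [FundamentalGroup.one_def, FundamentalGroup.one_def, Path.Homotopic.Quotient.refl_trans,
      Path.Homotopic.Quotient.trans_symm]
  map_mul' γ γ' := by
    rw [FundamentalGroup.mul_def, FundamentalGroup.mul_def]
    simp only [Path.Homotopic.Quotient.trans_assoc]
    rw [← Path.Homotopic.Quotient.trans_assoc p.symm p, Path.Homotopic.Quotient.symm_trans,
      Path.Homotopic.Quotient.refl_trans]

theorem conjHom_apply {a b : X} (p : Path.Homotopic.Quotient a b) (γ : FundamentalGroup X b) :
    conjHom p γ = p.trans (Path.Homotopic.Quotient.trans γ p.symm) := rfl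

theorem conjHom_bijective {a b : X} (p : Path.Homotopic.Quotient a b) :
    Function.Bijective (conjHom p) := by
  constructor
  · intro γ γ' h
    rw [conjHom_apply, conjHom_apply] at h
    have h2 := congrArg (fun δ => p.symm.trans (Path.Homotopic.Quotient.trans δ p)) h
    simpa only [Path.Homotopic.Quotient.trans_assoc, Path.Homotopic.Quotient.symm_trans,
      Path.Homotopic.Quotient.trans_refl,
      ← Path.Homotopic.Quotient.trans_assoc p.symm p, Path.Homotopic.Quotient.refl_trans] using h2
  · intro δ
    refine ⟨p.symm.trans (Path.Homotopic.Quotient.trans δ p), ?_⟩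
    rw [conjHom_apply]
    simp only [Path.Homotopic.Quotient.trans_assoc, Path.Homotopic.Quotient.trans_symm,
      Path.Homotopic.Quotient.trans_refl]
    rw [← Path.Homotopic.Quotient.trans_assoc p p.symm, Path.Homotopic.Quotient.trans_symm,
      Path.Homotopic.Quotient.refl_trans]

theorem incr_conjHom (g : C(X, PuncturedPlane)) {a b : X} (p : Path.Homotopic.Quotient a b)
    (γ : FundamentalGroup X b) : incr g (conjHom p γ) = incr g γ := by
  rw [conjHom_apply, incr_trans, incr_trans, incr_symm]
  ring

end Conjugation

section ProductWithPunctured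

variable {ι : Type*} [Fintype ι] (c : ι → ℂ)

/-- The degree on the free group that corresponds to the total winding number around the
punctures. -/
def stripDegree : FreeGroup ι →* Multiplicative ℤ :=
  FreeGroup.lift fun i => Multiplicative.ofAdd ((leftSetAt c i).card : ℤ)

theorem sum_incr_stripHom (w : FreeGroup ι) : ∑ j, incr (subPoint c j) (stripHom c w) =
    -(2 * Real.pi * Complex.I) * ((stripDegree c w).toAdd : ℂ) := by
  induction w using FreeGroup.induction_on with
  | C1 =>
    rw [map_one, map_one, FundamentalGroup.one_def]
    simp [incr_refl]
  | of i =>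
    simp only [incr_stripHom_of, stripDegree, FreeGroup.lift_apply_of, toAdd_ofAdd, leftSetAt]
    rw [Finset.sum_ite]
    simp [mul_comm]
  | inv_of i h =>
    rw [map_inv, map_inv, FundamentalGroup.inv_def]
    simp only [incr_symm, Finset.sum_neg_distrib, h]
    simp
  | mul x y hx hy =>
    rw [map_mul, map_mul, FundamentalGroup.mul_def]
    simp only [incr_trans, Finset.sum_add_distrib, hx, hy]
    simp
    ring

theorem exists_path_apex (hc : Function.Injective fun i => (c i).re) (t : Punctured c) :
    Nonempty (Path.Homotopic.Quotient (apex c true) t) := by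
  obtain ⟨b, hb⟩ := exists_mem_slit c hc t
  cases b
  · exact ⟨(crossing c (leftPoint_re c)).trans (.mk (conePath c hb))⟩
  · exact ⟨.mk (conePath c hb)⟩

variable {X : Type*} [TopologicalSpace X]

/-- This expresses the isomorphism with `ℤ × FreeGroup ι` without forming the product: the winding
of the first component and `T` are jointly injective and jointly surjective. The third clause
translates linking numbers into the degree of words. -/
theorem exists_hom_freeGroup (hc : Function.Injective fun i => (c i).re)
    (e : X ≃ₜ PuncturedPlane × Punctured c) (u : X) :
    ∃ T : FundamentalGroup X u →* FreeGroup ι,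
      (∀ γ : FundamentalGroup X u, incr (fstMap e) γ = 0 → T γ = 1 → γ = 1) ∧
      (∀ (n : ℤ) w, ∃ γ : FundamentalGroup X u, incr (fstMap e) γ = n * (2 * Real.pi * Complex.I) ∧ T γ = w) ∧
      ∀ γ : FundamentalGroup X u, ∑ j, incr ((subPoint c j).comp (sndMap e)) γ =
        -(2 * Real.pi * Complex.I) * ((stripDegree c (T γ)).toAdd : ℂ) := by
  obtain ⟨p⟩ := exists_path_apex c hc (sndMap e u)
  let θ : FreeGroup ι ≃* FundamentalGroup (Punctured c) (apex c true) :=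
    MulEquiv.ofBijective (stripHom c) ⟨stripHom_injective c hc, stripHom_surjective c hc⟩
  have hθ : ∀ δ, stripHom c (θ.symm δ) = δ := θ.apply_symm_apply
  let T : FundamentalGroup X u →* FreeGroup ι :=
    θ.symm.toMonoidHom.comp ((conjHom p).comp (FundamentalGroup.map (sndMap e) u))
  have hT : ∀ γ, stripHom c (T γ) = conjHom p (FundamentalGroup.map (sndMap e) u γ) :=
    fun γ => hθ _
  refine ⟨T, fun γ h1 h2 => ?_, fun n w => ?_, fun γ => ?_⟩
  · have h3 := hT γ
    rw [h2, map_one] at h3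
    have h4 := (conjHom_bijective p).1 (h3.symm.trans (map_one _).symm)
    exact eq_refl_of_fst_of_snd e γ h1 h4
  · obtain ⟨τ, hτ⟩ := (conjHom_bijective p).2 (stripHom c w)
    obtain ⟨γ, h1, h2⟩ := exists_loop_of_fst_of_snd e u n τ
    refine ⟨γ, h1, stripHom_injective c hc ?_⟩
    rw [hT, ← hτ]
    exact congrArg _ h2
  · rw [← sum_incr_stripHom, hT]
    refine Finset.sum_congr rfl fun j _ => ?_
    rw [incr_conjHom, ← incr_map]
    rfl

end ProductWithPunctured
end HigherOrderDegree
end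

noncomputable section
namespace HigherOrderDegree

open scoped unitInterval

/-! ### Higher-order degrees of product spaces -/

section DegreeOfProduct

variable {ι : Type} [Fintype ι] (c : ι → ℂ) {X : Type*} [TopologicalSpace X]

/-- The loop around the leftmost puncture alone has degree one, as `exists_freeGroup_hom_dvd` needs.
-/
theorem exists_leftSetAt_card_eq_one [Nonempty ι] (hc : Function.Injective fun i => (c i).re) :
    ∃ i, (leftSetAt c i).card = 1 := by
  obtain ⟨i, hi⟩ := Finite.exists_min fun i => (c i).re
  refine ⟨i, Finset.card_eq_one.2 ⟨i, ?_⟩⟩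
  ext j
  rw [mem_leftSetAt, Finset.mem_singleton]
  exact ⟨fun h => hc (le_antisymm h (hi j)), fun h => h ▸ le_rfl⟩

theorem two_pi_I_mul_eq_zero {z : ℂ} (h : 2 * Real.pi * Complex.I * z = 0) : z = 0 :=
  (mul_eq_zero.1 h).resolve_left Complex.two_pi_I_ne_zero

theorem rationalDerivedSeries_le_ker_incrHom (g : C(X, PuncturedPlane)) (u : X) (n : ℕ) :
    rationalDerivedSeries (FundamentalGroup X u) (n + 1) ≤ (incrHom g u).ker := by
  have : IsMulTorsionFree (Multiplicative ℂ) := inferInstance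
  exact rationalDerivedSeries_succ_le_ker _ n

theorem degree_of_product_isEmpty [IsEmpty ι] (e : X ≃ₜ PuncturedPlane × Punctured c) (u : X)
    {P : Type*} [Group P] (ψ : FundamentalGroup X u →* P)
    (hψ : ∀ γ : FundamentalGroup X u, ψ γ = 1 → incr (fstMap e) γ = 0) {F : C(X, PuncturedPlane)}
    (hF : ψ.ker = (incrHom F u).ker) (n : ℕ) : degree ψ n = 0 := by
  obtain ⟨T, h1, -, -⟩ := exists_hom_freeGroup c (fun i => isEmptyElim i) e u
  apply degree_eq_zero_of_subsingleton
  rw [eq_bot_iff]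
  intro γ hγ
  have h2 := rationalDerivedSeries_le_ker_incrHom F u n hγ
  rw [← hF] at h2
  exact h1 γ (hψ γ h2) (Subsingleton.elim _ _)

/-- In the kernel the winding `k` of the first component is fixed by `(l + 2) * k = degree of the
word`. So `T` maps `ψ.ker` isomorphically onto the words of degree divisible by `l + 2`, a free
group of rank `(l + 2) * l + 1`. -/
theorem degree_of_product {l : ℕ} (hl : Fintype.card ι = l + 1)
    (hc : Function.Injective fun i => (c i).re)
    (e : X ≃ₜ PuncturedPlane × Punctured c) (u : X) {P : Type*} [Group P]
    (ψ : FundamentalGroup X u →* P) {F : C(X, PuncturedPlane)} (hker : ψ.ker = (incrHom F u).ker)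
    (hF : ∀ γ : FundamentalGroup X u, incr F γ = (l + 2 : ℕ) * incr (fstMap e) γ +
      ∑ j, incr ((subPoint c j).comp (sndMap e)) γ) (n : ℕ) :
    degree ψ n = ((l + 2) * l : ℕ) := by
  classical
  have : Nonempty ι := Fintype.card_pos_iff.1 (by omega)
  obtain ⟨T, h1, h2, h3⟩ := exists_hom_freeGroup c hc e u
  obtain ⟨i₀, hi₀⟩ := exists_leftSetAt_card_eq_one c hc
  have hdeg₀ : stripDegree c (.of i₀) = Multiplicative.ofAdd 1 := by
    simp [stripDegree, hi₀]
  have hpi := Complex.two_pi_I_ne_zero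
  -- membership in the kernel in terms of the two components
  have hmem : ∀ (γ : FundamentalGroup X u) (k : ℤ),
      incr (fstMap e) γ = k * (2 * Real.pi * Complex.I) →
      (γ ∈ ψ.ker ↔ ((l + 2 : ℕ) : ℤ) * k = (stripDegree c (T γ)).toAdd) := by
    intro γ k hk
    rw [hker, mem_ker_incrHom, hF, h3, hk]
    constructor
    · intro h
      have h4 := two_pi_I_mul_eq_zero (z := ((l + 2 : ℕ) : ℂ) * k - ((stripDegree c (T γ)).toAdd : ℂ))
        (by linear_combination h)
      exact_mod_cast sub_eq_zero.1 h4
    · intro h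
      have h4 : ((l + 2 : ℕ) : ℂ) * k = ((stripDegree c (T γ)).toAdd : ℂ) := by exact_mod_cast h
      linear_combination (2 * Real.pi * Complex.I) * h4
  let J := {j : ι // j ≠ i₀}
  let E : FreeGroup (Option J) ≃* FreeGroup ι := FreeGroup.freeGroupCongr (Equiv.optionSubtypeNe i₀)
  obtain ⟨b, hb, hbr⟩ := exists_freeGroup_hom_dvd (l + 2) ((stripDegree c).comp E.toMonoidHom) (by
    change stripDegree c (E (.of none)) = _
    rw [← hdeg₀]
    simp only [E, FreeGroup.freeGroupCongr_apply, FreeGroup.map.of]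
    rw [Equiv.optionSubtypeNe_none])
  -- lift the free subgroup
  have hlift : ∀ x, ∃ γ : FundamentalGroup X u, γ ∈ ψ.ker ∧ T γ = E (b (.of x)) := by
    intro x
    obtain ⟨k, hk⟩ := (hbr (b (.of x))).1 ⟨_, rfl⟩
    obtain ⟨γ, hγ1, hγ2⟩ := h2 k (E (b (.of x)))
    exact ⟨γ, (hmem γ k hγ1).2 (by rw [hγ2]; exact hk.symm), hγ2⟩
  choose g hg1 hg2 using hlift
  let B := FreeGroup.lift g
  have hTB : ∀ w, T (B w) = E (b w) := by
    intro w
    have : T.comp B = E.toMonoidHom.comp b := by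
      ext x
      simp [B, hg2]
    exact DFunLike.congr_fun this w
  have hBker : ∀ w, B w ∈ ψ.ker := by
    intro w
    induction w using FreeGroup.induction_on with
    | C1 => rw [map_one]; exact Subgroup.one_mem _
    | of x => simpa [B] using hg1 x
    | inv_of x h => rw [map_inv]; exact Subgroup.inv_mem _ h
    | mul x y hx hy => rw [map_mul]; exact Subgroup.mul_mem _ hx hy
  have hTinj : ∀ γ ∈ ψ.ker, T γ = 1 → γ = 1 := by
    intro γ hγ hT
    refine h1 γ ?_ hT
    obtain ⟨k, hk⟩ := exists_int_incr (fstMap e) γ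
    have h4 := (hmem γ k hk).1 hγ
    rw [hT, map_one, toAdd_one] at h4
    have h5 : k = 0 := (mul_eq_zero.1 h4).resolve_left (by positivity)
    rw [hk, h5, Int.cast_zero, zero_mul]
  have hκ : Nat.card (Option (J × Fin (l + 2))) = (l + 2) * l + 1 := by
    have hJ : Fintype.card J = l := by
      have := Fintype.card_subtype_compl (fun j => j = i₀)
      rw [hl, Fintype.card_subtype_eq, Nat.add_sub_cancel] at this
      rw [← this]
    rw [Nat.card_eq_fintype_card, Fintype.card_option, Fintype.card_prod, hJ, Fintype.card_fin,
      mul_comm]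
  refine degree_eq_of_free ψ n hκ B ?_ ?_ ?_ ?_
  · rw [injective_iff_map_eq_one]
    intro w hw
    have h4 := hTB w
    rw [hw, map_one] at h4
    exact (injective_iff_map_eq_one b).1 hb w ((map_eq_one_iff E E.injective).1 h4.symm)
  · apply le_antisymm
    · rintro _ ⟨w, rfl⟩
      exact hBker w
    · intro γ hγ
      obtain ⟨k, hk⟩ := exists_int_incr (fstMap e) γ
      obtain ⟨w, hw⟩ := (hbr (E.symm (T γ))).2 (by
        refine ⟨k, ?_⟩
        have h4 := (hmem γ k hk).1 hγ
        rw [h4]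
        change (stripDegree c (E (E.symm (T γ)))).toAdd = _
        rw [E.apply_symm_apply])
      refine ⟨w, ?_⟩
      have h4 := hTinj (B w * γ⁻¹) (Subgroup.mul_mem _ (hBker w) (Subgroup.inv_mem _ hγ)) (by
        rw [map_mul, map_inv, hTB, hw, E.apply_symm_apply, mul_inv_cancel])
      exact mul_inv_eq_one.1 h4
  · rw [hker]
    exact rationalDerivedSeries_le_ker_incrHom F u n
  · intro h
    -- An element of `ψ.ker` with winding number one in the first component, which no rational
    -- derived subgroup past the first contains.
    obtain ⟨γ, hγ1, hγ2⟩ := h2 1 (.of i₀ ^ (l + 2))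
    have h4 : γ ∈ ψ.ker := (hmem γ 1 hγ1).2 (by
      rw [hγ2, map_pow, hdeg₀, toAdd_pow]
      simp)
    have h5 := mem_ker_incrHom.1 (rationalDerivedSeries_le_ker_incrHom (fstMap e) u n (h h4))
    rw [hγ1, Int.cast_one, one_mul] at h5
    exact hpi h5

end DegreeOfProduct
end HigherOrderDegree
end

noncomputable section
namespace HigherOrderDegree

/-! ### Concurrent lines: the complement as a product -/

section LinearCoordinates

theorem Line.eval_poly (l : Line) (p : Fin 2 → ℂ) :
    MvPolynomial.eval p l.poly = l.a * p 0 + l.b * p 1 + l.c := by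
  simp [Line.poly]

theorem eval_arrangementPoly {m : ℕ} (L : Fin m → Line) (p : Fin 2 → ℂ) :
    MvPolynomial.eval p (arrangementPoly L) = ∏ i, MvPolynomial.eval p (L i).poly := by
  rw [arrangementPoly, map_prod]

theorem Line.exists_complement (l : Line) : ∃ r s : ℂ, l.a * s - l.b * r = 1 := by
  rcases l.ne_zero with h | h
  · exact ⟨0, l.a⁻¹, by field_simp; simp⟩
  · exact ⟨-l.b⁻¹, 0, by field_simp; simp⟩

/-- Multiplying by `1 + s * I` separates the real parts for all but finitely many real `s`, as each
pair of points excludes at most one value. -/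
theorem exists_injective_re {ι : Type*} [Finite ι] {c : ι → ℂ} (hc : Function.Injective c) :
    ∃ ω : ℂ, ω ≠ 0 ∧ Function.Injective fun i => (ω * c i).re := by
  have hfin : (⋃ p : ι × ι, {s : ℝ | p.1 ≠ p.2 ∧
      (c p.1).re - s * (c p.1).im = (c p.2).re - s * (c p.2).im}).Finite := by
    refine Set.finite_iUnion fun p => Set.Subsingleton.finite fun s hs s' hs' => ?_
    by_contra hne
    apply hs.1
    apply hc
    have h1 : (s - s') * ((c p.1).im - (c p.2).im) = 0 := by linarith [hs.2, hs'.2]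
    have h2 : (c p.1).im = (c p.2).im :=
      sub_eq_zero.1 ((mul_eq_zero.1 h1).resolve_left (sub_ne_zero.2 hne))
    refine Complex.ext ?_ h2
    have := hs.2
    rw [h2] at this
    linarith
  obtain ⟨s, hs⟩ := hfin.infinite_compl.nonempty
  refine ⟨⟨1, s⟩, fun h => one_ne_zero (congrArg Complex.re h), fun i j hij => ?_⟩
  by_contra hne
  apply hs
  rw [Set.mem_iUnion]
  refine ⟨(i, j), hne, ?_⟩
  simpa [Complex.mul_re] using hij

/-- Linear coordinates on the complement of concurrent lines in which it is a product. -/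
theorem exists_homeomorph_of_concurrent {k : ℕ} (L : Fin (k + 1) → Line)
    (hL : GeneralPositionAtInfinity L) (hp : Concurrent L) :
    ∃ c : Fin k → ℂ, (Function.Injective fun i => (c i).re) ∧
      ∃ (e : Complement (arrangementPoly L) ≃ₜ PuncturedPlane × Punctured c) (K : ℂ), ∀ p,
        MvPolynomial.eval p.1 (arrangementPoly L) =
          K * ((e p).1.1 ^ (k + 1) * ∏ j, ((e p).2.1 - c j)) := by
  obtain ⟨q, hq⟩ := hp
  obtain ⟨r₀, s₀, hrs⟩ := (L 0).exists_complement
  have hβ : ∀ i : Fin k, (L 0).a * (L i.succ).b - (L 0).b * (L i.succ).a ≠ 0 := fun i h =>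
    hL 0 i.succ (Fin.succ_ne_zero i).symm (by
      unfold Line.Parallel
      linear_combination h)
  let β : Fin k → ℂ := fun i => (L 0).a * (L i.succ).b - (L 0).b * (L i.succ).a
  let α : Fin k → ℂ := fun i => (L i.succ).a * s₀ - (L i.succ).b * r₀
  let c₀ : Fin k → ℂ := fun i => -(α i / β i)
  have hc₀ : Function.Injective c₀ := by
    intro i j hij
    by_contra hne
    refine hL i.succ j.succ (fun h => hne (Fin.succ_injective _ h)) ?_
    have h1 : α i * β j = α j * β i := by
      have := neg_injective hij
      rwa [div_eq_div_iff (hβ i) (hβ j)] at this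
    simp only [α, β] at h1
    unfold Line.Parallel
    linear_combination h1 + ((L j.succ).a * (L i.succ).b - (L i.succ).a * (L j.succ).b) * hrs
  obtain ⟨ω, hω, hinj⟩ := exists_injective_re hc₀
  have hpos : ∀ i x y, (L i).a * x + (L i).b * y + (L i).c =
      (L i).a * (x - q 0) + (L i).b * (y - q 1) := by
    intro i x y
    have h1 : (L i).a * q 0 + (L i).b * q 1 + (L i).c = 0 := by
      rw [← Line.eval_poly]; exact hq i
    linear_combination h1
  -- `z` is the equation of the first line and `v` a complementary form vanishing at the common
  -- point. The quotient `v / z` is constant on the lines of the pencil other than the first; the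
  -- factor `ω` makes the real parts of its values distinct.
  let z : (Fin 2 → ℂ) → ℂ := fun p => (L 0).a * (p 0 - q 0) + (L 0).b * (p 1 - q 1)
  let v : (Fin 2 → ℂ) → ℂ := fun p => ω * (r₀ * (p 0 - q 0) + s₀ * (p 1 - q 1))
  let c : Fin k → ℂ := fun i => ω * c₀ i
  have hline : ∀ (i : Fin k) p, MvPolynomial.eval p (L i.succ).poly =
      β i / ω * (v p - c i * z p) := by
    intro i p
    have h1 : α i * (L 0).a + β i * r₀ = (L i.succ).a := by
      simp only [α, β]
      linear_combination (L i.succ).a * hrs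
    have h2 : α i * (L 0).b + β i * s₀ = (L i.succ).b := by
      simp only [α, β]
      linear_combination (L i.succ).b * hrs
    rw [Line.eval_poly, hpos, ← h1, ← h2]
    have hβi : β i ≠ 0 := hβ i
    simp only [c, c₀, v, z]
    field_simp
    ring
  have hf : ∀ p, MvPolynomial.eval p (arrangementPoly L) =
      z p * ∏ i, (β i / ω * (v p - c i * z p)) := by
    intro p
    rw [eval_arrangementPoly, Fin.prod_univ_succ, Line.eval_poly, hpos]
    simp only [hline]
    rfl
  have hz : ∀ p : Complement (arrangementPoly L), z p.1 ≠ 0 := fun p h => p.2 (by rw [hf, h, zero_mul])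
  have hv : ∀ (p : Complement (arrangementPoly L)) i, v p.1 / z p.1 ≠ c i := fun p i h => p.2 (by
    rw [div_eq_iff (hz p)] at h
    rw [hf, Finset.prod_eq_zero (Finset.mem_univ i), mul_zero]
    rw [h, sub_self, mul_zero])
  let w : ℂ × ℂ → Fin 2 → ℂ := fun a => ![q 0 + (s₀ * a.1 - (L 0).b * (a.1 * a.2 / ω)),
    q 1 + ((L 0).a * (a.1 * a.2 / ω) - r₀ * a.1)]
  have hzw : ∀ a, z (w a) = a.1 := by
    intro a
    simp only [z, w, Matrix.cons_val_zero, Matrix.cons_val_one]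
    linear_combination a.1 * hrs
  have hvw : ∀ a, v (w a) = a.1 * a.2 := by
    intro a
    simp only [v, w, Matrix.cons_val_zero, Matrix.cons_val_one]
    field_simp
    linear_combination (a.2) * a.1 * hrs
  have hwz : ∀ p, z p ≠ 0 → w (z p, v p / z p) = p := by
    intro p hp
    ext i
    fin_cases i
    · simp only [w, Fin.zero_eta, Matrix.cons_val_zero]
      rw [mul_div_cancel₀ _ hp]
      simp only [v, z]
      field_simp
      linear_combination (p 0 - q 0) * hrs
    · simp only [w, Fin.mk_one, Matrix.cons_val_one, Matrix.cons_val_fin_one]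
      rw [mul_div_cancel₀ _ hp]
      simp only [v, z]
      field_simp
      linear_combination (p 1 - q 1) * hrs
  have hcz : Continuous z := by fun_prop
  have hcv : Continuous v := by fun_prop
  have hcw : Continuous w := by
    refine continuous_pi fun i => ?_
    fin_cases i
    · simp only [w, Fin.zero_eta, Matrix.cons_val_zero]
      fun_prop
    · simp only [w, Fin.mk_one, Matrix.cons_val_one]
      fun_prop
  have hcval : Continuous (Subtype.val : Complement (arrangementPoly L) → _) :=
    continuous_subtype_val
  have hwf : ∀ a : PuncturedPlane × Punctured c,
      MvPolynomial.eval (w (a.1.1, a.2.1)) (arrangementPoly L) ≠ 0 := by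
    intro a
    rw [hf, hzw, hvw]
    refine mul_ne_zero a.1.2 (Finset.prod_ne_zero_iff.2 fun i _ =>
      mul_ne_zero (div_ne_zero (hβ i) hω) ?_)
    have : a.1.1 * a.2.1 - c i * a.1.1 = a.1.1 * (a.2.1 - c i) := by ring
    rw [this]
    exact mul_ne_zero a.1.2 (sub_ne_zero.2 (a.2.2 i))
  let e : Complement (arrangementPoly L) ≃ₜ PuncturedPlane × Punctured c :=
    { toFun := fun p => (⟨z p.1, hz p⟩, ⟨v p.1 / z p.1, hv p⟩)
      invFun := fun a => ⟨w (a.1.1, a.2.1), hwf a⟩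
      left_inv := fun p => Subtype.ext (hwz p.1 (hz p))
      right_inv := fun a => Prod.ext (Subtype.ext (hzw _)) (Subtype.ext (by
        change v (w _) / z (w _) = a.2.1
        rw [hzw, hvw, mul_div_cancel_left₀ _ a.1.2]))
      continuous_toFun := Continuous.prodMk
        (Continuous.subtype_mk (hcz.comp hcval) _)
        (Continuous.subtype_mk ((hcv.comp hcval).div (hcz.comp hcval) hz) _)
      continuous_invFun := Continuous.subtype_mk (hcw.comp (Continuous.prodMk
        (continuous_subtype_val.comp continuous_fst)
        (continuous_subtype_val.comp continuous_snd))) fun a => hwf a }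
  refine ⟨c, hinj, e, ∏ i, β i / ω, fun p => ?_⟩
  have hzp := hz p
  have h0 : ∀ a b d : ℂ, b ≠ 0 → a - d * b = b * (a / b - d) := fun a b d hb => by
    field_simp
  have h1 : ∀ i, β i / ω * (v p.1 - c i * z p.1) =
      β i / ω * (z p.1 * (v p.1 / z p.1 - c i)) := by
    intro i
    rw [← h0 (v p.1) (z p.1) (c i) hzp]
  rw [hf]
  simp only [h1, Finset.prod_mul_distrib, Finset.prod_const, Finset.card_univ, Fintype.card_fin]
  change _ = _ * (z p.1 ^ (k + 1) * ∏ j, (v p.1 / z p.1 - c j))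
  ring

theorem incr_evalMap_of_eq {k : ℕ} {f : MvPolynomial (Fin 2) ℂ} {c : Fin k → ℂ}
    (e : Complement f ≃ₜ PuncturedPlane × Punctured c) (K : ℂ)
    (h : ∀ p, MvPolynomial.eval p.1 f = K * ((e p).1.1 ^ (k + 1) * ∏ j, ((e p).2.1 - c j)))
    {x y : Complement f} (γ : Path.Homotopic.Quotient x y) :
    incr (evalMap f) γ = (k + 1 : ℕ) * incr (fstMap e) γ +
      ∑ j, incr ((subPoint c j).comp (sndMap e)) γ := by
  rw [incr_prod (Finset.univ : Finset (Fin (k + 1) ⊕ Fin k))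
    (g := Sum.elim (fun _ => fstMap e) fun j => (subPoint c j).comp (sndMap e)) K]
  · simp [Fintype.sum_sum_type]
  · intro p
    rw [Fintype.prod_sum_type]
    simp only [Sum.elim_inl, Sum.elim_inr, Finset.prod_const, Finset.card_univ, Fintype.card_fin]
    exact h p

theorem curveDegree_of_concurrent {l : ℕ} (L : Fin (l + 2) → Line)
    (hL : GeneralPositionAtInfinity L) (hp : Concurrent L)
    (u : Complement (arrangementPoly L)) (n : ℕ) :
    curveDegree (arrangementPoly L) u n = ((l + 2) * l : ℕ) := by
  obtain ⟨c, hc, e, K, h⟩ := exists_homeomorph_of_concurrent L hL hp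
  exact degree_of_product c (by simp) hc e u (linking _ u) (ker_linking _ u)
    (fun γ => incr_evalMap_of_eq e K h γ) n

theorem curveDegree_of_single_line (L : Fin 1 → Line) (u : Complement (arrangementPoly L)) (n : ℕ) :
    curveDegree (arrangementPoly L) u n = 0 := by
  have hp : Concurrent L := by
    rcases (L 0).ne_zero with h | h
    · refine ⟨![-(L 0).c / (L 0).a, 0], fun i => ?_⟩
      rw [Subsingleton.elim i 0]
      change MvPolynomial.eval _ _ = 0
      rw [Line.eval_poly]
      simp [mul_div_cancel₀ _ h]
    · refine ⟨![0, -(L 0).c / (L 0).b], fun i => ?_⟩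
      rw [Subsingleton.elim i 0]
      change MvPolynomial.eval _ _ = 0
      rw [Line.eval_poly]
      simp [mul_div_cancel₀ _ h]
  obtain ⟨c, hc, e, K, h⟩ := exists_homeomorph_of_concurrent (k := 0) L
    (fun i j hij => absurd (Subsingleton.elim (α := Fin 1) i j) hij) hp
  have hF : ∀ γ : FundamentalGroup _ u, incr (evalMap (arrangementPoly L)) γ =
      incr (fstMap e) γ := fun γ => by
    rw [incr_evalMap_of_eq e K h γ]
    simp
  refine degree_of_product_isEmpty c e u (linking _ u) (fun γ hγ => ?_) (ker_linking _ u) n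
  have h1 : γ ∈ (linking _ u).ker := hγ
  rw [ker_linking, mem_ker_incrHom, hF] at h1
  exact h1

end LinearCoordinates
end HigherOrderDegree
end

noncomputable section
namespace HigherOrderDegree

open scoped unitInterval

/-! ### Rotation of far points about a distinguished line -/

section LineSpace

variable {ι : Type*} (a b : ι → ℂ)

/-- The complement of the line `y = 0` and of the lines `x = a i * y + b i`. -/
def LineSpace : Type _ := {p : ℂ × ℂ // p.2 ≠ 0 ∧ ∀ i, p.1 ≠ a i * p.2 + b i}

instance : TopologicalSpace (LineSpace a b) := instTopologicalSpaceSubtype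

variable [Fintype ι]

/-- If `‖x‖` exceeds this bound times `1 + ‖y‖`, then `x` is more than `1` away from every puncture
of the fibre over `y`. The condition involves only `‖y‖`, so rotating `y` preserves it. -/
def farBound : ℝ := 1 + ∑ i, (‖a i‖ + ‖b i‖)

theorem one_le_farBound : 1 ≤ farBound a b :=
  le_add_of_nonneg_right (Finset.sum_nonneg fun _ _ => by positivity)

theorem norm_line_le (i : ι) (y : ℂ) : ‖a i * y + b i‖ + 1 ≤ farBound a b * (1 + ‖y‖) := by
  have h1 : ‖a i‖ + ‖b i‖ ≤ ∑ i, (‖a i‖ + ‖b i‖) :=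
    Finset.single_le_sum (f := fun i => ‖a i‖ + ‖b i‖) (fun _ _ => by positivity)
      (Finset.mem_univ i)
  have h2 : ‖a i * y + b i‖ ≤ ‖a i‖ * ‖y‖ + ‖b i‖ := (norm_add_le _ _).trans (by rw [norm_mul])
  have h3 : (1 + (‖a i‖ + ‖b i‖)) * (1 + ‖y‖) ≤ farBound a b * (1 + ‖y‖) := by
    unfold farBound
    gcongr
  nlinarith [norm_nonneg (a i), norm_nonneg (b i), norm_nonneg y,
    mul_nonneg (norm_nonneg (b i)) (norm_nonneg y)]

theorem ne_of_far {x y : ℂ} (h : farBound a b * (1 + ‖y‖) < ‖x‖) (i : ι) : x ≠ a i * y + b i := by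
  rintro rfl
  linarith [norm_line_le a b i y]

variable {a b}

/-- The points near infinity in their fibre of the second coordinate. -/
def IsFar (p : LineSpace a b) : Prop := farBound a b * (1 + ‖p.1.2‖) < ‖p.1.1‖

/-- The rotation of the second coordinate of a far point by an angle. -/
def rotate {p : LineSpace a b} (hp : IsFar p) (θ : ℝ) : LineSpace a b :=
  ⟨(p.1.1, Complex.exp (θ * (2 * Real.pi * Complex.I)) * p.1.2),
    mul_ne_zero (Complex.exp_ne_zero _) p.2.1, ne_of_far a b (by
      have : (θ * (2 * Real.pi * Complex.I) : ℂ) = ((θ * (2 * Real.pi) : ℝ) : ℂ) * Complex.I := by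
        push_cast; ring
      rw [norm_mul, this, Complex.norm_exp_ofReal_mul_I, one_mul]
      exact hp)⟩

theorem rotate_congr {p q : LineSpace a b} (hp : IsFar p) (hq : IsFar q) (h : p = q) (θ : ℝ) :
    rotate hp θ = rotate hq θ := by
  subst h
  rfl

/-- The loop that rotates the second coordinate of a far point. -/
def rotLoop {p : LineSpace a b} (hp : IsFar p) : Path p p where
  toFun θ := rotate hp θ
  continuous_toFun := Continuous.subtype_mk (by fun_prop) _
  source' := Subtype.ext (by simp [rotate])
  target' := Subtype.ext (by simp [rotate, Complex.exp_two_pi_mul_I])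

/-- A class of paths between far points that commutes with the loops `rotLoop`. -/
def RotCommutes {p q : LineSpace a b} (η : Path.Homotopic.Quotient p q) : Prop :=
  ∃ (hp : IsFar p) (hq : IsFar q), (Path.Homotopic.Quotient.mk (rotLoop hp)).trans η =
    η.trans (.mk (rotLoop hq))

theorem RotCommutes.trans {p q r : LineSpace a b} {η : Path.Homotopic.Quotient p q}
    {η' : Path.Homotopic.Quotient q r} (h : RotCommutes η) (h' : RotCommutes η') :
    RotCommutes (η.trans η') := by
  obtain ⟨hp, hq, h⟩ := h
  obtain ⟨_, hr, h'⟩ := h'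
  refine ⟨hp, hr, ?_⟩
  rw [← Path.Homotopic.Quotient.trans_assoc, h, Path.Homotopic.Quotient.trans_assoc, h',
    Path.Homotopic.Quotient.trans_assoc]

theorem RotCommutes.symm {p q : LineSpace a b} {η : Path.Homotopic.Quotient p q}
    (h : RotCommutes η) : RotCommutes η.symm := by
  obtain ⟨hp, hq, h⟩ := h
  refine ⟨hq, hp, ?_⟩
  have h1 : η.symm.trans (((Path.Homotopic.Quotient.mk (rotLoop hp)).trans η).trans η.symm) =
      η.symm.trans ((η.trans (.mk (rotLoop hq))).trans η.symm) := by rw [h]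
  simp only [Path.Homotopic.Quotient.trans_assoc, Path.Homotopic.Quotient.trans_symm,
    Path.Homotopic.Quotient.trans_refl] at h1
  rw [h1, ← Path.Homotopic.Quotient.trans_assoc, Path.Homotopic.Quotient.symm_trans,
    Path.Homotopic.Quotient.refl_trans]

/-- A path through far points commutes with the rotations. -/
theorem rotCommutes_of_far {p q : LineSpace a b} (η : Path p q) (h : ∀ s, IsFar (η s)) :
    RotCommutes (.mk η) := by
  have hp : IsFar p := η.source ▸ h 0
  have hq : IsFar q := η.target ▸ h 1
  refine ⟨hp, hq, ?_⟩
  have hcont : Continuous fun s => (η s).1 := continuous_subtype_val.comp η.continuous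
  refine square_homotopic (F := fun θ s => rotate (h s) θ) ?_ (fun θ => ?_) (fun θ => ?_)
    (fun s => ?_) (fun s => ?_)
  · exact Continuous.subtype_mk (by fun_prop) _
  · exact rotate_congr hp (h 0) η.source.symm θ
  · exact rotate_congr hq (h 1) η.target.symm θ
  · exact Subtype.ext (by simp [rotate])
  · exact Subtype.ext (by simp [rotate, Complex.exp_two_pi_mul_I])

/-- Commutation with the rotations may be checked after a deformation that keeps the end points
far. -/
theorem rotCommutes_of_deformation {F : I → I → LineSpace a b}
    (hF : Continuous (Function.uncurry F)) {p q : LineSpace a b} (η : Path p q)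
    (hη : ∀ s, η s = F s 0) (h0 : ∀ r, IsFar (F 0 r)) (h1 : ∀ r, IsFar (F 1 r))
    (h : ∀ δ : Path (F 0 1) (F 1 1), (∀ s, δ s = F s 1) → RotCommutes (.mk δ)) :
    RotCommutes (.mk η) := by
  obtain rfl : F 0 0 = p := (hη 0).symm.trans η.source
  obtain rfl : F 1 0 = q := (hη 1).symm.trans η.target
  let l : Path (F 0 0) (F 0 1) := ⟨⟨F 0, by fun_prop⟩, rfl, rfl⟩
  let r : Path (F 1 0) (F 1 1) := ⟨⟨F 1, by fun_prop⟩, rfl, rfl⟩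
  let δ : Path (F 0 1) (F 1 1) := ⟨⟨fun s => F s 1, by fun_prop⟩, rfl, rfl⟩
  have hsq := square_homotopic hF (p := η) (q := δ) (l := l) (r := r) hη (fun _ => rfl)
    (fun _ => rfl) (fun _ => rfl)
  have h2 : Path.Homotopic.Quotient.mk η =
      ((Path.Homotopic.Quotient.mk l).trans (.mk δ)).trans (Path.Homotopic.Quotient.mk r).symm := by
    rw [← hsq, Path.Homotopic.Quotient.trans_assoc, Path.Homotopic.Quotient.trans_symm,
      Path.Homotopic.Quotient.trans_refl]
  rw [h2]
  exact ((rotCommutes_of_far l h0).trans (h δ fun _ => rfl)).trans (rotCommutes_of_far r h1).symm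

variable (a b)

/-- All paths between far points in the fibre over `y` commute with the rotations. -/
def IsGood (y : ℂ) : Prop :=
  ∀ (p q : LineSpace a b) (η : Path p q), (∀ s, (η s).1.2 = y) → IsFar p → IsFar q →
    RotCommutes (.mk η)

variable {a b}

/-- The path that multiplies the first coordinate of a far point by a growing factor. -/
theorem exists_scalePath {p : LineSpace a b} (hp : IsFar p) {R : ℝ} (hR : 0 ≤ R) :
    ∃ (q : LineSpace a b) (ρ : Path p q), q.1.1 = (1 + R) * p.1.1 ∧ (∀ s, (ρ s).1.2 = p.1.2) ∧
      ∀ s, IsFar (ρ s) := by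
  have h : ∀ s : I, farBound a b * (1 + ‖p.1.2‖) < ‖(1 + s * R : ℂ) * p.1.1‖ := by
    intro s
    have h1 : (1 + s * R : ℂ) = ((1 + s * R : ℝ) : ℂ) := by push_cast; ring
    have h2 : 0 ≤ (s : ℝ) * R := mul_nonneg s.2.1 hR
    rw [norm_mul, h1, Complex.norm_real, Real.norm_of_nonneg (by linarith)]
    have h3 : farBound a b * (1 + ‖p.1.2‖) < ‖p.1.1‖ := hp
    nlinarith [norm_nonneg p.1.1]
  let P : I → LineSpace a b := fun s => ⟨((1 + s * R : ℂ) * p.1.1, p.1.2), p.2.1,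
    ne_of_far a b (h s)⟩
  refine ⟨P 1, ⟨⟨P, Continuous.subtype_mk (by fun_prop) _⟩, Subtype.ext (by simp [P]), rfl⟩, ?_,
    fun s => rfl, h⟩
  simp [P]

/-- The end points may be pushed outwards through far points of the fibre, and the paths that do
this commute with the rotations. -/
theorem isGood_of_large {y : ℂ} (N : ℝ) (h : ∀ (p q : LineSpace a b) (η : Path p q),
    (∀ s, (η s).1.2 = y) → N < ‖p.1.1‖ → N < ‖q.1.1‖ → RotCommutes (.mk η)) : IsGood a b y := by
  have key : ∀ {p : LineSpace a b}, IsFar p → ∃ (q : LineSpace a b) (ρ : Path p q), N < ‖q.1.1‖ ∧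
      (∀ s, (ρ s).1.2 = p.1.2) ∧ ∀ s, IsFar (ρ s) := by
    intro p hp
    obtain ⟨q, ρ, h1, h2, h3⟩ := exists_scalePath hp (R := |N|) (abs_nonneg N)
    refine ⟨q, ρ, ?_, h2, h3⟩
    have h4 : (1 + (|N| : ℝ) : ℂ) = ((1 + |N| : ℝ) : ℂ) := by push_cast; ring
    have h5 : 1 < ‖p.1.1‖ := by
      have h6 : farBound a b * (1 + ‖p.1.2‖) < ‖p.1.1‖ := hp
      nlinarith [one_le_farBound a b, norm_nonneg p.1.2]
    rw [h1, h4, norm_mul, Complex.norm_real, Real.norm_of_nonneg (by positivity)]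
    nlinarith [le_abs_self N, abs_nonneg N]
  intro p q η hη hp hq
  obtain ⟨p', ρ, hp1, hp2, hp3⟩ := key hp
  obtain ⟨q', τ, hq1, hq2, hq3⟩ := key hq
  have h0 : p.1.2 = y := by rw [← η.source]; exact hη 0
  have h1 : q.1.2 = y := by rw [← η.target]; exact hη 1
  have h2 := h _ _ ((ρ.symm.trans η).trans τ) (fun s => by
    rw [Path.trans_apply]
    split_ifs
    · rw [Path.trans_apply]
      split_ifs
      · exact (hp2 _).trans h0
      · exact hη _
    · exact (hq2 _).trans h1) hp1 hq1
  have h3 := ((rotCommutes_of_far ρ hp3).trans h2).trans (rotCommutes_of_far τ hq3).symm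
  rw [Path.Homotopic.Quotient.mk_trans, Path.Homotopic.Quotient.mk_trans,
    Path.Homotopic.Quotient.mk_symm] at h3
  simp only [Path.Homotopic.Quotient.trans_assoc, Path.Homotopic.Quotient.trans_symm,
    Path.Homotopic.Quotient.trans_refl] at h3
  rwa [← Path.Homotopic.Quotient.trans_assoc, Path.Homotopic.Quotient.trans_symm,
    Path.Homotopic.Quotient.refl_trans] at h3

end LineSpace
end HigherOrderDegree
end

noncomputable section
namespace HigherOrderDegree

open scoped unitInterval

/-! ### An isotopy of fibres that follows the punctures -/

section Isotopy

variable {ι : Type*} (a b : ι → ℂ)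

/-- A bump function around the point of the line with index `i` in the fibre over `y₀`. -/
def bump (y₀ : ℂ) (d : ℝ) (i : ι) (x : ℂ) : ℝ := max (1 - ‖x - (a i * y₀ + b i)‖ / d) 0

/-- An isotopy that moves the points of the lines in the fibre over `y₀` to those in the fibre
over `y`. -/
def flow [Fintype ι] (y₀ : ℂ) (d : ℝ) (x y : ℂ) : ℂ := x + ∑ i, bump a b y₀ d i x * (a i * (y - y₀))

theorem continuous_flow [Fintype ι] (y₀ : ℂ) (d : ℝ) :
    Continuous fun p : ℂ × ℂ => flow a b y₀ d p.1 p.2 := by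
  unfold flow bump
  fun_prop

theorem flow_self [Fintype ι] (y₀ : ℂ) (d : ℝ) (x : ℂ) : flow a b y₀ d x y₀ = x := by
  simp [flow]

theorem bump_sub_le (y₀ : ℂ) {d : ℝ} (hd : 0 < d) (i : ι) (x x' : ℂ) :
    |bump a b y₀ d i x - bump a b y₀ d i x'| ≤ ‖x - x'‖ / d := by
  unfold bump
  refine (abs_max_sub_max_le_abs _ _ _).trans ?_
  have h : 1 - ‖x - (a i * y₀ + b i)‖ / d - (1 - ‖x' - (a i * y₀ + b i)‖ / d) =
      (‖x' - (a i * y₀ + b i)‖ - ‖x - (a i * y₀ + b i)‖) / d := by ring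
  rw [h, abs_div, abs_of_pos hd]
  gcongr
  refine (abs_norm_sub_norm_le _ _).trans (le_of_eq ?_)
  rw [norm_sub_rev]
  congr 1
  ring

/-- The distance between the points of different lines in the fibre over `y` is at least `d`. -/
def Separated (d : ℝ) (y : ℂ) : Prop :=
  ∀ i j, i ≠ j → d ≤ ‖(a i * y + b i) - (a j * y + b j)‖

variable {a b}

theorem bump_point [DecidableEq ι] {y₀ : ℂ} {d : ℝ} (hd : 0 < d) (hs : Separated a b d y₀)
    (i j : ι) : bump a b y₀ d i (a j * y₀ + b j) = if i = j then 1 else 0 := by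
  split_ifs with h
  · subst h
    simp [bump]
  · rw [bump, max_eq_right]
    rw [sub_nonpos, one_le_div hd]
    exact hs j i (Ne.symm h)

variable [Fintype ι]

/-- The isotopy takes each puncture over `y₀` exactly to the one over `y`. Its displacement has
Lipschitz constant at most `(∑ ‖a i‖) * ‖y - y₀‖ / d < 1`, so no other point arrives there. -/
theorem flow_ne {y₀ y : ℂ} {d : ℝ} (hd : 0 < d) (hs : Separated a b d y₀)
    (hy : (∑ i, ‖a i‖) * ‖y - y₀‖ < d) {x : ℂ} (hx : ∀ i, x ≠ a i * y₀ + b i) (j : ι) :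
    flow a b y₀ d x y ≠ a j * y + b j := by
  classical
  intro h
  have h1 : ∑ i, (bump a b y₀ d i (a j * y₀ + b j) : ℂ) * (a i * (y - y₀)) = a j * (y - y₀) := by
    rw [Finset.sum_eq_single j]
    · simp [bump_point hd hs]
    · intro i _ hij
      simp [bump_point hd hs, hij]
    · simp
  have h2 : x - (a j * y₀ + b j) = ∑ i, ((bump a b y₀ d i (a j * y₀ + b j) - bump a b y₀ d i x : ℝ) : ℂ)
      * (a i * (y - y₀)) := by
    push_cast
    simp only [sub_mul, Finset.sum_sub_distrib] at h1 ⊢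
    rw [h1]
    unfold flow at h
    linear_combination h
  have hpos : 0 < ‖x - (a j * y₀ + b j)‖ := norm_pos_iff.2 (sub_ne_zero.2 (hx j))
  have h3 : ‖x - (a j * y₀ + b j)‖ ≤
      ‖x - (a j * y₀ + b j)‖ / d * ((∑ i, ‖a i‖) * ‖y - y₀‖) := by
    calc ‖x - (a j * y₀ + b j)‖ ≤ ∑ i, ‖((bump a b y₀ d i (a j * y₀ + b j) -
          bump a b y₀ d i x : ℝ) : ℂ) * (a i * (y - y₀))‖ := by
          conv_lhs => rw [h2]
          exact norm_sum_le _ _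
      _ ≤ ∑ i, ‖x - (a j * y₀ + b j)‖ / d * (‖a i‖ * ‖y - y₀‖) := by
          refine Finset.sum_le_sum fun i _ => ?_
          rw [norm_mul, norm_mul, Complex.norm_real, Real.norm_eq_abs]
          gcongr
          rw [norm_sub_rev]
          exact bump_sub_le a b y₀ hd i _ _
      _ = _ := by rw [← Finset.mul_sum, Finset.sum_mul]
  have h4 : ‖x - (a j * y₀ + b j)‖ / d * ((∑ i, ‖a i‖) * ‖y - y₀‖) <
      ‖x - (a j * y₀ + b j)‖ / d * d := by gcongr
  rw [div_mul_cancel₀ _ hd.ne'] at h4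
  exact absurd h3 (not_le.2 h4)

/-- The bumps live within distance `d ≤ 1` of the punctures, and far points are further away than
that. -/
theorem flow_of_far {y₀ y x : ℂ} {d : ℝ} (hd : 0 < d) (hd1 : d ≤ 1)
    (hx : farBound a b * (1 + ‖y₀‖) < ‖x‖) : flow a b y₀ d x y = x := by
  unfold flow
  rw [Finset.sum_eq_zero, add_zero]
  intro i _
  have h1 := norm_line_le a b i y₀
  have h2 := norm_sub_norm_le x (a i * y₀ + b i)
  rw [bump, max_eq_right, Complex.ofReal_zero, zero_mul]
  rw [sub_nonpos, one_le_div hd]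
  linarith

theorem exists_separated {y₀ : ℂ} (h : Function.Injective fun i => a i * y₀ + b i) :
    ∃ d : ℝ, 0 < d ∧ d ≤ 1 ∧ ∀ᶠ y in nhds y₀, Separated a b d y := by
  have h1 : ∀ i j, ∃ d : ℝ, 0 < d ∧ (i ≠ j → d < ‖(a i * y₀ + b i) - (a j * y₀ + b j)‖) := by
    intro i j
    by_cases hij : i = j
    · exact ⟨1, one_pos, fun h => absurd hij h⟩
    · have h2 : 0 < ‖(a i * y₀ + b i) - (a j * y₀ + b j)‖ :=
        norm_pos_iff.2 (sub_ne_zero.2 (fun h' => hij (h h')))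
      exact ⟨_, half_pos h2, fun _ => half_lt_self h2⟩
  choose d hd hd' using h1
  obtain ⟨e, he, hed⟩ : ∃ e : ℝ, 0 < e ∧ ∀ p : ι × ι, e ≤ d p.1 p.2 := by
    have h3 : ∀ᶠ e in nhdsWithin (0 : ℝ) (Set.Ioi 0), 0 < e ∧ ∀ p : ι × ι, e ≤ d p.1 p.2 := by
      refine Filter.Eventually.and self_mem_nhdsWithin (Filter.eventually_all.2 fun p => ?_)
      filter_upwards [nhdsWithin_le_nhds (gt_mem_nhds (hd p.1 p.2))] with e he using he.le
    exact h3.exists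
  refine ⟨min e 1, lt_min he one_pos, min_le_right _ _, ?_⟩
  have h4 : ∀ᶠ y in nhds y₀, ∀ p : ι × ι, p.1 ≠ p.2 →
      d p.1 p.2 < ‖(a p.1 * y + b p.1) - (a p.2 * y + b p.2)‖ := by
    refine Filter.eventually_all.2 fun p => ?_
    by_cases hp : p.1 = p.2
    · exact Filter.Eventually.of_forall fun _ h => absurd hp h
    · have hc : Continuous fun y => ‖(a p.1 * y + b p.1) - (a p.2 * y + b p.2)‖ := by fun_prop
      filter_upwards [hc.continuousAt.eventually_const_lt (hd' p.1 p.2 hp)] with y hy _ using hy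
  filter_upwards [h4] with y hy i j hij
  exact (min_le_left _ _).trans ((hed (i, j)).trans (hy (i, j) hij).le)

/-- Goodness is transported along the isotopy. -/
theorem IsGood.transport {y₀ y₁ : ℂ} {d : ℝ} (hd : 0 < d) (hd1 : d ≤ 1)
    (hs : Separated a b d y₀) (hy : (∑ i, ‖a i‖) * ‖y₁ - y₀‖ < d) (hne : ‖y₁ - y₀‖ < ‖y₀‖)
    (h : IsGood a b y₁) : IsGood a b y₀ := by
  have hM := one_le_farBound a b
  -- With this bound the end points are far over every point of the segment from `y₀` to `y₁`, and
  -- the isotopy leaves them fixed.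
  refine isGood_of_large (farBound a b * (1 + (‖y₀‖ + ‖y₁ - y₀‖))) fun p q η hη hp hq => ?_
  have hp0 : p.1.2 = y₀ := by rw [← η.source]; exact hη 0
  have hq0 : q.1.2 = y₀ := by rw [← η.target]; exact hη 1
  have hr : ∀ r : I, ‖(y₀ + r * (y₁ - y₀)) - y₀‖ ≤ ‖y₁ - y₀‖ := by
    intro r
    rw [add_sub_cancel_left, norm_mul, Complex.norm_real, Real.norm_of_nonneg r.2.1]
    exact mul_le_of_le_one_left (norm_nonneg _) r.2.2
  have hr0 : ∀ r : I, y₀ + r * (y₁ - y₀) ≠ 0 := by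
    intro r h0
    have := hr r
    rw [h0, zero_sub, norm_neg] at this
    linarith
  have hr1 : ∀ r : I, ‖y₀ + r * (y₁ - y₀)‖ ≤ ‖y₀‖ + ‖y₁ - y₀‖ := by
    intro r
    have h1 := norm_add_le y₀ (r * (y₁ - y₀))
    have h2 := hr r
    rw [add_sub_cancel_left] at h2
    linarith
  have hx : ∀ s i, (η s).1.1 ≠ a i * y₀ + b i := fun s i => by
    have := (η s).2.2 i
    rwa [hη s] at this
  have hfar : ∀ (r : I) {x : ℂ}, farBound a b * (1 + (‖y₀‖ + ‖y₁ - y₀‖)) < ‖x‖ →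
      farBound a b * (1 + ‖y₀ + r * (y₁ - y₀)‖) < ‖x‖ := by
    intro r x hx
    refine lt_of_le_of_lt ?_ hx
    gcongr
    exact hr1 r
  have hfar0 : ∀ {x : ℂ}, farBound a b * (1 + (‖y₀‖ + ‖y₁ - y₀‖)) < ‖x‖ →
      farBound a b * (1 + ‖y₀‖) < ‖x‖ := by
    intro x hx
    refine lt_of_le_of_lt ?_ hx
    gcongr
    exact le_add_of_nonneg_right (norm_nonneg _)
  let F : I → I → LineSpace a b := fun s r => ⟨(flow a b y₀ d (η s).1.1 (y₀ + r * (y₁ - y₀)),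
    y₀ + r * (y₁ - y₀)), hr0 r, flow_ne hd hs (lt_of_le_of_lt (by
      gcongr
      exact hr r) hy) (hx s)⟩
  have hcont : Continuous fun s => (η s).1.1 :=
    continuous_fst.comp (continuous_subtype_val.comp η.continuous)
  have hF : Continuous (Function.uncurry F) := by
    have hcy : Continuous fun p : I × I => y₀ + p.2 * (y₁ - y₀) := by fun_prop
    exact Continuous.subtype_mk (Continuous.prodMk ((continuous_flow a b y₀ d).comp
      ((hcont.comp continuous_fst).prodMk hcy)) hcy) _
  have h0 : ∀ r, IsFar (F 0 r) := by
    intro r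
    change farBound a b * (1 + ‖y₀ + r * (y₁ - y₀)‖) < ‖flow a b y₀ d (η 0).1.1 _‖
    rw [η.source, flow_of_far hd hd1 (hfar0 hp)]
    exact hfar r hp
  have h1 : ∀ r, IsFar (F 1 r) := by
    intro r
    change farBound a b * (1 + ‖y₀ + r * (y₁ - y₀)‖) < ‖flow a b y₀ d (η 1).1.1 _‖
    rw [η.target, flow_of_far hd hd1 (hfar0 hq)]
    exact hfar r hq
  refine rotCommutes_of_deformation hF η (fun s => ?_) h0 h1 fun δ hδ => ?_
  · refine Subtype.ext (Prod.ext ?_ ?_)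
    · change _ = flow a b y₀ d (η s).1.1 (y₀ + ((0 : I) : ℝ) * (y₁ - y₀))
      rw [Set.Icc.coe_zero, Complex.ofReal_zero, zero_mul, add_zero, flow_self]
    · change (η s).1.2 = y₀ + ((0 : I) : ℝ) * (y₁ - y₀)
      rw [hη s, Set.Icc.coe_zero, Complex.ofReal_zero, zero_mul, add_zero]
  · refine h _ _ δ (fun s => ?_) (h0 1) (h1 1)
    rw [hδ s]
    change y₀ + ((1 : I) : ℝ) * (y₁ - y₀) = y₁
    rw [Set.Icc.coe_one, Complex.ofReal_one, one_mul, add_sub_cancel]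

/-- The circle through `y₀` about `0` stays within `2 * ‖y₀‖` of `y₀`, so the isotopy is available
all around it. Since `flow` depends on `y` alone, it is the identity after a full turn. The path
dragged around the circle thus bounds a square with two copies of itself and two rotation loops. -/
theorem IsGood.of_small {y₀ : ℂ} {d : ℝ} (hd : 0 < d) (hd1 : d ≤ 1)
    (hs : Separated a b d y₀) (hy : (∑ i, ‖a i‖) * (2 * ‖y₀‖) < d) : IsGood a b y₀ := by
  intro p q η hη hp hq
  have hp0 : p.1.2 = y₀ := by rw [← η.source]; exact hη 0
  have hq0 : q.1.2 = y₀ := by rw [← η.target]; exact hη 1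
  let c : I → ℂ := fun θ => Complex.exp (θ * (2 * Real.pi * Complex.I)) * y₀
  have hc : ∀ θ, ‖c θ - y₀‖ ≤ 2 * ‖y₀‖ := by
    intro θ
    refine (norm_sub_le _ _).trans ?_
    have : (θ * (2 * Real.pi * Complex.I) : ℂ) = ((θ * (2 * Real.pi) : ℝ) : ℂ) * Complex.I := by
      push_cast; ring
    rw [norm_mul, this, Complex.norm_exp_ofReal_mul_I]
    linarith
  have hne : y₀ ≠ 0 := hp0 ▸ p.2.1
  have hx : ∀ s i, (η s).1.1 ≠ a i * y₀ + b i := fun s i => by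
    have := (η s).2.2 i
    rwa [hη s] at this
  let F : I → I → LineSpace a b := fun θ s => ⟨(flow a b y₀ d (η s).1.1 (c θ), c θ),
    mul_ne_zero (Complex.exp_ne_zero _) hne, flow_ne hd hs (lt_of_le_of_lt (by
      gcongr
      exact hc θ) hy) (hx s)⟩
  have hcont : Continuous fun s => (η s).1.1 :=
    continuous_fst.comp (continuous_subtype_val.comp η.continuous)
  have hF : Continuous (Function.uncurry F) := by
    have hcc : Continuous c := by fun_prop
    exact Continuous.subtype_mk (Continuous.prodMk ((continuous_flow a b y₀ d).comp
      ((hcont.comp continuous_snd).prodMk (hcc.comp continuous_fst))) (hcc.comp continuous_fst)) _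
  have hc0 : c 0 = y₀ := by simp [c]
  have hc1 : c 1 = y₀ := by simp [c, Complex.exp_two_pi_mul_I]
  have hend : ∀ {p : LineSpace a b} (hp : IsFar p) (hp0 : p.1.2 = y₀) (θ : I),
      (rotLoop hp θ).1 = (flow a b y₀ d p.1.1 (c θ), c θ) := by
    intro p hp hp0 θ
    rw [flow_of_far hd hd1 (hp0 ▸ hp)]
    change (p.1.1, _ * p.1.2) = _
    rw [hp0]
  refine ⟨hp, hq, square_homotopic hF (fun θ => ?_) (fun θ => ?_) (fun s => ?_) (fun s => ?_)⟩
  · refine Subtype.ext ((hend hp hp0 θ).trans ?_)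
    change _ = (flow a b y₀ d (η 0).1.1 (c θ), c θ)
    rw [η.source]
  · refine Subtype.ext ((hend hq hq0 θ).trans ?_)
    change _ = (flow a b y₀ d (η 1).1.1 (c θ), c θ)
    rw [η.target]
  · refine Subtype.ext ?_
    change _ = (flow a b y₀ d (η s).1.1 (c 0), c 0)
    rw [hc0, flow_self]
    exact Prod.ext rfl (hη s)
  · refine Subtype.ext ?_
    change _ = (flow a b y₀ d (η s).1.1 (c 1), c 1)
    rw [hc1, flow_self]
    exact Prod.ext rfl (hη s)

end Isotopy
end HigherOrderDegree
end

noncomputable section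
namespace HigherOrderDegree

open scoped unitInterval

/-! ### Commutation with rotations in every fibre -/

section Goodness

variable {ι : Type*} [Fintype ι] {a b : ι → ℂ}

theorem finite_special (hb : Function.Injective b) :
    {y : ℂ | y = 0 ∨ ¬ Function.Injective fun i => a i * y + b i}.Finite := by
  have h : (⋃ p : ι × ι, {y : ℂ | p.1 ≠ p.2 ∧ a p.1 * y + b p.1 = a p.2 * y + b p.2}).Finite := by
    refine Set.finite_iUnion fun p => Set.Subsingleton.finite fun y hy y' hy' => ?_
    by_contra hne
    apply hy.1
    have h1 : (a p.1 - a p.2) * (y - y') = 0 := by linear_combination hy.2 - hy'.2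
    have h2 := (mul_eq_zero.1 h1).resolve_right (sub_ne_zero.2 hne)
    exact hb (by linear_combination hy.2 - y * h2)
  refine ((Set.finite_singleton 0).union h).subset ?_
  rintro y (hy | hy)
  · exact Or.inl hy
  · rw [Function.Injective] at hy
    push Not at hy
    obtain ⟨i, j, hij, hne⟩ := hy
    exact Or.inr (Set.mem_iUnion.2 ⟨(i, j), hne, hij⟩)

/-- The distinct `b i` keep the punctures separated for small `y`, where `IsGood.of_small` applies.
The regular values form the complement of a finite set in the plane, which is connected, and
goodness spreads over it by local transport. -/
theorem isGood_of_regular (hb : Function.Injective b) {y : ℂ} (hy : y ≠ 0)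
    (hr : Function.Injective fun i => a i * y + b i) : IsGood a b y := by
  set U : Set ℂ := {y : ℂ | y = 0 ∨ ¬ Function.Injective fun i => a i * y + b i}ᶜ with hU
  have hfin := finite_special (a := a) hb
  have hmem : ∀ {y}, y ∈ U ↔ y ≠ 0 ∧ Function.Injective fun i => a i * y + b i := by
    intro y
    simp [hU, not_or]
  have hconn : IsPreconnected U :=
    (hfin.countable.isConnected_compl_of_one_lt_rank
      (Complex.rank_real_complex ▸ Nat.one_lt_ofNat)).isPreconnected
  have hsmall : ∀ᶠ y in nhds (0 : ℂ), IsGood a b y := by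
    obtain ⟨d, hd, hd1, hs⟩ := exists_separated (a := a) (b := b) (y₀ := 0) (by simpa using hb)
    have hc : Continuous fun y : ℂ => (∑ i, ‖a i‖) * (2 * ‖y‖) := by fun_prop
    filter_upwards [hs, hc.continuousAt.eventually_lt_const (by simpa using hd)] with y h1 h2
    exact IsGood.of_small hd hd1 h1 h2
  obtain ⟨y₁, h1, h1U⟩ : ∃ y₁, IsGood a b y₁ ∧ y₁ ∈ U := by
    have hdense : Dense U := hfin.countable.dense_compl ℝ
    obtain ⟨V, hV, hVo, h0⟩ := eventually_nhds_iff.1 hsmall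
    obtain ⟨y₁, h1, h2⟩ := hdense.inter_open_nonempty V hVo ⟨0, h0⟩
    exact ⟨y₁, hV _ h1, h2⟩
  refine hconn.induction₂' (fun y y' => IsGood a b y → IsGood a b y') ?_
    (fun _ _ _ _ _ _ h h' => h' ∘ h) h1U (hmem.2 ⟨hy, hr⟩) h1
  intro y₀ hy₀
  apply nhdsWithin_le_nhds
  obtain ⟨hne, hinj⟩ := hmem.1 hy₀
  obtain ⟨d, hd, hd1, hs⟩ := exists_separated hinj
  have hc : Continuous fun y : ℂ => (∑ i, ‖a i‖) * ‖y - y₀‖ := by fun_prop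
  have hc2 : Continuous fun y : ℂ => ‖y - y₀‖ := by fun_prop
  -- The local step must go both ways; transport from `y₀` to `y` needs `‖y - y₀‖ < ‖y‖`.
  have hc3 : Continuous fun y : ℂ => ‖y - y₀‖ - ‖y‖ := by fun_prop
  have hpos := norm_pos_iff.2 hne
  filter_upwards [hs, hc.continuousAt.eventually_lt_const (u := d) (by simpa using hd),
    hc2.continuousAt.eventually_lt_const (u := ‖y₀‖) (by simpa using hne),
    hc3.continuousAt.eventually_lt_const (u := 0) (by simpa using hne)] with y h1 h2 h3 h4
  refine ⟨IsGood.transport hd hd1 h1 ?_ ?_, IsGood.transport hd hd1 hs.self_of_nhds h2 h3⟩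
  · rwa [norm_sub_rev]
  · rw [norm_sub_rev]
    linarith

/-- In a fibre where punctures collide, the path is compact. It therefore remains in the complement,
with the same first coordinates, when `y₀` moves slightly to a regular value. -/
theorem isGood (hb : Function.Injective b) {y₀ : ℂ} (hy₀ : y₀ ≠ 0) : IsGood a b y₀ := by
  intro p q η hη hp hq
  have hp0 : p.1.2 = y₀ := by rw [← η.source]; exact hη 0
  have hq0 : q.1.2 = y₀ := by rw [← η.target]; exact hη 1
  have hcont : Continuous fun s => (η s).1.1 :=
    continuous_fst.comp (continuous_subtype_val.comp η.continuous)
  have hev : ∀ᶠ y in nhds y₀, (∀ s ∈ (Set.univ : Set I), y ≠ 0 ∧ ∀ i, (η s).1.1 ≠ a i * y + b i) ∧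
      farBound a b * (1 + ‖y‖) < ‖p.1.1‖ ∧ farBound a b * (1 + ‖y‖) < ‖q.1.1‖ := by
    have hc : Continuous fun y : ℂ => farBound a b * (1 + ‖y‖) := by fun_prop
    refine Filter.Eventually.and ?_ (Filter.Eventually.and ?_ ?_)
    · refine isCompact_univ.eventually_forall_of_forall_eventually fun s _ => ?_
      have h1 : ∀ᶠ z : ℂ × I in nhds (y₀, s), z.1 ≠ 0 := continuousAt_fst.eventually_ne hy₀
      have h2 : ∀ i, ∀ᶠ z : ℂ × I in nhds (y₀, s), (η z.2).1.1 ≠ a i * z.1 + b i := fun i => by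
        have hc : Continuous fun z : ℂ × I => (η z.2).1.1 - (a i * z.1 + b i) :=
          (hcont.comp continuous_snd).sub (by fun_prop)
        have h := (η s).2.2 i
        rw [hη s] at h
        filter_upwards [(hc.continuousAt (x := (y₀, s))).eventually_ne (sub_ne_zero.2 h)] with z hz
        exact sub_ne_zero.1 hz
      filter_upwards [h1, Filter.eventually_all.2 h2] with z hz1 hz2 using ⟨hz1, hz2⟩
    · exact hc.continuousAt.eventually_lt_const (hp0 ▸ hp)
    · exact hc.continuousAt.eventually_lt_const (hq0 ▸ hq)
  obtain ⟨ε, hε, hball⟩ := Metric.eventually_nhds_iff_ball.1 hev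
  have hdense := (finite_special (a := a) hb).countable.dense_compl ℝ
  obtain ⟨y₁, h1, h1U⟩ := hdense.inter_open_nonempty _ Metric.isOpen_ball
    ⟨y₀, Metric.mem_ball_self hε⟩
  have h1U' : y₁ ≠ 0 ∧ Function.Injective fun i => a i * y₁ + b i := by
    simpa [not_or] using h1U
  have hseg : ∀ r : I, y₀ + r * (y₁ - y₀) ∈ Metric.ball y₀ ε := by
    intro r
    rw [mem_ball_iff_norm] at h1 ⊢
    rw [add_sub_cancel_left, norm_mul, Complex.norm_real, Real.norm_of_nonneg r.2.1]
    exact (mul_le_of_le_one_left (norm_nonneg _) r.2.2).trans_lt h1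
  let F : I → I → LineSpace a b := fun s r => ⟨((η s).1.1, y₀ + r * (y₁ - y₀)),
    (hball _ (hseg r)).1 s trivial⟩
  have hF : Continuous (Function.uncurry F) :=
    Continuous.subtype_mk (Continuous.prodMk (hcont.comp continuous_fst) (by fun_prop)) _
  have h0 : ∀ r, IsFar (F 0 r) := by
    intro r
    change farBound a b * (1 + ‖y₀ + r * (y₁ - y₀)‖) < ‖(η 0).1.1‖
    rw [η.source]
    exact (hball _ (hseg r)).2.1
  have h1 : ∀ r, IsFar (F 1 r) := by
    intro r
    change farBound a b * (1 + ‖y₀ + r * (y₁ - y₀)‖) < ‖(η 1).1.1‖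
    rw [η.target]
    exact (hball _ (hseg r)).2.2
  refine rotCommutes_of_deformation hF η (fun s => ?_) h0 h1 fun δ hδ => ?_
  · refine Subtype.ext (Prod.ext rfl ?_)
    change (η s).1.2 = y₀ + ((0 : I) : ℝ) * (y₁ - y₀)
    rw [hη s, Set.Icc.coe_zero, Complex.ofReal_zero, zero_mul, add_zero]
  · refine isGood_of_regular hb h1U'.1 h1U'.2 _ _ δ (fun s => ?_) (h0 1) (h1 1)
    rw [hδ s]
    change y₀ + ((1 : I) : ℝ) * (y₁ - y₀) = y₁
    rw [Set.Icc.coe_one, Complex.ofReal_one, one_mul, add_sub_cancel]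

end Goodness

/-! ### The rotation loop is central -/

section Centrality

variable {ι : Type*} [Fintype ι] {a b : ι → ℂ}

theorem exists_path_compl (p : LineSpace a b) : ∃ (x : ℂ) (ρ : Path p.1.1 x),
    farBound a b * (1 + ‖p.1.2‖) < ‖x‖ ∧ ∀ s i, ρ s ≠ a i * p.1.2 + b i := by
  let S : Set ℂ := Set.range fun i => a i * p.1.2 + b i
  have hconn : IsPathConnected Sᶜ := (Set.finite_range _).countable.isPathConnected_compl_of_one_lt_rank
    (Complex.rank_real_complex ▸ Nat.one_lt_ofNat)
  have hM := one_le_farBound a b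
  let x : ℂ := ((farBound a b * (1 + ‖p.1.2‖) + 1 : ℝ) : ℂ)
  have hx : farBound a b * (1 + ‖p.1.2‖) < ‖x‖ := by
    rw [Complex.norm_real, Real.norm_of_nonneg (by positivity)]
    exact lt_add_one _
  have h1 : p.1.1 ∈ Sᶜ := by
    rintro ⟨i, hi⟩
    exact p.2.2 i hi.symm
  have h2 : x ∈ Sᶜ := by
    rintro ⟨i, hi⟩
    exact ne_of_far a b hx i hi.symm
  obtain ⟨ρ, hρ⟩ := hconn.joinedIn _ h1 _ h2
  exact ⟨x, ρ, hx, fun s i h => hρ s ⟨i, h.symm⟩⟩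

theorem exists_fibre_path (p : LineSpace a b) : ∃ (q : LineSpace a b) (ρ : Path p q), IsFar q ∧
    ∀ s, (ρ s).1.2 = p.1.2 := by
  obtain ⟨x, ρ, hx, hρ⟩ := exists_path_compl p
  exact ⟨⟨(x, p.1.2), p.2.1, ne_of_far a b hx⟩,
    ⟨⟨fun s => ⟨(ρ s, p.1.2), p.2.1, hρ s⟩, Continuous.subtype_mk (by fun_prop) _⟩,
      Subtype.ext (Prod.ext ρ.source rfl), Subtype.ext (Prod.ext ρ.target rfl)⟩, hx, fun _ => rfl⟩

/-- Locally, paths in the total space can be moved to paths of far points along the fibres. -/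
theorem exists_local_deformation (p₀ : LineSpace a b) : ∃ W : Set (LineSpace a b), IsOpen W ∧
    p₀ ∈ W ∧ ∀ {p q : LineSpace a b} (γ : Path p q), (∀ t, γ t ∈ W) →
      ∃ (p' q' : LineSpace a b) (α : Path p p') (β : Path q q'), (∀ s, (α s).1.2 = p.1.2) ∧
        (∀ s, (β s).1.2 = q.1.2) ∧ RotCommutes ((Path.Homotopic.Quotient.mk α).symm.trans
          ((Path.Homotopic.Quotient.mk γ).trans (.mk β))) := by
  obtain ⟨x, ρ, hx, hρ⟩ := exists_path_compl p₀
  -- The path `ρ` is corrected by a displacement that dies out: it starts at the first coordinate of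
  -- `p` and ends at the fixed far value `x`.
  let h : LineSpace a b → I → ℂ := fun p s => ρ s + (1 - s) * (p.1.1 - p₀.1.1)
  have hval : Continuous fun p : LineSpace a b => p.1 := continuous_subtype_val
  have hval1 : Continuous fun z : LineSpace a b × I => z.1.1.1 :=
    continuous_fst.comp (hval.comp continuous_fst)
  have hval2 : Continuous fun z : LineSpace a b × I => z.1.1.2 :=
    continuous_snd.comp (hval.comp continuous_fst)
  have hh : Continuous fun z : LineSpace a b × I => h z.1 z.2 := by
    fun_prop
  have hev : ∀ᶠ p in nhds p₀, (∀ s ∈ (Set.univ : Set I), ∀ i, h p s ≠ a i * p.1.2 + b i) ∧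
      farBound a b * (1 + ‖p.1.2‖) < ‖x‖ := by
    refine Filter.Eventually.and ?_ ?_
    · refine isCompact_univ.eventually_forall_of_forall_eventually fun s _ => ?_
      refine Filter.eventually_all.2 fun i => ?_
      have hc : Continuous fun z : LineSpace a b × I => h z.1 z.2 - (a i * z.1.1.2 + b i) := by
        fun_prop
      have h1 : h p₀ s ≠ a i * p₀.1.2 + b i := by simpa [h] using hρ s i
      filter_upwards [(hc.continuousAt (x := (p₀, s))).eventually_ne (sub_ne_zero.2 h1)] with z hz
      exact sub_ne_zero.1 hz
    · have hc : Continuous fun p : LineSpace a b => farBound a b * (1 + ‖p.1.2‖) := by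
        have := continuous_snd.comp hval
        fun_prop
      exact hc.continuousAt.eventually_lt_const hx
  obtain ⟨W, hW, hWo, hp₀⟩ := eventually_nhds_iff.1 hev
  refine ⟨W, hWo, hp₀, fun {p q} γ hγ => ?_⟩
  let F : I → I → LineSpace a b := fun t s => ⟨(h (γ t) s, (γ t).1.2), (γ t).2.1,
    (hW _ (hγ t)).1 s trivial⟩
  have hF : Continuous (Function.uncurry F) := by
    have h1 : Continuous fun z : I × I => (γ z.1, z.2) := by fun_prop
    exact Continuous.subtype_mk (Continuous.prodMk (hh.comp h1) (hval2.comp h1)) _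
  have h0 : ∀ t, F t 0 = γ t := fun t => Subtype.ext (Prod.ext (by simp [F, h]) rfl)
  have h1 : ∀ t, IsFar (F t 1) := by
    intro t
    have h2 : h (γ t) 1 = x := by simp [h]
    change farBound a b * (1 + ‖(γ t).1.2‖) < ‖h (γ t) 1‖
    rw [h2]
    exact (hW _ (hγ t)).2
  let δ : Path (F 0 1) (F 1 1) := ⟨⟨fun t => F t 1, by fun_prop⟩, rfl, rfl⟩
  let α : Path p (F 0 1) := ⟨⟨F 0, by fun_prop⟩, (h0 0).trans γ.source, rfl⟩
  let β : Path q (F 1 1) := ⟨⟨F 1, by fun_prop⟩, (h0 1).trans γ.target, rfl⟩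
  have hsq := square_homotopic hF (p := γ) (q := δ) (l := α) (r := β) (fun t => (h0 t).symm)
    (fun _ => rfl) (fun _ => rfl) (fun _ => rfl)
  refine ⟨F 0 1, F 1 1, α, β, fun s => ?_, fun s => ?_, ?_⟩
  · change (γ 0).1.2 = _
    rw [γ.source]
  · change (γ 1).1.2 = _
    rw [γ.target]
  · rw [hsq, ← Path.Homotopic.Quotient.trans_assoc, Path.Homotopic.Quotient.symm_trans,
      Path.Homotopic.Quotient.refl_trans]
    exact rotCommutes_of_far δ h1

/-- Changing the tails `α` and `β` within their fibres is harmless by `isGood`. The property is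
therefore compatible with concatenation, and `path_induction` reduces it to the local deformation.
-/
theorem rotCommutes_of_fibre_paths (hb : Function.Injective b) {p q : LineSpace a b}
    (γ : Path.Homotopic.Quotient p q) : ∀ (p' q' : LineSpace a b) (α : Path p p') (β : Path q q'),
      (∀ s, (α s).1.2 = p.1.2) → (∀ s, (β s).1.2 = q.1.2) → IsFar p' → IsFar q' →
        RotCommutes ((Path.Homotopic.Quotient.mk α).symm.trans (γ.trans (.mk β))) := by
  choose W hWo hW hloc using fun p₀ : LineSpace a b => exists_local_deformation p₀
  have hfib : ∀ {p p' p'' : LineSpace a b} (α : Path p p') (α₀ : Path p p''),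
      (∀ s, (α s).1.2 = p.1.2) → (∀ s, (α₀ s).1.2 = p.1.2) → IsFar p' → IsFar p'' →
      RotCommutes ((Path.Homotopic.Quotient.mk α).symm.trans (.mk α₀)) := by
    intro p p' p'' α α₀ hα hα₀ hp' hp''
    rw [← Path.Homotopic.Quotient.mk_symm, ← Path.Homotopic.Quotient.mk_trans]
    refine isGood hb p.2.1 _ _ (α.symm.trans α₀) (fun s => ?_) hp' hp''
    rw [Path.trans_apply]
    split_ifs
    · exact hα _
    · exact hα₀ _
  refine path_induction W hWo (fun p => ⟨p, hW p⟩) (fun {p q} γ => ∀ (p' q' : LineSpace a b)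
    (α : Path p p') (β : Path q q'), (∀ s, (α s).1.2 = p.1.2) → (∀ s, (β s).1.2 = q.1.2) →
      IsFar p' → IsFar q' →
        RotCommutes ((Path.Homotopic.Quotient.mk α).symm.trans (γ.trans (.mk β)))) ?_ ?_ γ
  · intro x y z γ γ' h h' p' q' α β hα hβ hp' hq'
    obtain ⟨y', μ, hy', hμ⟩ := exists_fibre_path y
    have h1 := (h _ _ α μ hα hμ hp' hy').trans (h' _ _ μ β hμ hβ hy' hq')
    simp only [Path.Homotopic.Quotient.trans_assoc] at h1 ⊢
    rwa [← Path.Homotopic.Quotient.trans_assoc (Path.Homotopic.Quotient.mk μ),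
      Path.Homotopic.Quotient.trans_symm, Path.Homotopic.Quotient.refl_trans] at h1
  · intro p₀ p q γ hγ p' q' α β hα hβ hp' hq'
    obtain ⟨p'', q'', α₀, β₀, hα₀, hβ₀, h⟩ := hloc p₀ γ hγ
    have hp'' : IsFar p'' := h.choose
    have hq'' : IsFar q'' := h.choose_spec.choose
    have h1 := ((hfib α α₀ hα hα₀ hp' hp'').trans h).trans (hfib β₀ β hβ₀ hβ hq'' hq')
    simp only [Path.Homotopic.Quotient.trans_assoc] at h1
    rwa [← Path.Homotopic.Quotient.trans_assoc (Path.Homotopic.Quotient.mk α₀),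
      Path.Homotopic.Quotient.trans_symm, Path.Homotopic.Quotient.refl_trans,
      ← Path.Homotopic.Quotient.trans_assoc (Path.Homotopic.Quotient.mk β₀),
      Path.Homotopic.Quotient.trans_symm, Path.Homotopic.Quotient.refl_trans] at h1

/-- The class of the loop that rotates the second coordinate. -/
def rotClass {u : LineSpace a b} (hu : IsFar u) : FundamentalGroup (LineSpace a b) u :=
  Path.Homotopic.Quotient.mk (rotLoop hu)

theorem rotClass_mem_center (hb : Function.Injective b) {u : LineSpace a b} (hu : IsFar u) :
    rotClass hu ∈ Subgroup.center (FundamentalGroup (LineSpace a b) u) := by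
  rw [Subgroup.mem_center_iff]
  intro γ
  obtain ⟨_, _, h⟩ := rotCommutes_of_fibre_paths hb γ _ _ (Path.refl u) (Path.refl u)
    (fun _ => rfl) (fun _ => rfl) hu hu
  rw [← Path.Homotopic.Quotient.mk_symm, Path.refl_symm, Path.Homotopic.Quotient.mk_refl,
    Path.Homotopic.Quotient.refl_trans, Path.Homotopic.Quotient.trans_refl] at h
  exact h

variable (a b)

/-- The second coordinate. -/
def sndCoord : C(LineSpace a b, PuncturedPlane) where
  toFun p := ⟨p.1.2, p.2.1⟩
  continuous_toFun := Continuous.subtype_mk (continuous_snd.comp continuous_subtype_val) _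

/-- The equation of a line. -/
def lineCoord (i : ι) : C(LineSpace a b, PuncturedPlane) where
  toFun p := ⟨p.1.1 - (a i * p.1.2 + b i), sub_ne_zero.2 (p.2.2 i)⟩
  continuous_toFun := Continuous.subtype_mk (by
    have h : Continuous fun p : LineSpace a b => p.1 := continuous_subtype_val
    fun_prop) _

variable {a b}

theorem incr_sndCoord_rotClass {u : LineSpace a b} (hu : IsFar u) :
    incr (sndCoord a b) (rotClass hu) = 2 * Real.pi * Complex.I := by
  rw [rotClass, incr_mk (sndCoord a b) (rotLoop hu)
    (fun θ => Complex.log u.1.2 + θ * (2 * Real.pi * Complex.I)) (by fun_prop)]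
  · simp
  · intro θ
    rw [Complex.exp_add, Complex.exp_log u.2.1, mul_comm]
    rfl

/-- For a far point `(a i * y + b i) / x` has norm less than one, so the principal branch of `log (1
- (a i * y + b i) / x)` is continuous along the loop and returns to its initial value. -/
theorem incr_lineCoord_rotClass {u : LineSpace a b} (hu : IsFar u) (i : ι) :
    incr (lineCoord a b i) (rotClass hu) = 0 := by
  have hlt : ∀ θ : I, ‖(a i * (rotate hu θ).1.2 + b i) / u.1.1‖ < 1 := by
    intro θ
    have h1 := norm_line_le a b i (rotate hu θ).1.2
    have h2 : ‖(rotate hu θ).1.2‖ = ‖u.1.2‖ := by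
      have : (θ * (2 * Real.pi * Complex.I) : ℂ) = ((θ * (2 * Real.pi) : ℝ) : ℂ) * Complex.I := by
        push_cast; ring
      change ‖Complex.exp _ * u.1.2‖ = _
      rw [norm_mul, this, Complex.norm_exp_ofReal_mul_I, one_mul]
    have h3 : farBound a b * (1 + ‖u.1.2‖) < ‖u.1.1‖ := hu
    rw [h2] at h1
    have h4 : 0 < ‖u.1.1‖ := lt_of_le_of_lt (by
      have := one_le_farBound a b
      positivity) h3
    rw [norm_div, div_lt_one h4]
    linarith
  have hu0 : u.1.1 ≠ 0 := by
    intro h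
    have h3 : farBound a b * (1 + ‖u.1.2‖) < ‖u.1.1‖ := hu
    rw [h, norm_zero] at h3
    have := one_le_farBound a b
    have : 0 ≤ farBound a b * (1 + ‖u.1.2‖) := by positivity
    linarith
  have hslit : ∀ θ : I, 1 - (a i * (rotate hu θ).1.2 + b i) / u.1.1 ∈ Complex.slitPlane := by
    intro θ
    left
    rw [Complex.sub_re, Complex.one_re, sub_pos]
    exact (Complex.re_le_norm _).trans_lt (hlt θ)
  have hcont : Continuous fun θ : I => (rotate hu θ).1.2 := by
    unfold rotate
    fun_prop
  rw [rotClass, incr_mk (lineCoord a b i) (rotLoop hu) (fun θ => Complex.log u.1.1 +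
    Complex.log (1 - (a i * (rotate hu θ).1.2 + b i) / u.1.1))
    (continuous_const.add (Continuous.clog (by fun_prop) hslit))]
  · have h0 : rotate hu ((0 : I) : ℝ) = rotate hu ((1 : I) : ℝ) :=
      (rotLoop hu).source.trans (rotLoop hu).target.symm
    rw [h0, sub_self]
  · intro θ
    rw [Complex.exp_add, Complex.exp_log hu0, Complex.exp_log (Complex.slitPlane_ne_zero (hslit θ)),
      mul_sub, mul_one, mul_div_cancel₀ _ hu0]
    rfl

theorem exists_central (hb : Function.Injective b) (p : LineSpace a b) :
    ∃ z ∈ Subgroup.center (FundamentalGroup (LineSpace a b) p),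
      incr (sndCoord a b) z = 2 * Real.pi * Complex.I ∧ ∀ i, incr (lineCoord a b i) z = 0 := by
  obtain ⟨q, ρ, hq, -⟩ := exists_fibre_path p
  refine ⟨conjHom (.mk ρ) (rotClass hq), ?_, ?_, fun i => ?_⟩
  · rw [Subgroup.mem_center_iff]
    intro w
    obtain ⟨w, rfl⟩ := (conjHom_bijective (Path.Homotopic.Quotient.mk ρ)).2 w
    rw [← map_mul, ← map_mul, Subgroup.mem_center_iff.1 (rotClass_mem_center hb hq) w]
  · rw [incr_conjHom, incr_sndCoord_rotClass]
  · rw [incr_conjHom, incr_lineCoord_rotClass]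

end Centrality
end HigherOrderDegree
end

noncomputable section
namespace HigherOrderDegree

open scoped unitInterval

/-! ### Exchanging the distinguished line with the line at infinity -/

section Swap

theorem fundamentalGroup_map_bijective {X Y : Type*} [TopologicalSpace X] [TopologicalSpace Y]
    (e : X ≃ₜ Y) (p : X) : Function.Bijective (FundamentalGroup.map (e : C(X, Y)) p) := by
  constructor
  · intro γ γ' h
    change Path.Homotopic.Quotient.map γ (e : C(X, Y)) =
      Path.Homotopic.Quotient.map γ' (e : C(X, Y)) at h
    induction γ using Path.Homotopic.Quotient.ind with | mk γ => ?_
    induction γ' using Path.Homotopic.Quotient.ind with | mk γ' => ?_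
    rw [← Path.Homotopic.Quotient.mk_map, ← Path.Homotopic.Quotient.mk_map,
      Path.Homotopic.Quotient.eq] at h
    have H := h.map (e.symm : C(Y, X))
    have hp : p = e.symm (e p) := (e.symm_apply_apply p).symm
    refine Path.Homotopic.Quotient.eq.2 ?_
    convert H.pathCast hp hp using 1
    · ext t
      exact (e.symm_apply_apply (γ t)).symm
    · ext t
      exact (e.symm_apply_apply (γ' t)).symm
  · intro τ
    induction τ using Path.Homotopic.Quotient.ind with | mk τ => ?_
    let γ : Path p p :=
      { toFun := fun s => e.symm (τ s)
        source' := by rw [τ.source]; exact e.symm_apply_apply p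
        target' := by rw [τ.target]; exact e.symm_apply_apply p }
    refine ⟨Path.Homotopic.Quotient.mk γ, ?_⟩
    change Path.Homotopic.Quotient.map (.mk γ) (e : C(X, Y)) = _
    rw [← Path.Homotopic.Quotient.mk_map]
    congr 1
    ext t
    exact e.apply_symm_apply (τ t)

theorem exists_central_comap {X Y : Type*} [TopologicalSpace X] [TopologicalSpace Y]
    (e : X ≃ₜ Y) (p : X) {z : FundamentalGroup Y (e p)} (hz : z ∈ Subgroup.center _) :
    ∃ w ∈ Subgroup.center (FundamentalGroup X p), ∀ g : C(Y, PuncturedPlane),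
      incr (g.comp (e : C(X, Y))) w = incr g z := by
  obtain ⟨hinj, hsurj⟩ := fundamentalGroup_map_bijective e p
  obtain ⟨w, rfl⟩ := hsurj z
  refine ⟨w, Subgroup.mem_center_iff.2 fun γ => hinj ?_, fun g => (incr_map g _ w).symm⟩
  rw [map_mul, map_mul]
  exact Subgroup.mem_center_iff.1 hz _

variable {ι : Type*} {a b : ι → ℂ}

theorem swap_mem {p : ℂ × ℂ} (hp : p.2 ≠ 0 ∧ ∀ i, p.1 ≠ a i * p.2 + b i) :
    p.2⁻¹ ≠ 0 ∧ ∀ i, p.1 / p.2 ≠ b i * p.2⁻¹ + a i := by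
  refine ⟨inv_ne_zero hp.1, fun i h => hp.2 i ?_⟩
  have := hp.1
  field_simp at h
  linear_combination h

variable (a b) in
/-- The projective change of coordinates that exchanges the line `y = 0` with the line at
infinity. -/
def swapHomeomorph : LineSpace a b ≃ₜ LineSpace b a where
  toFun p := ⟨(p.1.1 / p.1.2, p.1.2⁻¹), swap_mem p.2⟩
  invFun p := ⟨(p.1.1 / p.1.2, p.1.2⁻¹), swap_mem p.2⟩
  left_inv p := Subtype.ext (Prod.ext (by
    have := p.2.1
    change p.1.1 / p.1.2 / p.1.2⁻¹ = p.1.1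
    field_simp) (inv_inv _))
  right_inv p := Subtype.ext (Prod.ext (by
    have := p.2.1
    change p.1.1 / p.1.2 / p.1.2⁻¹ = p.1.1
    field_simp) (inv_inv _))
  continuous_toFun := by
    have h : Continuous fun p : LineSpace a b => p.1 := continuous_subtype_val
    exact Continuous.subtype_mk (((continuous_fst.comp h).div (continuous_snd.comp h)
      fun p => p.2.1).prodMk ((continuous_snd.comp h).inv₀ fun p => p.2.1)) _
  continuous_invFun := by
    have h : Continuous fun p : LineSpace b a => p.1 := continuous_subtype_val
    exact Continuous.subtype_mk (((continuous_fst.comp h).div (continuous_snd.comp h)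
      fun p => p.2.1).prodMk ((continuous_snd.comp h).inv₀ fun p => p.2.1)) _

variable [Fintype ι]

/-- In the new coordinates `x' = x / y`, `y' = 1 / y` the loop winds once around `y' = 0`, so `y`
winds by `-1`. The same `-1` appears for each line since `x - (a i * y + b i) = y * (x' - (b i * y'
+ a i))`. -/
theorem exists_central_swap (ha : Function.Injective a) (p : LineSpace a b) :
    ∃ z ∈ Subgroup.center (FundamentalGroup (LineSpace a b) p),
      incr (sndCoord a b) z = -(2 * Real.pi * Complex.I) ∧
      ∀ i, incr (lineCoord a b i) z = -(2 * Real.pi * Complex.I) := by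
  obtain ⟨z, hz, h1, h2⟩ := exists_central ha (swapHomeomorph a b p)
  obtain ⟨w, hw, h⟩ := exists_central_comap (swapHomeomorph a b) p hz
  have hsnd : incr (sndCoord a b) w = -(2 * Real.pi * Complex.I) := by
    have h3 := incr_mul (f := ContinuousMap.const _ (⟨1, one_ne_zero⟩ : PuncturedPlane))
      (g := sndCoord a b) (h := (sndCoord b a).comp (swapHomeomorph a b : C(LineSpace a b, LineSpace b a)))
      (fun q => (mul_inv_cancel₀ q.2.1).symm) w
    rw [incr_const 1 (fun _ => rfl), h, h1] at h3
    linear_combination -h3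
  refine ⟨w, hw, hsnd, fun i => ?_⟩
  rw [incr_mul (f := lineCoord a b i) (g := sndCoord a b)
    (h := (lineCoord b a i).comp (swapHomeomorph a b : C(LineSpace a b, LineSpace b a))) (fun q => ?_), hsnd, h, h2,
    add_zero]
  have := q.2.1
  change q.1.1 - (a i * q.1.2 + b i) = q.1.2 * (q.1.1 / q.1.2 - (b i * q.1.2⁻¹ + a i))
  field_simp
  ring

theorem curveDegree_of_homeomorph_lineSpace [Nonempty ι] {f : MvPolynomial (Fin 2) ℂ}
    (ha : Function.Injective a) (hb : Function.Injective b) (e : Complement f ≃ₜ LineSpace a b)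
    (K : ℂ) (h : ∀ p, MvPolynomial.eval p.1 f =
      K * ((e p).1.2 * ∏ i, ((e p).1.1 - (a i * (e p).1.2 + b i)))) (u : Complement f) (n : ℕ) :
    curveDegree f u n = 0 := by
  obtain ⟨z₁, hz₁, hs₁, hl₁⟩ := exists_central hb (e u)
  obtain ⟨z₂, hz₂, hs₂, hl₂⟩ := exists_central_swap (b := b) ha (e u)
  -- `z₂` contributes `-1` for each of the `Fintype.card ι + 1` lines and `z₁` contributes `1` for
  -- `y = 0` only, so the total linking number cancels. The linking number with each remaining line
  -- is still `-1`.
  have hz := mul_mem hz₂ (pow_mem hz₁ (Fintype.card ι + 1))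
  have hincr : ∀ g : C(LineSpace a b, PuncturedPlane),
      incr g (z₂ * z₁ ^ (Fintype.card ι + 1) : FundamentalGroup _ (e u)) =
        incr g z₂ + (Fintype.card ι + 1 : ℕ) * incr g z₁ := by
    intro g
    rw [← incrHom_apply, map_mul, map_pow, toAdd_mul, toAdd_pow, incrHom_apply, incrHom_apply,
      nsmul_eq_mul]
  obtain ⟨w, hw, hwz⟩ := exists_central_comap e u hz
  have hker : incr (evalMap f) w = 0 := by
    rw [incr_prod (Finset.univ : Finset (Option ι)) (g := fun o => o.elim
      ((sndCoord a b).comp (e : C(Complement f, LineSpace a b))) fun i => (lineCoord a b i).comp (e : C(Complement f, LineSpace a b))) K]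
    · rw [Fintype.sum_option]
      simp only [Option.elim_none, Option.elim_some, hwz, hincr, hs₁, hs₂, hl₁, hl₂, mul_zero,
        add_zero, Finset.sum_const, Finset.card_univ, nsmul_eq_mul]
      push_cast
      ring
    · intro p
      rw [Fintype.prod_option]
      exact h p
  obtain ⟨i⟩ := ‹Nonempty ι›
  refine degree_eq_zero_of_central (linking f u) n hw ?_ fun hn => ?_
  · rw [← MonoidHom.mem_ker, ker_linking, mem_ker_incrHom]
    exact hker
  · have h1 := mem_ker_incrHom.1 (rationalDerivedSeries_le_ker_incrHom
      ((lineCoord a b i).comp (e : C(Complement f, LineSpace a b))) u n hn)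
    rw [hwz, hincr, hl₁, hl₂, mul_zero, add_zero] at h1
    exact Complex.two_pi_I_ne_zero (neg_eq_zero.1 h1)

end Swap

/-! ### Arrangements with a nodal line -/

section NodalLine

theorem curveDegree_of_nodal_line {m : ℕ} (L : Fin m → Line) (hL : GeneralPositionAtInfinity L)
    (hnode : HasNodalLine L) (u : Complement (arrangementPoly L)) (n : ℕ) :
    curveDegree (arrangementPoly L) u n = 0 := by
  classical
  obtain ⟨i₀, hi₀⟩ := hnode
  let ι := {j : Fin m // j ≠ i₀}
  rcases isEmpty_or_nonempty ι with hι | hι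
  · have hm : m = 1 := by
      have h1 : Fintype.card (Fin m) = 1 := Fintype.card_eq_one_iff.2 ⟨i₀, fun j => by
        by_contra hj
        exact hι.elim ⟨j, hj⟩⟩
      rwa [Fintype.card_fin] at h1
    subst hm
    exact curveDegree_of_single_line L u n
  obtain ⟨r, s, hrs⟩ := (L i₀).exists_complement
  let α : ι → ℂ := fun j => (L j).a * s - (L j).b * r
  let β : ι → ℂ := fun j => (L i₀).a * (L j).b - (L i₀).b * (L j).a
  have hβ : ∀ j, β j ≠ 0 := fun j h => hL i₀ j j.2.symm (by
    simp only [β] at h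
    unfold Line.Parallel
    linear_combination h)
  let a : ι → ℂ := fun j => -(α j / β j)
  let b : ι → ℂ := fun j => (α j * (L i₀).c - (L j).c) / β j
  let y : (Fin 2 → ℂ) → ℂ := fun p => (L i₀).a * p 0 + (L i₀).b * p 1 + (L i₀).c
  let x : (Fin 2 → ℂ) → ℂ := fun p => r * p 0 + s * p 1
  let w : ℂ × ℂ → Fin 2 → ℂ := fun q => ![s * (q.2 - (L i₀).c) - (L i₀).b * q.1,
    (L i₀).a * q.1 - r * (q.2 - (L i₀).c)]
  have hline : ∀ (j : ι) p, MvPolynomial.eval p (L j).poly =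
      β j * (x p - (a j * y p + b j)) := by
    intro j p
    have hβj := hβ j
    have h1 : β j * (x p - (a j * y p + b j)) =
        β j * x p + α j * y p - (α j * (L i₀).c - (L j).c) := by
      simp only [a, b]
      field_simp
      ring
    rw [h1, Line.eval_poly]
    simp only [α, β, x, y]
    linear_combination (-(L j).a * p 0 - (L j).b * p 1) * hrs
  have hline₀ : ∀ p, MvPolynomial.eval p (L i₀).poly = y p := fun p => Line.eval_poly _ p
  have hyw : ∀ q, y (w q) = q.2 := by
    intro q
    simp only [y, w, Matrix.cons_val_zero, Matrix.cons_val_one, Matrix.cons_val_fin_one]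
    linear_combination (q.2 - (L i₀).c) * hrs
  have hxw : ∀ q, x (w q) = q.1 := by
    intro q
    simp only [x, w, Matrix.cons_val_zero, Matrix.cons_val_one, Matrix.cons_val_fin_one]
    linear_combination q.1 * hrs
  have hwxy : ∀ p, w (x p, y p) = p := by
    intro p
    ext i
    fin_cases i
    · simp only [w, x, y, Fin.zero_eta, Matrix.cons_val_zero]
      linear_combination p 0 * hrs
    · simp only [w, x, y, Fin.mk_one, Matrix.cons_val_one, Matrix.cons_val_fin_one]
      linear_combination p 1 * hrs
  have ha : Function.Injective a := by
    intro j k hjk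
    by_contra hne
    refine hL j k (fun h => hne (Subtype.ext h)) ?_
    have h1 : α j * β k = α k * β j := by
      have := neg_injective hjk
      rwa [div_eq_div_iff (hβ j) (hβ k)] at this
    simp only [α, β] at h1
    unfold Line.Parallel
    linear_combination h1 + ((L k).a * (L j).b - (L j).a * (L k).b) * hrs
  -- If `b j = b k`, the point with `x = b j`, `y = 0` lies on the distinguished line and on two
  -- further lines.
  have hb : Function.Injective b := by
    intro j k hjk
    by_contra hne
    refine hi₀ j k j.2 k.2 (fun h => hne (Subtype.ext h)) (w (b j, 0)) ?_ ⟨?_, ?_⟩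
    · change MvPolynomial.eval _ _ = 0
      rw [hline₀, hyw]
    · change MvPolynomial.eval _ _ = 0
      rw [hline, hxw, hyw]
      ring
    · change MvPolynomial.eval _ _ = 0
      rw [hline, hxw, hyw, hjk]
      ring
  have hf : ∀ p, MvPolynomial.eval p (arrangementPoly L) =
      y p * ∏ j : ι, (β j * (x p - (a j * y p + b j))) := by
    intro p
    rw [eval_arrangementPoly, Fintype.prod_eq_mul_prod_subtype_ne _ i₀, hline₀]
    simp only [← hline]
    rfl
  have hmem : ∀ p : Complement (arrangementPoly L), y p.1 ≠ 0 ∧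
      ∀ j, x p.1 ≠ a j * y p.1 + b j := by
    intro p
    have h := p.2
    rw [hf, mul_ne_zero_iff, Finset.prod_ne_zero_iff] at h
    exact ⟨h.1, fun j hj => h.2 j (Finset.mem_univ j) (by rw [hj, sub_self, mul_zero])⟩
  have hwmem : ∀ q : LineSpace a b, MvPolynomial.eval (w q.1) (arrangementPoly L) ≠ 0 := by
    intro q
    rw [hf, hyw, hxw]
    exact mul_ne_zero q.2.1 (Finset.prod_ne_zero_iff.2 fun j _ =>
      mul_ne_zero (hβ j) (sub_ne_zero.2 (q.2.2 j)))
  have hcw : Continuous w := by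
    refine continuous_pi fun i => ?_
    fin_cases i
    · simp only [w, Fin.zero_eta, Matrix.cons_val_zero]
      fun_prop
    · simp only [w, Fin.mk_one, Matrix.cons_val_one, Matrix.cons_val_fin_one]
      fun_prop
  have hcx : Continuous x := by fun_prop
  have hcy : Continuous y := by fun_prop
  have hcval : Continuous (Subtype.val : Complement (arrangementPoly L) → _) :=
    continuous_subtype_val
  let e : Complement (arrangementPoly L) ≃ₜ LineSpace a b :=
    { toFun := fun p => ⟨(x p.1, y p.1), hmem p⟩
      invFun := fun q => ⟨w q.1, hwmem q⟩
      left_inv := fun p => Subtype.ext (hwxy p.1)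
      right_inv := fun q => Subtype.ext (Prod.ext (hxw q.1) (hyw q.1))
      continuous_toFun := Continuous.subtype_mk ((hcx.comp hcval).prodMk (hcy.comp hcval)) _
      continuous_invFun := Continuous.subtype_mk (hcw.comp continuous_subtype_val) _ }
  refine curveDegree_of_homeomorph_lineSpace ha hb e (∏ j, β j) (fun p => ?_) u n
  rw [hf, Finset.prod_mul_distrib]
  change _ = _ * (y p.1 * ∏ j, (x p.1 - (a j * y p.1 + b j)))
  ring

end NodalLine
end HigherOrderDegree
end

open HigherOrderDegree in
theorem mainTheorem1 :
    (∀ L : Fin 3 → Line, GeneralPositionAtInfinity L → Concurrent L →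
      ∀ (u : Complement (arrangementPoly L)) (n : ℕ), curveDegree (arrangementPoly L) u n = 3) ∧
    (∀ L : Fin 4 → Line, GeneralPositionAtInfinity L → Concurrent L →
      ∀ (u : Complement (arrangementPoly L)) (n : ℕ), curveDegree (arrangementPoly L) u n = 8) ∧
    (∀ L : Fin 5 → Line, GeneralPositionAtInfinity L → Concurrent L →
      ∀ (u : Complement (arrangementPoly L)) (n : ℕ), curveDegree (arrangementPoly L) u n = 15) ∧
    (∀ (m : ℕ) (L : Fin m → Line), GeneralPositionAtInfinity L → HasNodalLine L →
      ∀ (u : Complement (arrangementPoly L)) (n : ℕ), curveDegree (arrangementPoly L) u n = 0) := by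
  refine ⟨fun L hL hp u n => ?_, fun L hL hp u n => ?_, fun L hL hp u n => ?_,
    fun m L hL hnode u n => curveDegree_of_nodal_line L hL hnode u n⟩
  · exact (curveDegree_of_concurrent (l := 1) L hL hp u n).trans (by norm_num)
  · exact (curveDegree_of_concurrent (l := 2) L hL hp u n).trans (by norm_num)
  · exact (curveDegree_of_concurrent (l := 3) L hL hp u n).trans (by norm_num)
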